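/- **Setting.** Let $G$ be a complete graph on the node set $\{0,\dots,n-1\}$, $n\ge 1$, with a weight $w_{uv}\in\{-1,1\}$ on each pair of distinct nodes. An edge $uv$ agrees with a partition $\mathcal C$ of the nodes if $w_{uv}=1$ and $u,v$ lie in the same cluster, or $w_{uv}=-1$ and $u,v$ lie in different clusters. Let $\mathrm{disagree}(G,\mathcal C)=\sum_{uv}|w_{uv}|-\sum_{uv\text{ agrees with }\mathcal C}|w_{uv}|$ and $\mathrm{min\text{-}disagree}(G)=\min_{\mathcal C}\mathrm{disagree}(G,\mathcal C)$. The graph is presented as a dynamic graph stream: a finite sequence of insertions (of absent edges) and deletions (of present edges), each item giving the edge and its weight, that starts with no edges and ends with exactly the edges of $G$ and their weights. A streaming program is a fixed randomized RAM program with initially empty memory that reads the stream once, in order, and that reads a sequence of independent fair random bits once, in order. It has read-only access to the parameters $n$, $t$ and $\lceil 1/\varepsilon\rceil$. Its space is the largest number of bits (of addresses and contents of the nonzero memory cells) that its memory holds at any moment, both while it processes the stream and afterwards. Its time is the total number of steps. **Theorem.** For every $c\in\mathbb N$ there are a single streaming program and constants $C,k$ such that for every $t\in\mathbb N$ there is a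 constant $D$ with the following property. Let $n\ge 1$ and $\varepsilon>0$, let $G$ be a unit-weight complete graph on $n$ nodes with $\mathrm{min\text{-}disagree}(G)\le t$, and let $\sigma$ be a dynamic graph stream of length $|\sigma|$ that presents $G$. Then 1. for every outcome of the random bits, the program halts, uses at most $C\,(n+\varepsilon^{-2}t)\,\log^k(n+2)$ bits of space, and takes at most $D\,(n\lceil 1/\varepsilon\rceil)^D(|\sigma|+1)$ steps. In particular, for fixed $t$, it runs in polynomial time and uses $\tilde O(n+\varepsilon^{-2}t)$ space; 2. except with probability at most $n^{-c}$, the program outputs a partition $\mathcal C$ and a rational number $v$ with $$\mathrm{disagree}(G,\mathcal C)\le(1+\varepsilon)\,\mathrm{min\text{-}disagree}(G)\quad\text{and}\quad \mathrm{min\text{-}disagree}(G)\le v\le(1+\varepsilon)\,\mathrm{min\text{-}disagree}(G).$$ -/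

import Mathlib

namespace CorrClust

/-! ### Correlation clustering on unit-weight graphs -/

/-- A complete graph on the nodes `0, …, n - 1` with a weight `1` or `-1` on every pair of distinct
nodes. (The values on the diagonal of `Sym2` are never used.) -/
abbrev UnitGraph (n : ℕ) : Type := Sym2 (Fin n) → ℤˣ

/-- The unordered pairs of distinct nodes, each listed once. -/
def pairs (n : ℕ) : Finset (Fin n × Fin n) := Finset.univ.filter fun p => p.1 < p.2

/-- The weight of the edge between two nodes. -/
def UnitGraph.weight {n : ℕ} (G : UnitGraph n) (p : Fin n × Fin n) : ℤ := (G s(p.1, p.2) : ℤ)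

/-- An edge agrees with a partition (given as an equivalence relation, "same cluster") if it is
positive and inside a cluster, or negative and between two clusters. -/
def Agrees {n : ℕ} (G : UnitGraph n) (P : Setoid (Fin n)) (p : Fin n × Fin n) : Prop :=
  (0 < G.weight p ∧ P p.1 p.2) ∨ (G.weight p < 0 ∧ ¬ P p.1 p.2)

open Classical in
/-- The total absolute weight of the edges that agree with the partition. -/
noncomputable def agree {n : ℕ} (G : UnitGraph n) (P : Setoid (Fin n)) : ℤ :=
  ∑ p ∈ (pairs n).filter (Agrees G P), |G.weight p|

/-- The total absolute weight of the edges that do not agree with the partition. -/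
noncomputable def disagree {n : ℕ} (G : UnitGraph n) (P : Setoid (Fin n)) : ℤ :=
  ∑ p ∈ pairs n, |G.weight p| - agree G P

/-- The minimum disagreement over all partitions (finitely many, and at least one). -/
noncomputable def minDisagree {n : ℕ} (G : UnitGraph n) : ℤ :=
  ⨅ P : Setoid (Fin n), disagree G P

/-- The infimum is a minimum: some partition attains it. -/
theorem minDisagree_spec {n : ℕ} (G : UnitGraph n) :
    (∃ P, disagree G P = minDisagree G) ∧ ∀ P, minDisagree G ≤ disagree G P := by
  have hf : Finite (Setoid (Fin n)) :=
    Finite.of_injective (fun (P : Setoid (Fin n)) (a b : Fin n) => P a b)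
      fun P Q h => Setoid.ext fun a b => iff_of_eq (congrFun (congrFun h a) b)
  have hb : BddBelow (Set.range (disagree G)) := (Set.finite_range _).bddBelow
  exact ⟨Int.csInf_mem (Set.range_nonempty _) hb, fun P => ciInf_le hb P⟩

/-! ### Dynamic graph streams -/

/-- A stream item: insertion or deletion of the edge `uv`; its weight is given in both cases. -/
inductive Update (n : ℕ) : Type
  | insert (u v : Fin n) (w : ℤˣ)
  | delete (u v : Fin n) (w : ℤˣ)

/-- The weighted edges that are present at some moment. -/
abbrev Present (n : ℕ) : Type := Sym2 (Fin n) → Option ℤˣ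

/-- `Leads E σ E'`: the stream `σ` is well formed when it starts from the edge set `E` (only absent
edges between distinct nodes are inserted, only present edges are deleted, with their current
weight), and it ends with the edge set `E'`. -/
inductive Leads {n : ℕ} : Present n → List (Update n) → Present n → Prop
  | nil (E : Present n) : Leads E [] E
  | insert {E E' : Present n} {σ : List (Update n)} {u v : Fin n} {w : ℤˣ} (huv : u ≠ v)
      (h : E s(u, v) = none) (hσ : Leads (Function.update E s(u, v) (some w)) σ E') :
      Leads E (Update.insert u v w :: σ) E'
  | delete {E E' : Present n} {σ : List (Update n)} {u v : Fin n} {w : ℤˣ}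
      (h : E s(u, v) = some w) (hσ : Leads (Function.update E s(u, v) none) σ E') :
      Leads E (Update.delete u v w :: σ) E'

/-- The stream starts with no edges and ends with the complete unit-weight graph `G`. -/
def IsStreamOf {n : ℕ} (σ : List (Update n)) (G : UnitGraph n) : Prop :=
  ∃ E : Present n, Leads (fun _ => none) σ E ∧ ∀ u v : Fin n, u ≠ v → E s(u, v) = some (G s(u, v))

/-- A stream item as a machine reads it. -/
structure Token where
  /-- `1` for an insertion, `0` for a deletion -/
  op : ℕ
  /-- first endpoint -/
  fst : ℕ
  /-- second endpoint -/
  snd : ℕ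
  /-- `1` for weight `1`, `0` for weight `-1` -/
  sign : ℕ

/-- The encoding of stream items as tokens. -/
def Update.token {n : ℕ} : Update n → Token
  | .insert u v w => ⟨1, u, v, if w = 1 then 1 else 0⟩
  | .delete u v w => ⟨0, u, v, if w = 1 then 1 else 0⟩

/-! ### Randomized single-pass streaming programs

A program is a fixed structured RAM program. It has finitely many arrays, each named by a constant
of the program and indexed by natural numbers, that hold natural numbers and are initially zero.
Its parameters are read-only. The stream can be read only forwards and only once, and so can the
sequence of random bits: whatever is to be remembered of either has to be stored in memory. (An expression is a
fixed term with finitely many nodes, so its evaluation takes time and space polynomial, respectively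
linear, in the bit lengths of its operands; all stored results count towards the memory.) -/

/-- Expressions. Comparisons give `1` for true and `0` for false; `sub` is truncated. -/
inductive Expr : Type
  | const (a : ℕ)
  | par (i : Fin 3)
  | load (x : ℕ) (i : Expr)
  | add (a b : Expr)
  | sub (a b : Expr)
  | mul (a b : Expr)
  | div (a b : Expr)
  | mod (a b : Expr)
  | lt (a b : Expr)
  | eq (a b : Expr)

/-- Programs. -/
inductive Prog : Type
  /-- do nothing -/
  | skip
  /-- write the value of `e` to the cell with index `i` of the array `x` -/
  | store (x : ℕ) (i e : Expr)
  /-- write a fresh fair random bit to the cell with index `0` of the array `x` -/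
  | flip (x : ℕ)
  /-- read the next stream item, if there is one, into the array `x` -/
  | next (x : ℕ)
  | seq (p q : Prog)
  /-- run `p` if the value of `e` is not zero, and `q` otherwise -/
  | ite (e : Expr) (p q : Prog)
  /-- run `p` as long as the value of `e` is not zero -/
  | while (e : Expr) (p : Prog)

/-- The memory: `M (x, i)` is the content of the cell with index `i` of the array `x`. -/
abbrev Memory : Type := (ℕ × ℕ) →₀ ℕ

/-- The number of bits in memory: for every nonzero cell, the bit lengths of its address and of its
content. -/
def Memory.bits (M : Memory) : ℕ := M.sum fun a b => Nat.size a.1 + Nat.size a.2 + Nat.size b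

/-- The value of an expression, given the parameters and the memory. -/
def Expr.eval (par : Fin 3 → ℕ) (M : Memory) : Expr → ℕ
  | .const a => a
  | .par i => par i
  | .load x i => M (x, i.eval par M)
  | .add a b => a.eval par M + b.eval par M
  | .sub a b => a.eval par M - b.eval par M
  | .mul a b => a.eval par M * b.eval par M
  | .div a b => a.eval par M / b.eval par M
  | .mod a b => a.eval par M % b.eval par M
  | .lt a b => if a.eval par M < b.eval par M then 1 else 0
  | .eq a b => if a.eval par M = b.eval par M then 1 else 0

/-- A configuration: the memory, the unread part of the stream, the number of random bits used. -/
structure Config where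
  mem : Memory
  stream : List Token
  used : ℕ

/-- The configuration with one cell overwritten. -/
noncomputable def Config.write (s : Config) (x i a : ℕ) : Config :=
  { s with mem := s.mem.update (x, i) a }

/-- The result of reading a stream item into the array `x`: cell `0` becomes `0` if the stream has
ended; otherwise it becomes `1`, and cells `1, 2, 3, 4` receive the item. -/
noncomputable def Config.next (s : Config) (x : ℕ) : Config :=
  match s.stream with
  | [] => s.write x 0 0
  | a :: l =>
    (((({ s with stream := l }.write x 0 1).write x 1 a.op).write x 2 a.fst).write x 3 a.snd).write
      x 4 a.sign

/-- `Exec par coin p s s' T S`: with parameters `par` and the sequence `coin` of random bits, the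
program `p`, started in `s`, halts in `s'` after `T` steps, and the memory never holds more than
`S` bits, `S` being the peak. Each assignment, random bit, stream read and test is one step. -/
inductive Exec (par : Fin 3 → ℕ) (coin : ℕ → Bool) : Prog → Config → Config → ℕ → ℕ → Prop
  | skip (s : Config) : Exec par coin .skip s s 1 s.mem.bits
  | store (x : ℕ) (i e : Expr) (s s' : Config)
      (h : s' = s.write x (i.eval par s.mem) (e.eval par s.mem)) :
      Exec par coin (.store x i e) s s' 1 (max s.mem.bits s'.mem.bits)
  | flip (x : ℕ) (s s' : Config)
      (h : s' = { s with used := s.used + 1 }.write x 0 (coin s.used).toNat) :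
      Exec par coin (.flip x) s s' 1 (max s.mem.bits s'.mem.bits)
  | next (x : ℕ) (s s' : Config) (h : s' = s.next x) :
      Exec par coin (.next x) s s' 1 (max s.mem.bits s'.mem.bits)
  | seq {p q : Prog} {s s' s'' : Config} {T T' S S' : ℕ} (hp : Exec par coin p s s' T S)
      (hq : Exec par coin q s' s'' T' S') :
      Exec par coin (.seq p q) s s'' (T + T') (max S S')
  | ite_true {e : Expr} {p q : Prog} {s s' : Config} {T S : ℕ} (he : e.eval par s.mem ≠ 0)
      (hp : Exec par coin p s s' T S) : Exec par coin (.ite e p q) s s' (T + 1) S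
  | ite_false {e : Expr} {p q : Prog} {s s' : Config} {T S : ℕ} (he : e.eval par s.mem = 0)
      (hq : Exec par coin q s s' T S) : Exec par coin (.ite e p q) s s' (T + 1) S
  | while_true {e : Expr} {p : Prog} {s s' s'' : Config} {T T' S S' : ℕ}
      (he : e.eval par s.mem ≠ 0) (hp : Exec par coin p s s' T S)
      (hw : Exec par coin (.while e p) s' s'' T' S') :
      Exec par coin (.while e p) s s'' (T + T' + 1) (max S S')
  | while_false {e : Expr} {p : Prog} {s : Config} (he : e.eval par s.mem = 0) :
      Exec par coin (.while e p) s s 1 s.mem.bits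

/-- Given the parameters and the random bits, an execution is deterministic. -/
theorem Exec.unique {par : Fin 3 → ℕ} {coin : ℕ → Bool} {p : Prog} {s s₁ s₂ : Config}
    {T₁ T₂ S₁ S₂ : ℕ} (h₁ : Exec par coin p s s₁ T₁ S₁)
    (h₂ : Exec par coin p s s₂ T₂ S₂) : s₁ = s₂ ∧ T₁ = T₂ ∧ S₁ = S₂ := by
  induction h₁ generalizing s₂ T₂ S₂ with
  | skip s => cases h₂; simp
  | store x i e s s' h => cases h₂; simp_all
  | flip x s s' h => cases h₂; simp_all
  | next x s s' h => cases h₂; simp_all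
  | seq hp hq ih1 ih2 =>
    cases h₂ with
    | seq a b => obtain ⟨rfl, rfl, rfl⟩ := ih1 a; obtain ⟨rfl, rfl, rfl⟩ := ih2 b; simp
  | ite_true he hp ih =>
    cases h₂ with
    | ite_true _ b => obtain ⟨rfl, rfl, rfl⟩ := ih b; simp
    | ite_false h _ => exact absurd h he
  | ite_false he hp ih =>
    cases h₂ with
    | ite_false _ b => obtain ⟨rfl, rfl, rfl⟩ := ih b; simp
    | ite_true h _ => exact absurd he h
  | while_true he hp hw ih1 ih2 =>
    cases h₂ with
    | while_true _ a b => obtain ⟨rfl, rfl, rfl⟩ := ih1 a; obtain ⟨rfl, rfl, rfl⟩ := ih2 b; simp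
    | while_false h => exact absurd h he
  | while_false he =>
    cases h₂ with
    | while_true h _ _ => exact absurd he h
    | while_false h => simp

/-- `Runs p n t ε σ coin M T S`: the program `p`, with the parameters `n`, `t` and `⌈1/ε⌉`, empty
memory and the input stream `σ`, halts with memory `M` after `T` steps and uses `S` bits of
memory. -/
def Runs (p : Prog) (n t : ℕ) (ε : ℝ) (σ : List (Update n)) (coin : ℕ → Bool) (M : Memory)
    (T S : ℕ) : Prop :=
  ∃ s : Config, Exec ![n, t, ⌈1 / ε⌉₊] coin p ⟨0, σ.map Update.token, 0⟩ s T S ∧ s.mem = M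

/-- The law of a sequence of independent fair random bits. -/
noncomputable def coinMeasure : MeasureTheory.Measure (ℕ → Bool) :=
  MeasureTheory.Measure.infinitePi fun _ => (PMF.uniformOfFintype Bool).toMeasure

/-- The partition in the output: the cluster of the node `v` is named by the cell with index `v` of
the array `1`. -/
def outPartition (n : ℕ) (M : Memory) : Setoid (Fin n) := Setoid.ker fun v => M (1, (v : ℕ))

/-- The estimate in the output: the quotient of the cells with indices `0` and `1` of the
array `0`. -/
noncomputable def outValue (M : Memory) : ℝ := (M (0, 0) : ℝ) / (M (0, 1) : ℝ)

/-- The output is a `(1 + ε)`-approximation of the minimum disagreement: both the reported value,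
and the cost of the reported partition, are at least the minimum and at most `1 + ε` times it. (For
the cost of the partition, the lower bound is automatic.) -/
def IsApprox {n : ℕ} (G : UnitGraph n) (ε : ℝ) (M : Memory) : Prop :=
  M (0, 1) ≠ 0 ∧ (minDisagree G : ℝ) ≤ outValue M ∧ outValue M ≤ (1 + ε) * minDisagree G ∧
    (disagree G (outPartition n M) : ℝ) ≤ (1 + ε) * minDisagree G

end CorrClust

/-!
# Correlation clustering in dynamic streams

The program keeps two kinds of linear sketches of the graph of positive edges, from which it
recovers a partition after the stream has ended, by exhaustive search.

**Candidates.** Every node gets a random key, and the fingerprint of a node is the sum of the keys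
of its closed positive neighbourhood. With high probability, nodes have equal fingerprints if and
only if they have equal neighbourhoods (`Params.measure_key_collision_le`), and the fingerprints
name the clusters of a *base partition*. For a partition with `m` disagreements, all but `2 * m`
nodes are *clean*: their closed neighbourhood is their cluster (`card_not_clean_le`). Among clean
nodes the base partition is the given one. So an optimal partition arises from the base partition by
moving at most `min (2 * t) n` nodes, each of them to the cluster of a node or to a new one
(`Params.exists_candidate`). These candidates are encoded by the numbers below
`(2 * n ^ 2) ^ min (2 * t) n`: polynomially many, for fixed `t`.

**Distances.** The number of disagreements of a partition is the squared Euclidean distance between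
the indicator vectors of the positive edges and of the pairs inside its clusters
(`Params.dist_eq_disagree`). It is estimated in the manner of Alon, Matias and Szegedy, by the
square of a random signed sum. The sign of a pair is given by a random quadratic form over the field
with two elements, at the binary digits of its code. The product of four such signs has mean zero
unless they cancel in pairs (`sum_sign_eq_zero`), which bounds the variance; this costs a squared
logarithm of random bits for each estimator. Averages over groups of about `1 / ε ^ 2` estimators are accurate with probability
`15 / 16` (`card_bad_group_le`), and the majority of about `t * log n` groups is wrong so seldom
(`card_majority_bad_le`) that a union bound over all candidates is possible
(`Params.measure_badBits_le`). For this, the candidates must not depend on the random bits: as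
partitions they do not, though their labels do (`Params.GoodBits.sameKer`).

**Search.** For `d = 0, 1, …`, all candidates are tested for a distance of about `d`, and the first
one that passes is the output, with the value `d + ⌊d / prec⌋`. An optimal candidate passes at the
latest when `d` is the minimum, and a candidate that passes has at most `d + ⌊d / prec⌋`
disagreements (`Params.GoodBits.isApprox`).

The program is verified by a calculus of weakest preconditions (`Wp`) that keeps track of the time
and of a memory budget, a bound for every array on its length and its contents.
-/

namespace CorrClust

/-! ### Execution of programs within a time and memory budget -/

/-- The arrays that a program may write to. The list is computed from the shape of the program
alone. So `of_decide_eq_true rfl` proves that an array is not in it even for programs with a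
variable among their constants, for which `decide` gives up. -/
def Prog.writes : Prog → List ℕ
  | .skip => []
  | .store x _ _ => [x]
  | .flip x => [x]
  | .next x => [x]
  | .seq p q => p.writes ++ q.writes
  | .ite _ p q => p.writes ++ q.writes
  | .while _ p => p.writes

/-- Whether a program contains an instruction that reads the stream. -/
def Prog.reads : Prog → Bool
  | .skip => false
  | .store _ _ _ => false
  | .flip _ => false
  | .next _ => true
  | .seq p q => p.reads || q.reads
  | .ite _ p q => p.reads || q.reads
  | .while _ p => p.reads

/-- Whether a program contains an instruction that uses a random bit. -/
def Prog.flips : Prog → Bool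
  | .skip => false
  | .store _ _ _ => false
  | .flip _ => true
  | .next _ => false
  | .seq p q => p.flips || q.flips
  | .ite _ p q => p.flips || q.flips
  | .while _ p => p.flips

/-- What the syntax of a program guarantees to be unchanged by its execution. -/
structure Frame (p : Prog) (s s' : Config) : Prop where
  mem : ∀ x ∉ p.writes, ∀ i, s'.mem (x, i) = s.mem (x, i)
  stream : p.reads = false → s'.stream = s.stream
  used : p.flips = false → s'.used = s.used

@[simp] theorem write_mem (s : Config) (x i a y j : ℕ) :
    (s.write x i a).mem (y, j) = if y = x ∧ j = i then a else s.mem (y, j) := by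
  simp only [Config.write, Finsupp.coe_update, Function.update_apply, Prod.mk.injEq]

@[simp] theorem write_stream (s : Config) (x i a : ℕ) : (s.write x i a).stream = s.stream := rfl

@[simp] theorem write_used (s : Config) (x i a : ℕ) : (s.write x i a).used = s.used := rfl

theorem next_mem_of_ne (s : Config) {x y : ℕ} (h : y ≠ x) (j : ℕ) :
    (s.next x).mem (y, j) = s.mem (y, j) := by
  unfold Config.next
  split <;> simp [h]

theorem next_used (s : Config) (x : ℕ) : (s.next x).used = s.used := by
  unfold Config.next
  split <;> simp

theorem Exec.frame {par : Fin 3 → ℕ} {coin : ℕ → Bool} {p : Prog} {s s' : Config} {T S : ℕ}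
    (h : Exec par coin p s s' T S) : Frame p s s' := by
  induction h with
  | skip s => exact ⟨fun _ _ _ => rfl, fun _ => rfl, fun _ => rfl⟩
  | store x i e s s' h =>
    subst h
    refine ⟨fun y hy j => ?_, fun _ => rfl, fun _ => rfl⟩
    simp only [Prog.writes, List.mem_singleton] at hy
    simp [hy]
  | flip x s s' h =>
    subst h
    refine ⟨fun y hy j => ?_, fun _ => rfl, fun h => by simp [Prog.flips] at h⟩
    simp only [Prog.writes, List.mem_singleton] at hy
    simp [hy]
  | next x s s' h =>
    subst h
    refine ⟨fun y hy j => ?_, fun h => by simp [Prog.reads] at h, fun _ => next_used _ _⟩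
    simp only [Prog.writes, List.mem_singleton] at hy
    exact next_mem_of_ne _ hy _
  | seq hp hq ih1 ih2 =>
    refine ⟨fun y hy j => ?_, fun h => ?_, fun h => ?_⟩
    · simp only [Prog.writes, List.mem_append, not_or] at hy
      rw [ih2.mem y hy.2, ih1.mem y hy.1]
    · simp only [Prog.reads, Bool.or_eq_false_iff] at h
      rw [ih2.stream h.2, ih1.stream h.1]
    · simp only [Prog.flips, Bool.or_eq_false_iff] at h
      rw [ih2.used h.2, ih1.used h.1]
  | ite_true he hp ih =>
    refine ⟨fun y hy j => ?_, fun h => ?_, fun h => ?_⟩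
    · simp only [Prog.writes, List.mem_append, not_or] at hy
      exact ih.mem y hy.1 j
    · simp only [Prog.reads, Bool.or_eq_false_iff] at h
      exact ih.stream h.1
    · simp only [Prog.flips, Bool.or_eq_false_iff] at h
      exact ih.used h.1
  | ite_false he hp ih =>
    refine ⟨fun y hy j => ?_, fun h => ?_, fun h => ?_⟩
    · simp only [Prog.writes, List.mem_append, not_or] at hy
      exact ih.mem y hy.2 j
    · simp only [Prog.reads, Bool.or_eq_false_iff] at h
      exact ih.stream h.2
    · simp only [Prog.flips, Bool.or_eq_false_iff] at h
      exact ih.used h.2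
  | while_true he hp hw ih1 ih2 =>
    exact ⟨fun y hy j => (ih2.mem y hy j).trans (ih1.mem y hy j),
      fun h => (ih2.stream h).trans (ih1.stream h), fun h => (ih2.used h).trans (ih1.used h)⟩
  | while_false he => exact ⟨fun _ _ _ => rfl, fun _ => rfl, fun _ => rfl⟩

/-- A memory budget: `cap x i` bounds the content of the cell `i` of the array `x`. Only the cells
`i < len x` of the arrays `x < num` may be used at all. -/
structure Budget where
  /-- the number of arrays -/
  num : ℕ
  /-- the length of each array -/
  len : ℕ → ℕ
  /-- the largest content of the cells of each array -/
  val : ℕ → ℕ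

/-- The largest admissible content of a cell. -/
def Budget.cap (B : Budget) (x i : ℕ) : ℕ := if x < B.num ∧ i < B.len x then B.val x else 0

/-- The memory stays within the budget. -/
def Budget.Fits (B : Budget) (M : Memory) : Prop := ∀ x i, M (x, i) ≤ B.cap x i

/-- An upper bound on the number of bits of a memory within the budget. -/
def Budget.space (B : Budget) : ℕ :=
  ∑ x ∈ Finset.range B.num, B.len x * (Nat.size x + Nat.size (B.len x) + Nat.size (B.val x))

theorem Budget.Fits.bits_le {B : Budget} {M : Memory} (h : B.Fits M) : M.bits ≤ B.space := by
  have hmem : ∀ a ∈ M.support, a.1 < B.num ∧ a.2 < B.len a.1 ∧ M a ≤ B.val a.1 := by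
    rintro ⟨x, i⟩ ha
    have h1 := h x i
    have h2 : M (x, i) ≠ 0 := by simpa using ha
    unfold Budget.cap at h1
    split_ifs at h1 with h3
    · exact ⟨h3.1, h3.2, h1⟩
    · omega
  unfold Memory.bits Budget.space Finsupp.sum
  calc ∑ a ∈ M.support, (Nat.size a.1 + Nat.size a.2 + Nat.size (M a))
      ≤ ∑ a ∈ M.support, (Nat.size a.1 + Nat.size (B.len a.1) + Nat.size (B.val a.1)) := by
        refine Finset.sum_le_sum fun a ha => ?_
        obtain ⟨_, h2, h3⟩ := hmem a ha
        have := Nat.size_le_size h2.le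
        have := Nat.size_le_size h3
        omega
    _ ≤ ∑ a ∈ ((Finset.range B.num).sigma fun x => Finset.range (B.len x)).map
          (Equiv.sigmaEquivProd ℕ ℕ).toEmbedding,
          (Nat.size a.1 + Nat.size (B.len a.1) + Nat.size (B.val a.1)) := by
        refine Finset.sum_le_sum_of_subset fun a ha => ?_
        obtain ⟨h1, h2, _⟩ := hmem a ha
        simp only [Finset.mem_map, Finset.mem_sigma, Finset.mem_range]
        exact ⟨⟨a.1, a.2⟩, ⟨h1, h2⟩, rfl⟩
    _ = _ := by
        rw [Finset.sum_map, Finset.sum_sigma]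
        simp

section Rules

variable {par : Fin 3 → ℕ} {coin : ℕ → Bool} {B : Budget}

/-- A weakest precondition with resource bounds. Started in `s`, the program `p` halts within `T`
steps in a configuration that satisfies `Q`; its memory never holds more bits than the budget `B`
allows, and is within the budget at the end. -/
def Wp (par : Fin 3 → ℕ) (coin : ℕ → Bool) (B : Budget) (p : Prog) (s : Config) (T : ℕ)
    (Q : Config → Prop) : Prop :=
  ∃ (s' : Config) (T' S : ℕ), Exec par coin p s s' T' S ∧ T' ≤ T ∧ S ≤ B.space ∧
    B.Fits s'.mem ∧ Q s'

theorem Budget.Fits.write {s : Config} (h : B.Fits s.mem) {x i a : ℕ} (ha : a ≤ B.cap x i) :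
    B.Fits (s.write x i a).mem := by
  intro y j
  rw [write_mem]
  split_ifs with hy
  · rw [hy.1, hy.2]; exact ha
  · exact h y j

theorem Wp.mono {p : Prog} {s : Config} {T T' : ℕ} {Q Q' : Config → Prop}
    (h : Wp par coin B p s T Q) (hT : T ≤ T')
    (hQ : ∀ s', Frame p s s' → B.Fits s'.mem → Q s' → Q' s') : Wp par coin B p s T' Q' := by
  obtain ⟨s', T1, S, h1, h2, h3, h4, h5⟩ := h
  exact ⟨s', T1, S, h1, h2.trans hT, h3, h4, hQ s' h1.frame h4 h5⟩

theorem Wp.store {x : ℕ} {i e : Expr} {s : Config} {Q : Config → Prop} (hf : B.Fits s.mem)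
    (hc : e.eval par s.mem ≤ B.cap x (i.eval par s.mem))
    (hQ : Q (s.write x (i.eval par s.mem) (e.eval par s.mem))) :
    Wp par coin B (.store x i e) s 1 Q :=
  ⟨_, 1, _, .store x i e s _ rfl, le_rfl, max_le hf.bits_le (hf.write hc).bits_le, hf.write hc, hQ⟩

theorem Wp.flip {x : ℕ} {s : Config} {Q : Config → Prop} (hf : B.Fits s.mem)
    (hc : 1 ≤ B.cap x 0)
    (hQ : Q ({ s with used := s.used + 1 }.write x 0 (coin s.used).toNat)) :
    Wp par coin B (.flip x) s 1 Q := by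
  have h : B.Fits ({ s with used := s.used + 1 }.write x 0 (coin s.used).toNat : Config).mem :=
    Budget.Fits.write (s := { s with used := s.used + 1 }) hf ((Bool.toNat_le _).trans hc)
  exact ⟨_, 1, _, .flip x s _ rfl, le_rfl, max_le hf.bits_le h.bits_le, h, hQ⟩

theorem Wp.next {x : ℕ} {s : Config} {Q : Config → Prop} (hf : B.Fits s.mem)
    (h : B.Fits (s.next x).mem) (hQ : Q (s.next x)) : Wp par coin B (.next x) s 1 Q :=
  ⟨_, 1, _, .next x s _ rfl, le_rfl, max_le hf.bits_le h.bits_le, h, hQ⟩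

theorem Wp.seq {p q : Prog} {s : Config} {T T' : ℕ} {Q : Config → Prop}
    (h : Wp par coin B p s T fun s' => Wp par coin B q s' T' Q) :
    Wp par coin B (.seq p q) s (T + T') Q := by
  obtain ⟨s', T1, S, h1, h2, h3, h4, s'', T2, S', h5, h6, h7, h8, h9⟩ := h
  exact ⟨s'', _, _, .seq h1 h5, add_le_add h2 h6, max_le h3 h7, h8, h9⟩

/-- Composition, with the frame of the first program at hand for the second one. -/
theorem Wp.seq' {p q : Prog} {s : Config} {T T' : ℕ} {R Q : Config → Prop}
    (h : Wp par coin B p s T R)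
    (h' : ∀ s', Frame p s s' → B.Fits s'.mem → R s' → Wp par coin B q s' T' Q) :
    Wp par coin B (.seq p q) s (T + T') Q :=
  Wp.seq (h.mono le_rfl h')

/-- A loop that runs at most `N - k` times, `k` being the first index of its invariant `I`. -/
theorem Wp.while {e : Expr} {p : Prog} {Q : Config → Prop} (I : ℕ → Config → Prop) (N T : ℕ)
    (h : ∀ k s, I k s → B.Fits s.mem → (e.eval par s.mem = 0 ∧ Q s) ∨
      (e.eval par s.mem ≠ 0 ∧ k < N ∧ Wp par coin B p s T (I (k + 1))))
    {k : ℕ} {s : Config} (hI : I k s) (hf : B.Fits s.mem) :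
    Wp par coin B (.while e p) s ((N - k) * (T + 1) + 1) Q := by
  induction hm : N - k generalizing k s with
  | zero =>
    rcases h k s hI hf with ⟨h1, h2⟩ | ⟨_, h2, _⟩
    · exact ⟨s, 1, _, .while_false h1, by omega, hf.bits_le, hf, h2⟩
    · omega
  | succ m ih =>
    rcases h k s hI hf with ⟨h1, h2⟩ | ⟨h1, _, s', T1, S, h4, h5, h6, h7, h8⟩
    · exact ⟨s, 1, _, .while_false h1, by omega, hf.bits_le, hf, h2⟩
    · obtain ⟨s'', T2, S', h9, h10, h11, h12, h13⟩ := ih h8 h7 (by omega)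
      exact ⟨s'', _, _, .while_true h1 h4 h9, by rw [Nat.succ_mul]; omega, max_le h6 h11, h12, h13⟩

/-- Counting loop: `x` runs from `0` to `N - 1`. -/
def Prog.for (x : ℕ) (N : Expr) (p : Prog) : Prog :=
  .seq (.store x (.const 0) (.const 0)) (.while (.lt (.load x (.const 0)) N)
    (.seq p (.store x (.const 0) (.add (.load x (.const 0)) (.const 1)))))

/-- The rule for counting loops. The invariant may not depend on the loop variable; its
preservation may use that everything outside the body is still as before the loop. -/
theorem Wp.for {x : ℕ} {Ne : Expr} {p : Prog} {s : Config} (I : ℕ → Config → Prop) (N T : ℕ)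
    (hf : B.Fits s.mem) (hc : N ≤ B.cap x 0) (hx : x ∉ p.writes)
    (hI : ∀ k s a, I k s → I k (s.write x 0 a)) (h0 : I 0 s)
    (hN : ∀ s', Frame (Prog.for x Ne p) s s' → Ne.eval par s'.mem = N)
    (hstep : ∀ k s', k < N → Frame (Prog.for x Ne p) s s' → B.Fits s'.mem → s'.mem (x, 0) = k →
      I k s' → Wp par coin B p s' T (I (k + 1))) :
    Wp par coin B (Prog.for x Ne p) s (N * (T + 2) + 2) (I N) := by
  have hfr : ∀ s', Frame (Prog.for x Ne p) s s' → ∀ s'',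
      Frame (.seq p (.store x (.const 0) (.add (.load x (.const 0)) (.const 1)))) s' s'' →
      Frame (Prog.for x Ne p) s s'' := by
    intro s' h1 s'' h2
    refine ⟨fun y hy j => ?_, fun h => ?_, fun h => ?_⟩
    · rw [h2.mem y (by simp only [Prog.for, Prog.writes, List.mem_append, List.mem_singleton,
        not_or] at hy ⊢; tauto), h1.mem y hy]
    · rw [h2.stream (by simpa [Prog.for, Prog.reads] using h), h1.stream h]
    · rw [h2.used (by simpa [Prog.for, Prog.flips] using h), h1.used h]
  have hmain := Wp.while (par := par) (coin := coin) (B := B) (e := .lt (.load x (.const 0)) Ne)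
    (p := .seq p (.store x (.const 0) (.add (.load x (.const 0)) (.const 1)))) (Q := I N)
    (fun k s' => k ≤ N ∧ Frame (Prog.for x Ne p) s s' ∧ s'.mem (x, 0) = k ∧ I k s') N (T + 1)
    (by
      rintro k s' ⟨hk, hF, hxk, hIk⟩ hfit
      rcases hk.lt_or_eq with hk | rfl
      · right
        have hne : (Expr.lt (.load x (.const 0)) Ne).eval par s'.mem ≠ 0 := by
          simp [Expr.eval, hN s' hF, hxk, hk]
        refine ⟨hne, hk, ?_⟩
        refine Wp.mono (T := T + 1) (Q := fun s'' => s''.mem (x, 0) = k + 1 ∧ I (k + 1) s'') ?_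
          le_rfl ?_
        · refine Wp.seq' (hstep k s' hk hF hfit hxk hIk) fun s2 hF2 hfit2 hI2 => ?_
          have hx2 : s2.mem (x, 0) = k := by rw [hF2.mem x hx, hxk]
          refine Wp.store hfit2 ?_ ?_
          · simp [Expr.eval, hx2]; omega
          · simp only [Expr.eval, write_mem, hx2]
            exact ⟨by simp, hI _ _ _ hI2⟩
        · rintro s'' hF'' _ ⟨h1, h2⟩
          exact ⟨hk, hfr s' hF s'' hF'', h1, h2⟩
      · left
        exact ⟨by simp [Expr.eval, hN s' hF, hxk], hIk⟩)
    (k := 0) (s := s.write x 0 0)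
    ⟨Nat.zero_le _, ⟨fun y hy j => by
        have : y ≠ x := by
          rintro rfl
          simp [Prog.for, Prog.writes] at hy
        simp [this], fun _ => rfl, fun _ => rfl⟩, by simp, hI _ _ _ h0⟩
    (hf.write (Nat.zero_le _))
  refine Wp.mono (T := 1 + ((N - 0) * (T + 1 + 1) + 1)) ?_
    (by rw [Nat.sub_zero, show T + 1 + 1 = T + 2 from rfl]; omega) (fun _ _ _ h => h)
  exact Wp.seq (Wp.store hf (Nat.zero_le _) hmain)

end Rules


/-! ### The streaming program -/

instance : Add Expr := ⟨.add⟩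
instance : Sub Expr := ⟨.sub⟩
instance : Mul Expr := ⟨.mul⟩
instance : Div Expr := ⟨.div⟩
instance : Mod Expr := ⟨.mod⟩
instance (a : ℕ) : OfNat Expr a := ⟨.const a⟩

/-- The content of a scalar variable: the cell with index `0` of an array. -/
def Expr.cell (x : ℕ) : Expr := .load x 0

section Eval

variable (par : Fin 3 → ℕ) (M : Memory) (a b : Expr)

@[simp] theorem eval_add : (a + b).eval par M = a.eval par M + b.eval par M := rfl
@[simp] theorem eval_sub : (a - b).eval par M = a.eval par M - b.eval par M := rfl
@[simp] theorem eval_mul : (a * b).eval par M = a.eval par M * b.eval par M := rfl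
@[simp] theorem eval_div : (a / b).eval par M = a.eval par M / b.eval par M := rfl
@[simp] theorem eval_mod : (a % b).eval par M = a.eval par M % b.eval par M := rfl
@[simp] theorem eval_ofNat (k : ℕ) : (ofNat(k) : Expr).eval par M = k := rfl
@[simp] theorem eval_zero : (0 : Expr).eval par M = 0 := rfl
@[simp] theorem eval_one : (1 : Expr).eval par M = 1 := rfl
@[simp] theorem eval_const (k : ℕ) : (Expr.const k).eval par M = k := rfl
@[simp] theorem eval_par (i : Fin 3) : (Expr.par i).eval par M = par i := rfl
@[simp] theorem eval_cell (x : ℕ) : (Expr.cell x).eval par M = M (x, 0) := rfl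
@[simp] theorem eval_load (x : ℕ) : (Expr.load x a).eval par M = M (x, a.eval par M) := rfl
@[simp] theorem eval_lt :
    (Expr.lt a b).eval par M = if a.eval par M < b.eval par M then 1 else 0 := rfl
@[simp] theorem eval_eq :
    (Expr.eq a b).eval par M = if a.eval par M = b.eval par M then 1 else 0 := rfl

end Eval

infixr:60 " ;; " => Prog.seq

/-- The parameters of a run of the program with error exponent `c`: the number `n` of nodes, the
bound `t` on the disagreement, and the precision `E = ⌈1/ε⌉`. -/
structure Params where
  c : ℕ
  n : ℕ
  t : ℕ
  E : ℕ
  one_le_n : 1 ≤ n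
  one_le_E : 1 ≤ E

namespace Params

variable (P : Params) (coin : ℕ → Bool)

/-- The parameters as the program reads them. -/
def par : Fin 3 → ℕ := ![P.n, P.t, P.E]

/-- The number of binary digits of the code `u * n + v` of a pair of nodes. -/
def width : ℕ := Nat.size (P.n * P.n)

/-- The number of nodes that a candidate partition moves to other clusters. -/
def moves : ℕ := min (2 * P.t) P.n

/-- The inverse of the accuracy. It is at most `n ^ 3 + 1`, beyond which a better accuracy makes no
difference because disagreements are integers, and it is `1` if `t = 0`. -/
def prec : ℕ := min P.E (P.moves * (P.n * P.n) + 1)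

/-- The number of groups of estimators. The majority of the groups is wrong about a partition with
probability at most `2 ^ (-groups)`. Of the exponent, `2 * moves * width` pays for the union bound
over the candidates. -/
def groups : ℕ := (2 * P.moves + (P.c + 1)) * P.width

/-- The number of estimators in each group. The relative variance of an estimator is at most `2`,
so by Chebyshev's inequality the average over `288 * prec ^ 2 = 16 * 2 * (3 * prec) ^ 2` of them has
a relative error above `1 / (3 * prec)` with probability at most `1 / 16`. -/
def size : ℕ := 288 * (P.prec * P.prec)

/-- The total number of estimators. -/
def reps : ℕ := P.groups * P.size

/-- The number of random bits in the key of a node. Of these, `width` pay for the union bound over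
the pairs of nodes. -/
def keyBits : ℕ := (P.c + 2) * P.width

/-- The number of possible moves of a node: a choice of the node and of one of `2 * n` labels. -/
def base : ℕ := 2 * (P.n * P.n)

/-- The number of candidate partitions. -/
def cands : ℕ := P.base ^ P.moves

end Params

/-- The number whose binary digits, the leading one first, are `f 0, …, f (k - 1)`. -/
def bitsVal (f : ℕ → Bool) : ℕ → ℕ
  | 0 => 0
  | k + 1 => 2 * bitsVal f k + (f k).toNat

theorem bitsVal_lt (f : ℕ → Bool) (k : ℕ) : bitsVal f k < 2 ^ k := by
  induction k with
  | zero => simp [bitsVal]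
  | succ k ih =>
    have := Bool.toNat_le (f k)
    rw [bitsVal, pow_succ]
    omega

namespace Params

variable (P : Params) (coin : ℕ → Bool)

/-- The random key of a node. -/
def key (v : ℕ) : ℕ := bitsVal (fun i => coin (v * P.keyBits + i)) P.keyBits

/-- The random bits that come after the keys: the coefficients of the quadratic forms. -/
def seed (k : ℕ) : ℕ := (coin (P.n * P.keyBits + k)).toNat

/-- The value modulo `2` of the `j`-th random quadratic form at the binary digits of `e`. -/
def hash (j e : ℕ) : ℕ :=
  (∑ k ∈ Finset.range (P.width * P.width), P.seed coin (j * (P.width * P.width) + k) *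
    ((e / 2 ^ (k / P.width) % 2) * (e / 2 ^ (k % P.width) % 2))) % 2

end Params

/-! The arrays of the program. Those of length greater than `1` hold the labels of the nodes
(`aLabel`, which is the output partition), powers of two (`aPow`), the keys of the nodes (`aKey`),
the coefficients of the quadratic forms (`aSeed`), the sketches of the positive edges (`aSketch`),
the sums of the keys of the positive neighbours (`aPrint`), the current stream item (`aToken`), and
the output value as a fraction (`aOut`). The other ones are scalar variables; a name with the
prefix `i` is that of a loop variable or of an index. -/

notation "aOut" => (0 : ℕ)
notation "aLabel" => (1 : ℕ)
notation "aWidth" => (2 : ℕ)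
notation "aPow" => (3 : ℕ)
notation "aCands" => (4 : ℕ)
notation "aKey" => (5 : ℕ)
notation "aSeed" => (6 : ℕ)
notation "aSketch" => (7 : ℕ)
notation "aPrint" => (8 : ℕ)
notation "aCount" => (9 : ℕ)
notation "aToken" => (10 : ℕ)
notation "aCoin" => (11 : ℕ)
notation "iNode" => (12 : ℕ)
notation "iBit" => (13 : ℕ)
notation "iSeed" => (14 : ℕ)
notation "aHash" => (15 : ℕ)
notation "iHash" => (16 : ℕ)
notation "iEdge" => (17 : ℕ)
notation "iRep" => (18 : ℕ)
notation "aCand" => (19 : ℕ)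
notation "aFound" => (20 : ℕ)
notation "aMoves" => (21 : ℕ)
notation "iGroup" => (22 : ℕ)
notation "iMember" => (23 : ℕ)
notation "aAcc" => (24 : ℕ)
notation "aPairs" => (25 : ℕ)
notation "aSquares" => (26 : ℕ)
notation "aVotes" => (27 : ℕ)

/-- The smaller one of two values. -/
def minE (a b : Expr) : Expr := .lt a b * a + (1 - .lt a b) * b

@[simp] theorem eval_minE (par : Fin 3 → ℕ) (M : Memory) (a b : Expr) :
    (minE a b).eval par M = min (a.eval par M) (b.eval par M) := by
  simp only [minE, eval_add, eval_mul, eval_lt, eval_sub, eval_one]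
  split_ifs <;> simp <;> omega

/-! The parameters as expressions. -/

def nE : Expr := .par 0
def widthE : Expr := .cell aWidth
def candsE : Expr := .cell aCands
def movesE : Expr := minE (2 * .par 1) nE
def precE : Expr := minE (.par 2) (movesE * (nE * nE) + 1)
def groupsE (c : ℕ) : Expr := (2 * movesE + (.const c + 1)) * widthE
def sizeE : Expr := 288 * (precE * precE)
def repsE (c : ℕ) : Expr := groupsE c * sizeE
def keyBitsE (c : ℕ) : Expr := (.const c + 2) * widthE
def baseE : Expr := 2 * (nE * nE)

section EvalParams

variable (P : Params) (M : Memory)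

@[simp] theorem eval_nE : nE.eval P.par M = P.n := rfl
@[simp] theorem eval_movesE : movesE.eval P.par M = P.moves := by
  simp only [movesE, Params.moves, eval_minE, eval_mul, eval_nE, eval_ofNat]
  rfl
@[simp] theorem eval_precE : precE.eval P.par M = P.prec := by
  simp only [precE, Params.prec, eval_minE, eval_mul, eval_nE, eval_add, eval_one, eval_movesE]
  rfl
@[simp] theorem eval_sizeE : sizeE.eval P.par M = P.size := by
  simp [sizeE, Params.size]
@[simp] theorem eval_baseE : baseE.eval P.par M = P.base := by
  simp [baseE, Params.base]

variable {M}

theorem eval_widthE (h : M (aWidth, 0) = P.width) : widthE.eval P.par M = P.width := h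
theorem eval_groupsE (h : M (aWidth, 0) = P.width) :
    (groupsE P.c).eval P.par M = P.groups := by
  simp [groupsE, Params.groups, eval_widthE P h]
theorem eval_repsE (h : M (aWidth, 0) = P.width) : (repsE P.c).eval P.par M = P.reps := by
  simp [repsE, Params.reps, eval_groupsE P h]
theorem eval_keyBitsE (h : M (aWidth, 0) = P.width) :
    (keyBitsE P.c).eval P.par M = P.keyBits := by
  simp [keyBitsE, Params.keyBits, eval_widthE P h]

end EvalParams

/-! The parts of the program. -/

/-- Compute the binary width of the pair codes, and a table of powers of two. -/
def widthProg : Prog :=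
  .store aPow 0 1 ;;
  .while (.lt (.load aPow (.cell aWidth)) (nE * nE + 1))
    (.store aPow (.cell aWidth + 1) (2 * .load aPow (.cell aWidth)) ;;
    .store aWidth 0 (.cell aWidth + 1))

/-- Compute the number of candidate partitions. -/
def candsProg : Prog :=
  .store aCands 0 1 ;; .for iNode movesE (.store aCands 0 (.cell aCands * baseE))

/-- Draw the keys of the nodes. -/
def keyProg (c : ℕ) : Prog :=
  .for iNode nE (.for iBit (keyBitsE c) (.flip aCoin ;;
    .store aKey (.cell iNode) (2 * .load aKey (.cell iNode) + .cell aCoin)))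

/-- Draw the coefficients of the quadratic forms. -/
def seedProg (c : ℕ) : Prog :=
  .for iSeed (repsE c * (widthE * widthE)) (.flip aCoin ;;
    .store aSeed (.cell iSeed) (.cell aCoin))

/-- What is done before the stream is read. -/
def setupProg (c : ℕ) : Prog := widthProg ;; candsProg ;; keyProg c ;; seedProg c

/-- Evaluate the quadratic form with the number `iRep` at the pair code `iEdge`. -/
def hashProg : Prog :=
  .store aHash 0 0 ;;
  .for iHash (widthE * widthE) (.store aHash 0 ((.cell aHash +
    .load aSeed (.cell iRep * (widthE * widthE) + .cell iHash) *
      ((.cell iEdge / .load aPow (.cell iHash / widthE) % 2) *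
        (.cell iEdge / .load aPow (.cell iHash % widthE) % 2))) % 2))

/-- Whether the stream item inserts a positive edge. -/
def plusE : Expr := .load aToken 4 * .load aToken 1
/-- Whether the stream item deletes a positive edge. -/
def minusE : Expr := .load aToken 4 * (1 - .load aToken 1)
def fstE : Expr := .load aToken 2
def sndE : Expr := .load aToken 3

/-- Update the sketches for a stream item. -/
def updateProg (c : ℕ) : Prog :=
  .store aPrint fstE (.load aPrint fstE + plusE * .load aKey sndE - minusE * .load aKey sndE) ;;
  .store aPrint sndE (.load aPrint sndE + plusE * .load aKey fstE - minusE * .load aKey fstE) ;;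
  .store iEdge 0 (.lt fstE sndE * (fstE * nE + sndE) + .lt sndE fstE * (sndE * nE + fstE)) ;;
  .for iRep (repsE c) (hashProg ;;
    .store aSketch (.cell iRep)
      (.load aSketch (.cell iRep) + plusE * .cell aHash - minusE * .cell aHash)) ;;
  .store aCount 0 (.cell aCount + plusE - minusE)

/-- Process the stream. -/
def streamProg (c : ℕ) : Prog :=
  .next aToken ;; .while (.cell aToken) (updateProg c ;; .next aToken)

/-- The node that the current move moves. -/
def movedE : Expr := .cell aMoves % baseE % nE
/-- The label code that the current move assigns. -/
def codeE : Expr := .cell aMoves % baseE / nE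

/-- Compute the labels of the current candidate partition. -/
def labelProg : Prog :=
  .for iNode nE (.store aLabel (.cell iNode)
    (nE + .load aPrint (.cell iNode) + .load aKey (.cell iNode))) ;;
  .store aMoves 0 (.cell aCand % candsE) ;;
  .for iNode movesE (.store aLabel movedE (.lt codeE nE * codeE +
      (1 - .lt codeE nE) * (nE + .load aPrint (codeE - nE) + .load aKey (codeE - nE))) ;;
    .store aMoves 0 (.cell aMoves / baseE))

/-- Whether `iEdge` is the code of a pair of nodes with equal labels. -/
def sameE : Expr :=
  .lt (.cell iEdge / nE) (.cell iEdge % nE) *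
    .eq (.load aLabel (.cell iEdge / nE)) (.load aLabel (.cell iEdge % nE))

/-- The square of the difference of two values. -/
def sqDiffE (a b : Expr) : Expr := (a - b) * (a - b) + (b - a) * (b - a)

/-- Sum the hash values of the pairs inside the clusters of the current candidate. -/
def sumProg : Prog :=
  .store aAcc 0 0 ;; .store aPairs 0 0 ;;
  .for iEdge (nE * nE) (hashProg ;;
    .store aAcc 0 (.cell aAcc + sameE * .cell aHash) ;;
    .store aPairs 0 (.cell aPairs + sameE))

/-- Count the groups of estimators that vote for the current candidate. -/
def voteProg (c : ℕ) : Prog :=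
  .store aVotes 0 0 ;;
  .for iGroup (groupsE c) (
    .store aSquares 0 0 ;;
    .for iMember sizeE (
      .store iRep 0 (.cell iGroup * sizeE + .cell iMember) ;;
      sumProg ;;
      .store aSquares 0 (.cell aSquares + sqDiffE (.cell aCount + 2 * .cell aAcc)
        (.cell aPairs + 2 * .load aSketch (.cell iRep)))) ;;
    .store aVotes 0 (.cell aVotes + .lt (3 * precE * .cell aSquares)
      ((3 * precE + 1) * (sizeE * (.cell aCand / candsE)) + 1)))

/-- Search for the first candidate that is accepted. -/
def searchProg (c : ℕ) : Prog :=
  .while (.lt (.cell aCand) ((nE * nE + 1) * candsE) * (1 - .cell aFound))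
    (labelProg ;; voteProg c ;;
    .store aFound 0 (1 - .lt (2 * .cell aVotes) (groupsE c)) ;;
    .store aCand 0 (.cell aCand + (1 - .cell aFound)))

/-- Write the estimate to the output. -/
def outputProg : Prog :=
  .store aOut 0 (.cell aCand / candsE + .cell aCand / candsE / precE) ;; .store aOut 1 1

/-- The streaming program. -/
def mainProg (c : ℕ) : Prog :=
  setupProg c ;; streamProg c ;; searchProg c ;; outputProg

/-! ### What the program computes -/

namespace Params

variable (P : Params) (coin : ℕ → Bool)

/-- The memory budget of the program. -/
def budget : Budget where
  num := 28
  len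
    | aOut => 2
    | aLabel => P.n
    | aPow => P.width + 1
    | aKey => P.n
    | aSeed => P.reps * (P.width * P.width)
    | aSketch => P.reps
    | aPrint => P.n
    | aToken => 5
    | _ => 1
  val
    | aOut => 2 * (P.n * P.n + 1)
    | aLabel => P.n + (P.n + 1) * 2 ^ P.keyBits
    | aWidth => P.width
    | aPow => 2 ^ P.width
    | aCands => P.cands
    | aKey => 2 ^ P.keyBits
    | aSeed => 1
    | aSketch => P.n * P.n
    | aPrint => P.n * 2 ^ P.keyBits
    | aCount => P.n * P.n
    | aToken => P.n
    | aCoin => 1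
    | iNode => P.n
    | iBit => P.keyBits
    | iSeed => P.reps * (P.width * P.width)
    | aHash => 1
    | iHash => P.width * P.width
    | iEdge => P.n * P.n
    | iRep => P.reps
    | aCand => (P.n * P.n + 1) * P.cands
    | aFound => 1
    | aMoves => P.cands
    | iGroup => P.groups
    | iMember => P.size
    | aAcc => P.n * P.n
    | aPairs => P.n * P.n
    | aSquares => P.size * (9 * (P.n * P.n) * (P.n * P.n))
    | aVotes => P.groups
    | _ => 0

/-- The part of the memory that is fixed before the stream is read. -/
structure Env (M : Memory) : Prop where
  width : M (aWidth, 0) = P.width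
  pow : ∀ i ≤ P.width, M (aPow, i) = 2 ^ i
  cands : M (aCands, 0) = P.cands
  key : ∀ v < P.n, M (aKey, v) = P.key coin v
  seed : ∀ k < P.reps * (P.width * P.width), M (aSeed, k) = P.seed coin k

variable {P coin}

theorem Env.frame {p : Prog} {s s' : Config} (h : P.Env coin s.mem) (hF : Frame p s s')
    (hp : ∀ x ∈ [aWidth, aPow, aCands, aKey, aSeed], x ∉ p.writes) : P.Env coin s'.mem := by
  have := fun x hx => hF.mem x (hp x hx)
  constructor
  · rw [this _ (by simp), h.width]
  · intro i hi; rw [this _ (by simp), h.pow i hi]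
  · rw [this _ (by simp), h.cands]
  · intro i hi; rw [this _ (by simp), h.key i hi]
  · intro i hi; rw [this _ (by simp), h.seed i hi]

theorem Env.write {s : Config} (h : P.Env coin s.mem) {x : ℕ} (i a : ℕ)
    (hx : x ∉ [aWidth, aPow, aCands, aKey, aSeed]) : P.Env coin (s.write x i a).mem := by
  simp only [List.mem_cons, List.not_mem_nil, or_false, not_or] at hx
  obtain ⟨h1, h2, h3, h4, h5⟩ := hx
  constructor <;> intros <;> rw [write_mem, if_neg (by tauto)]
  · exact h.width
  · exact h.pow _ ‹_›
  · exact h.cands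
  · exact h.key _ ‹_›
  · exact h.seed _ ‹_›

theorem hashProg_spec {s : Config} (hf : P.budget.Fits s.mem) (he : P.Env coin s.mem)
    (hj : s.mem (iRep, 0) < P.reps) :
    Wp P.par coin P.budget hashProg s (P.width * P.width * 3 + 3)
      fun s' => s'.mem (aHash, 0) = P.hash coin (s.mem (iRep, 0)) (s.mem (iEdge, 0)) := by
  refine Wp.mono (T := 1 + (P.width * P.width * (1 + 2) + 2)) (Q := _) (Wp.seq ?_)
    (by omega) (fun _ _ _ h => h)
  refine Wp.store hf (Nat.zero_le _) ?_
  simp only [eval_zero]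
  refine Wp.mono (Wp.for (fun k s' => s'.mem (aHash, 0) =
      (∑ k ∈ Finset.range k, P.seed coin (s.mem (iRep, 0) * (P.width * P.width) + k) *
      ((s.mem (iEdge, 0) / 2 ^ (k / P.width) % 2) * (s.mem (iEdge, 0) / 2 ^ (k % P.width) % 2))) % 2)
      (P.width * P.width) 1 (hf.write (Nat.zero_le _)) (by simp [Budget.cap, budget])
      (by decide) ?_ (by simp) ?_ ?_) le_rfl ?_
  · intro k s' a h
    simpa using h
  · intro s' h
    have he' := (he.write _ _ (by decide)).frame h (by decide)
    simp [eval_widthE P he'.width]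
  · intro k s' hk hF hfit hk0 hI
    have he' := (he.write _ _ (by decide)).frame hF (by decide)
    have h1 : s'.mem (iRep, 0) = s.mem (iRep, 0) := by
      rw [hF.mem _ (by decide)]; simp
    have h2 : s'.mem (iEdge, 0) = s.mem (iEdge, 0) := by
      rw [hF.mem _ (by decide)]; simp
    have hw : 0 < P.width := Nat.pos_of_ne_zero (by rintro h; simp [h] at hk)
    have hb1 : k / P.width ≤ P.width := (Nat.div_lt_of_lt_mul hk).le
    have hb2 : k % P.width ≤ P.width := (Nat.mod_lt _ hw).le
    have hb3 : s.mem (iRep, 0) * (P.width * P.width) + k < P.reps * (P.width * P.width) := by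
      calc _ < s.mem (iRep, 0) * (P.width * P.width) + P.width * P.width := by omega
        _ = (s.mem (iRep, 0) + 1) * (P.width * P.width) := by ring
        _ ≤ _ := Nat.mul_le_mul_right _ hj
    refine Wp.store hfit ?_ ?_
    · simp only [eval_mod, eval_ofNat]
      exact (Nat.lt_succ_iff.1 (Nat.mod_lt _ two_pos)).trans (by simp [Budget.cap, budget])
    · simp only [eval_mod, eval_ofNat, eval_add, eval_cell, eval_mul, eval_load,
        eval_div, eval_widthE P he'.width, h1, h2, hk0, hI, write_mem, he'.pow _ hb1,
        he'.pow _ hb2, he'.seed _ hb3, Finset.sum_range_succ]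
      simp [Nat.add_mod]
  · intro s' _ _ h
    exact h

end Params


/-! ### Preparing the random bits -/

namespace Params

variable {P : Params} {coin : ℕ → Bool}

theorem lt_width_iff (k : ℕ) : k < P.width ↔ 2 ^ k ≤ P.n * P.n := Nat.lt_size

theorem sq_lt_two_pow_width : P.n * P.n < 2 ^ P.width := Nat.lt_size_self _

theorem base_pos : 0 < P.base := by
  have := P.one_le_n
  unfold base
  positivity

theorem cands_pos : 0 < P.cands := Nat.pow_pos base_pos

theorem widthProg_spec {s : Config} (hf : P.budget.Fits s.mem) (h0 : s.mem (aWidth, 0) = 0) :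
    Wp P.par coin P.budget widthProg s (P.width * 3 + 2)
      fun s' => s'.mem (aWidth, 0) = P.width ∧ ∀ i ≤ P.width, s'.mem (aPow, i) = 2 ^ i := by
  have hc : (1 : ℕ) ≤ P.budget.cap aPow 0 := by
    simp [Budget.cap, budget, Nat.one_le_two_pow]
  refine Wp.mono (T := 1 + ((P.width - 0) * (2 + 1) + 1)) (Q := _) (Wp.seq ?_)
    (by omega) (fun _ _ _ h => h)
  refine Wp.store hf hc ?_
  refine Wp.while (fun k s' => k ≤ P.width ∧ s'.mem (aWidth, 0) = k ∧
    ∀ i ≤ k, s'.mem (aPow, i) = 2 ^ i) P.width 2 ?_ ?_ (hf.write hc)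
  · rintro k s' ⟨hk, hw, hp⟩ hfit
    have hcond : (Expr.lt (.load aPow (.cell aWidth)) (nE * nE + 1)).eval P.par s'.mem ≠ 0 ↔
        k < P.width := by
      simp [hw, hp k le_rfl, lt_width_iff]
    rcases hk.lt_or_eq with hk | rfl
    · right
      refine ⟨hcond.2 hk, hk, Wp.seq (T := 1) (T' := 1) ?_⟩
      have h2 : 2 * 2 ^ k ≤ 2 ^ P.width := by
        rw [← pow_succ']
        exact Nat.pow_le_pow_right two_pos hk
      have hfit2 : P.budget.Fits (s'.write aPow (k + 1) (2 * 2 ^ k)).mem :=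
        hfit.write (by simpa [Budget.cap, budget, hk] using h2)
      refine Wp.store hfit ?_ ?_
      · simpa [hw, hp k le_rfl, Budget.cap, budget, hk] using h2
      · simp only [eval_add, eval_cell, hw, eval_mul, eval_ofNat, eval_load,
          hp k le_rfl]
        refine Wp.store hfit2 ?_ ?_
        · simp [hw, Budget.cap, budget]; omega
        · refine ⟨hk, by simp [hw], fun i hi => ?_⟩
          rcases hi.lt_or_eq with h | rfl
          · have : i ≤ k := by omega
            have : i ≠ k + 1 := by omega
            simp [*]
          · simp [pow_succ']
    · left
      refine ⟨by_contra fun h => (lt_irrefl _ (hcond.1 h)), hw, hp⟩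
  · refine ⟨Nat.zero_le _, by simp [h0], fun i hi => ?_⟩
    obtain rfl : i = 0 := by omega
    simp

theorem candsProg_spec {s : Config} (hf : P.budget.Fits s.mem) :
    Wp P.par coin P.budget candsProg s (P.moves * 3 + 3)
      fun s' => s'.mem (aCands, 0) = P.cands := by
  have hc : (1 : ℕ) ≤ P.budget.cap aCands 0 := by
    simpa [Budget.cap, budget] using Nat.succ_le_of_lt cands_pos
  refine Wp.mono (T := 1 + (P.moves * (1 + 2) + 2)) (Q := _) (Wp.seq ?_)
    (by omega) (fun _ _ _ h => h)
  refine Wp.store hf hc ?_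
  refine Wp.for (fun k s' => s'.mem (aCands, 0) = P.base ^ k) P.moves 1 (hf.write hc)
    (by simp [Budget.cap, budget, moves]) (by decide) ?_ (by simp) (by simp) ?_
  · intro k s' a h
    simpa using h
  · intro k s' hk hF hfit hk0 hI
    refine Wp.store hfit ?_ (by simp [hI, pow_succ])
    simp only [eval_mul, eval_cell, hI, eval_baseE, eval_zero, ← pow_succ]
    simpa [Budget.cap, budget, cands] using Nat.pow_le_pow_right base_pos hk

theorem keyProg_spec {s : Config} (hf : P.budget.Fits s.mem) (hw : s.mem (aWidth, 0) = P.width)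
    (hu : s.used = 0) (h0 : ∀ i, s.mem (aKey, i) = 0) :
    Wp P.par coin P.budget (keyProg P.c) s (P.n * (P.keyBits * 4 + 4) + 2)
      fun s' => (∀ v < P.n, s'.mem (aKey, v) = P.key coin v) ∧ s'.used = P.n * P.keyBits := by
  refine Wp.mono (Wp.for (fun k s' => (∀ v < k, s'.mem (aKey, v) = P.key coin v) ∧
    (∀ v, k ≤ v → s'.mem (aKey, v) = 0) ∧ s'.used = k * P.keyBits) P.n
    (P.keyBits * 4 + 2) hf (by simp [Budget.cap, budget]) (by exact of_decide_eq_true rfl)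
    ?_ ?_ (by simp) ?_)
    le_rfl (fun s' _ _ h => ⟨h.1, h.2.2⟩)
  · rintro k s' a ⟨h1, h2, h3⟩
    exact ⟨by simpa using h1, by simpa using h2, by simpa using h3⟩
  · exact ⟨by simp, by simpa using h0, by simp [hu]⟩
  · rintro k s' hk hF hfit hk0 ⟨h1, h2, h3⟩
    have hw' : s'.mem (aWidth, 0) = P.width := by rw [hF.mem _ (by exact of_decide_eq_true rfl), hw]
    refine Wp.mono (Wp.for (fun i s2 => s2.mem (aKey, k) =
      bitsVal (fun i => coin (k * P.keyBits + i)) i ∧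
      (∀ v ≠ k, s2.mem (aKey, v) = s'.mem (aKey, v)) ∧ s2.used = k * P.keyBits + i) P.keyBits 2
      hfit (by simp [Budget.cap, budget]) (by exact of_decide_eq_true rfl) ?_ ?_ ?_ ?_) (by omega) ?_
    · rintro i s2 a ⟨h4, h5, h6⟩
      exact ⟨by simpa using h4, by simpa using h5, by simpa using h6⟩
    · exact ⟨by simp [h2 k le_rfl, bitsVal], by simp, by simp [h3]⟩
    · intro s2 hF2
      exact eval_keyBitsE P (by rw [hF2.mem _ (by exact of_decide_eq_true rfl), hw'])
    · rintro i s2 hi hF2 hfit2 hi0 ⟨h4, h5, h6⟩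
      have hk2 : s2.mem (iNode, 0) = k := by rw [hF2.mem _ (by exact of_decide_eq_true rfl), hk0]
      refine Wp.seq' (T := 1) (T' := 1) (R := fun s3 => s3.mem (aCoin, 0) = (coin s2.used).toNat ∧
        s3.used = s2.used + 1) ?_ ?_
      · exact Wp.flip hfit2 (by simp [Budget.cap, budget]) ⟨by simp, by simp⟩
      · rintro s3 hF3 hfit3 ⟨h7, h8⟩
        have hm : ∀ v, s3.mem (aKey, v) = s2.mem (aKey, v) :=
          hF3.mem _ (by exact of_decide_eq_true rfl)
        have hk3 : s3.mem (iNode, 0) = k := by rw [hF3.mem _ (by exact of_decide_eq_true rfl), hk2]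
        have hb : 2 * s3.mem (aKey, k) + s3.mem (aCoin, 0) =
            bitsVal (fun i => coin (k * P.keyBits + i)) (i + 1) := by
          rw [bitsVal, hm, h4, h7, h6]
        refine Wp.store hfit3 ?_ ⟨?_, ?_, ?_⟩
        · simp only [eval_add, eval_mul, eval_ofNat, eval_load, eval_cell, hk3, hb]
          refine (bitsVal_lt _ _).le.trans ?_
          simpa [Budget.cap, budget, hk] using Nat.pow_le_pow_right two_pos hi
        · simpa [hk3] using hb
        · intro v hv
          simp [hk3, hv, hm, h5 v hv]
        · simp [h8, h6, add_assoc]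
    · rintro s2 hF2 _ ⟨h4, h5, h6⟩
      refine ⟨fun v hv => ?_, fun v hv => ?_, by rw [h6]; ring⟩
      · rcases (Nat.lt_succ_iff.1 hv).lt_or_eq with hv | rfl
        · rw [h5 v hv.ne, h1 v hv]
        · exact h4
      · rw [h5 v (by omega), h2 v (by omega)]

theorem seedProg_spec {s : Config} (hf : P.budget.Fits s.mem)
    (hw : s.mem (aWidth, 0) = P.width) (hu : s.used = P.n * P.keyBits) :
    Wp P.par coin P.budget (seedProg P.c) s (P.reps * (P.width * P.width) * 4 + 2)
      fun s' => ∀ k < P.reps * (P.width * P.width), s'.mem (aSeed, k) = P.seed coin k := by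
  refine Wp.mono (Wp.for (fun k s' => (∀ i < k, s'.mem (aSeed, i) = P.seed coin i) ∧
    s'.used = P.n * P.keyBits + k) (P.reps * (P.width * P.width))
    2 hf (by simp [Budget.cap, budget]) (by exact of_decide_eq_true rfl) ?_ (by simp [hu]) ?_ ?_)
    le_rfl (fun s' _ _ h => h.1)
  · rintro k s' a ⟨h1, h2⟩
    exact ⟨by simpa using h1, by simpa using h2⟩
  · intro s' hF
    have hw' : s'.mem (aWidth, 0) = P.width := by rw [hF.mem _ (by exact of_decide_eq_true rfl), hw]
    simp [eval_repsE P hw', eval_widthE P hw']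
  · rintro k s' hk hF hfit hk0 ⟨h1, h2⟩
    refine Wp.seq' (T := 1) (T' := 1) (R := fun s3 => s3.mem (aCoin, 0) = P.seed coin k ∧
      s3.used = s'.used + 1) ?_ ?_
    · exact Wp.flip hfit (by simp [Budget.cap, budget]) ⟨by simp [seed, h2], by simp⟩
    · rintro s3 hF3 hfit3 ⟨h7, h8⟩
      have hk3 : s3.mem (iSeed, 0) = k := by rw [hF3.mem _ (by exact of_decide_eq_true rfl), hk0]
      refine Wp.store hfit3 ?_ ⟨fun i hi => ?_, by simp [h8, h2, add_assoc]⟩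
      · simpa [hk3, h7, Budget.cap, budget, hk, seed] using Bool.toNat_le _
      · rcases (Nat.lt_succ_iff.1 hi).lt_or_eq with hi | rfl
        · simp [hk3, hi.ne, hF3.mem aSeed (by exact of_decide_eq_true rfl), h1 i hi]
        · simp [hk3, h7]

theorem setupProg_spec {s : Config} (h0 : s.mem = 0) (hu : s.used = 0) :
    Wp P.par coin P.budget (setupProg P.c) s
      (P.width * 3 + 2 + (P.moves * 3 + 3 + (P.n * (P.keyBits * 4 + 4) + 2 +
        (P.reps * (P.width * P.width) * 4 + 2)))) fun s' => P.Env coin s'.mem := by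
  have hf : P.budget.Fits s.mem := by
    intro x i
    simp [h0]
  refine Wp.seq' (widthProg_spec hf (by simp [h0])) fun s1 hF1 hf1 h1 => ?_
  refine Wp.seq' (candsProg_spec hf1) fun s2 hF2 hf2 h2 => ?_
  refine Wp.seq' (keyProg_spec hf2 ?_ ?_ ?_) fun s3 hF3 hf3 h3 => ?_
  · rw [hF2.mem _ (by exact of_decide_eq_true rfl), h1.1]
  · rw [hF2.used (by exact of_decide_eq_true rfl), hF1.used (by exact of_decide_eq_true rfl), hu]
  · intro i
    rw [hF2.mem _ (by exact of_decide_eq_true rfl), hF1.mem _ (by exact of_decide_eq_true rfl), h0]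
    rfl
  have hw : s3.mem (aWidth, 0) = P.width := by
    rw [hF3.mem _ (by exact of_decide_eq_true rfl), hF2.mem _ (by exact of_decide_eq_true rfl), h1.1]
  refine (seedProg_spec hf3 hw h3.2).mono le_rfl fun s4 hF4 hf4 h4 => ?_
  constructor
  · rw [hF4.mem _ (by exact of_decide_eq_true rfl), hw]
  · intro i hi
    rw [hF4.mem _ (by exact of_decide_eq_true rfl), hF3.mem _ (by exact of_decide_eq_true rfl),
      hF2.mem _ (by exact of_decide_eq_true rfl), h1.2 i hi]
  · rw [hF4.mem _ (by exact of_decide_eq_true rfl), hF3.mem _ (by exact of_decide_eq_true rfl), h2]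
  · intro v hv
    rw [hF4.mem _ (by exact of_decide_eq_true rfl), h3.1 v hv]
  · exact h4

end Params


/-! ### Processing the stream -/

/-- The number that stands for an unordered pair of distinct nodes. -/
def pairCode (n u v : ℕ) : ℕ := if u < v then u * n + v else v * n + u

theorem pairCode_lt {n : ℕ} (u v : Fin n) : pairCode n u v < n * n := by
  have h : ∀ u v : Fin n, (u : ℕ) * n + v < n * n := fun u v => by
    calc (u : ℕ) * n + v < u * n + n := by omega
      _ = (u + 1) * n := by ring
      _ ≤ n * n := Nat.mul_le_mul_right _ u.2
  unfold pairCode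
  split_ifs
  · exact h u v
  · exact h v u

theorem mul_add_inj {n a b a' b' : ℕ} (hb : b < n) (hb' : b' < n)
    (h : a * n + b = a' * n + b') : a = a' ∧ b = b' := by
  have h1 := congrArg (· / n) h
  have h2 := congrArg (· % n) h
  have hn : 0 < n := by omega
  simp only [mul_comm _ n, Nat.mul_add_div hn, Nat.div_eq_of_lt hb, Nat.div_eq_of_lt hb',
    Nat.mul_add_mod, Nat.mod_eq_of_lt hb, Nat.mod_eq_of_lt hb', add_zero] at h1 h2
  exact ⟨h1, h2⟩

theorem pairCode_inj {n : ℕ} {u v u' v' : Fin n} (h : pairCode n u v = pairCode n u' v') :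
    s(u, v) = s(u', v') := by
  unfold pairCode at h
  split_ifs at h <;> obtain ⟨h1, h2⟩ := mul_add_inj (Fin.is_lt _) (Fin.is_lt _) h <;>
    rw [Fin.ext h1, Fin.ext h2]
  all_goals rw [Sym2.eq_swap]

theorem pairCode_congr {n : ℕ} {u v u' v' : Fin n} (h : s(u, v) = s(u', v')) :
    pairCode n u v = pairCode n u' v' := by
  rcases Sym2.eq_iff.1 h with ⟨rfl, rfl⟩ | ⟨rfl, rfl⟩
  · rfl
  · unfold pairCode
    rcases lt_trichotomy u v with h | rfl | h
    · rw [if_pos (by exact_mod_cast h), if_neg (by exact_mod_cast h.not_gt)]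
    · rfl
    · rw [if_neg (by exact_mod_cast h.not_gt), if_pos (by exact_mod_cast h)]

open Classical in
/-- The codes of the positive edges that are present. -/
noncomputable def posCodes {n : ℕ} (E : Present n) : Finset ℕ :=
  (Finset.univ.filter fun p : Fin n × Fin n => p.1 ≠ p.2 ∧ E s(p.1, p.2) = some 1).image
    fun p => pairCode n p.1 p.2

open Classical in
/-- The nodes that are joined to a node by a positive edge that is present. -/
noncomputable def nbrs {n : ℕ} (E : Present n) (u : Fin n) : Finset (Fin n) :=
  Finset.univ.filter fun v => E s(u, v) = some 1

theorem mem_posCodes {n : ℕ} {E : Present n} {e : ℕ} : e ∈ posCodes E ↔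
    ∃ u v : Fin n, u ≠ v ∧ E s(u, v) = some 1 ∧ pairCode n u v = e := by
  simp [posCodes, and_assoc]

theorem mem_nbrs {n : ℕ} {E : Present n} {u v : Fin n} :
    v ∈ nbrs E u ↔ E s(u, v) = some 1 := by
  simp [nbrs]

theorem pairCode_mem {n : ℕ} {E : Present n} {u v : Fin n} (huv : u ≠ v) :
    pairCode n u v ∈ posCodes E ↔ E s(u, v) = some 1 := by
  rw [mem_posCodes]
  constructor
  · rintro ⟨u', v', _, h, hc⟩
    rwa [← pairCode_inj hc]
  · exact fun h => ⟨u, v, huv, h, rfl⟩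

theorem posCodes_subset {n : ℕ} (E : Present n) : posCodes E ⊆ Finset.range (n * n) := by
  intro e he
  obtain ⟨u, v, _, _, rfl⟩ := mem_posCodes.1 he
  exact Finset.mem_range.2 (pairCode_lt u v)

/-- Updating a sum over the positive edges. The numbers `a` and `b` tell whether the edge becomes
positive, or ceases to be so. -/
theorem sum_posCodes_update {n : ℕ} {E : Present n} {u v : Fin n} (huv : u ≠ v)
    {x : Option ℤˣ} {a b : ℕ}
    (h : (a = 0 ∧ b = 0 ∧ E s(u, v) ≠ some 1 ∧ x ≠ some 1) ∨
      (a = 1 ∧ b = 0 ∧ E s(u, v) ≠ some 1 ∧ x = some 1) ∨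
      (a = 0 ∧ b = 1 ∧ E s(u, v) = some 1 ∧ x ≠ some 1)) (f : ℕ → ℕ) :
    ∑ e ∈ posCodes (Function.update E s(u, v) x), f e =
      ∑ e ∈ posCodes E, f e + a * f (pairCode n u v) - b * f (pairCode n u v) := by
  have key : ∀ e, e ∈ posCodes (Function.update E s(u, v) x) ↔
      if e = pairCode n u v then x = some 1 else e ∈ posCodes E := by
    intro e
    split_ifs with he
    · rw [he, pairCode_mem huv, Function.update_self]
    · simp only [mem_posCodes]
      have : ∀ u' v' : Fin n, pairCode n u' v' = e → s(u', v') ≠ s(u, v) := by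
        rintro u' v' rfl h
        exact he (pairCode_congr h)
      constructor
      · rintro ⟨u', v', h1, h2, h3⟩
        exact ⟨u', v', h1, by rwa [Function.update_of_ne (this _ _ h3)] at h2, h3⟩
      · rintro ⟨u', v', h1, h2, h3⟩
        exact ⟨u', v', h1, by rwa [Function.update_of_ne (this _ _ h3)], h3⟩
  have hm := pairCode_mem (E := E) huv
  rcases h with ⟨rfl, rfl, h1, h2⟩ | ⟨rfl, rfl, h1, h2⟩ | ⟨rfl, rfl, h1, h2⟩
  · have : posCodes (Function.update E s(u, v) x) = posCodes E := by
      ext e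
      rw [key]
      split_ifs with he
      · rw [he]; tauto
      · rfl
    simp [this]
  · have : posCodes (Function.update E s(u, v) x) = insert (pairCode n u v) (posCodes E) := by
      ext e
      rw [key, Finset.mem_insert]
      split_ifs <;> tauto
    rw [this, Finset.sum_insert (by tauto)]
    omega
  · have : posCodes (Function.update E s(u, v) x) = (posCodes E).erase (pairCode n u v) := by
      ext e
      rw [key, Finset.mem_erase]
      split_ifs <;> tauto
    have h3 := Finset.sum_erase_add (posCodes E) f (hm.2 h1)
    rw [this]
    omega

/-- Updating a sum over the positive neighbours of a node. -/
theorem sum_nbrs_update {n : ℕ} {E : Present n} {u v : Fin n} (huv : u ≠ v)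
    {x : Option ℤˣ} {a b : ℕ}
    (h : (a = 0 ∧ b = 0 ∧ E s(u, v) ≠ some 1 ∧ x ≠ some 1) ∨
      (a = 1 ∧ b = 0 ∧ E s(u, v) ≠ some 1 ∧ x = some 1) ∨
      (a = 0 ∧ b = 1 ∧ E s(u, v) = some 1 ∧ x ≠ some 1)) (f : ℕ → ℕ) (y : Fin n) :
    ∑ z ∈ nbrs (Function.update E s(u, v) x) y, f z =
      if y = u then ∑ z ∈ nbrs E y, f z + a * f v - b * f v
      else if y = v then ∑ z ∈ nbrs E y, f z + a * f u - b * f u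
      else ∑ z ∈ nbrs E y, f z := by
  have main : ∀ u v : Fin n, u ≠ v → ((a = 0 ∧ b = 0 ∧ E s(u, v) ≠ some 1 ∧ x ≠ some 1) ∨
      (a = 1 ∧ b = 0 ∧ E s(u, v) ≠ some 1 ∧ x = some 1) ∨
      (a = 0 ∧ b = 1 ∧ E s(u, v) = some 1 ∧ x ≠ some 1)) →
      ∑ z ∈ nbrs (Function.update E s(u, v) x) u, f z =
        ∑ z ∈ nbrs E u, f z + a * f v - b * f v := by
    intro u v huv h
    have key : ∀ z, z ∈ nbrs (Function.update E s(u, v) x) u ↔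
        if z = v then x = some 1 else z ∈ nbrs E u := by
      intro z
      rw [mem_nbrs, mem_nbrs]
      split_ifs with hz
      · rw [hz, Function.update_self]
      · rw [Function.update_of_ne]
        intro h
        rcases Sym2.eq_iff.1 h with ⟨_, h⟩ | ⟨h, _⟩
        · exact hz h
        · exact huv h
    have hm : v ∈ nbrs E u ↔ _ := mem_nbrs
    rcases h with ⟨rfl, rfl, h1, h2⟩ | ⟨rfl, rfl, h1, h2⟩ | ⟨rfl, rfl, h1, h2⟩
    · have : nbrs (Function.update E s(u, v) x) u = nbrs E u := by
        ext e
        rw [key]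
        split_ifs with he
        · rw [he]; tauto
        · rfl
      simp [this]
    · have : nbrs (Function.update E s(u, v) x) u = insert v (nbrs E u) := by
        ext e
        rw [key, Finset.mem_insert]
        split_ifs <;> tauto
      rw [this, Finset.sum_insert (by tauto)]
      omega
    · have : nbrs (Function.update E s(u, v) x) u = (nbrs E u).erase v := by
        ext e
        rw [key, Finset.mem_erase]
        split_ifs <;> tauto
      have h3 := Finset.sum_erase_add (nbrs E u) (fun z => f z) (hm.2 h1)
      rw [this]
      omega
  split_ifs with h1 h2
  · rw [h1]; exact main u v huv h
  · rw [h2, Sym2.eq_swap]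
    exact main v u huv.symm (by rwa [Sym2.eq_swap])
  · refine Finset.sum_congr ?_ fun _ _ => rfl
    ext z
    rw [mem_nbrs, mem_nbrs, Function.update_of_ne]
    intro h
    rcases Sym2.eq_iff.1 h with ⟨h, _⟩ | ⟨h, _⟩
    · exact h1 h
    · exact h2 h

/-- One step of a well-formed stream, as the sketches see it. -/
theorem Leads.step {n : ℕ} {E E' : Present n} {σ : Update n} {l : List (Update n)}
    (h : Leads E (σ :: l) E') (hd : ∀ u, E s(u, u) = none) :
    ∃ (u v : Fin n) (x : Option ℤˣ), u ≠ v ∧ σ.token.op ≤ 1 ∧ σ.token.fst = u ∧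
      σ.token.snd = v ∧ σ.token.sign ≤ 1 ∧ Leads (Function.update E s(u, v) x) l E' ∧
      (∀ u', Function.update E s(u, v) x s(u', u') = none) ∧
      ((σ.token.sign * σ.token.op = 0 ∧ σ.token.sign * (1 - σ.token.op) = 0 ∧
          E s(u, v) ≠ some 1 ∧ x ≠ some 1) ∨
        (σ.token.sign * σ.token.op = 1 ∧ σ.token.sign * (1 - σ.token.op) = 0 ∧
          E s(u, v) ≠ some 1 ∧ x = some 1) ∨
        (σ.token.sign * σ.token.op = 0 ∧ σ.token.sign * (1 - σ.token.op) = 1 ∧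
          E s(u, v) = some 1 ∧ x ≠ some 1)) := by
  have hdiag : ∀ (u v : Fin n) (x : Option ℤˣ), u ≠ v →
      ∀ u', Function.update E s(u, v) x s(u', u') = none := by
    intro u v x huv u'
    rw [Function.update_of_ne, hd]
    intro h
    rcases Sym2.eq_iff.1 h with ⟨h1, h2⟩ | ⟨h1, h2⟩
    · exact huv (h1.symm.trans h2)
    · exact huv (h2.symm.trans h1)
  cases h with
  | insert huv h hσ =>
    rename_i u v w
    refine ⟨u, v, some w, huv, le_rfl, rfl, rfl, ?_, hσ, hdiag _ _ _ huv, ?_⟩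
    · simp only [Update.token]; split_ifs <;> simp
    · rcases Int.units_eq_one_or w with rfl | rfl <;> simp [Update.token, h]
  | delete h hσ =>
    rename_i u v w
    have huv : u ≠ v := by
      rintro rfl
      rw [hd] at h
      exact absurd h (by simp)
    refine ⟨u, v, none, huv, zero_le_one, rfl, rfl, ?_, hσ, hdiag _ _ _ huv, ?_⟩
    · simp only [Update.token]; split_ifs <;> simp
    · rcases Int.units_eq_one_or w with rfl | rfl <;> simp [Update.token, h]

namespace Params

variable {P : Params} {coin : ℕ → Bool}

/-- The sketches hold the data of the positive edges that are present. -/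
structure Sketched (P : Params) (coin : ℕ → Bool) (E : Present P.n) (M : Memory) : Prop where
  sketch : ∀ j < P.reps, M (aSketch, j) = ∑ e ∈ posCodes E, P.hash coin j e
  print : ∀ u : Fin P.n, M (aPrint, u) = ∑ v ∈ nbrs E u, P.key coin v
  count : M (aCount, 0) = ∑ _e ∈ posCodes E, 1

theorem hash_le_one (j e : ℕ) : P.hash coin j e ≤ 1 :=
  Nat.lt_succ_iff.1 (Nat.mod_lt _ two_pos)

theorem sum_posCodes_le (E : Present P.n) {f : ℕ → ℕ} (hf : ∀ e, f e ≤ 1) :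
    ∑ e ∈ posCodes E, f e ≤ P.n * P.n := by
  calc ∑ e ∈ posCodes E, f e ≤ ∑ e ∈ posCodes E, 1 := Finset.sum_le_sum fun e _ => hf e
    _ = (posCodes E).card := by simp
    _ ≤ P.n * P.n := by simpa using Finset.card_le_card (posCodes_subset E)

theorem sum_nbrs_le (E : Present P.n) (u : Fin P.n) :
    ∑ v ∈ nbrs E u, P.key coin v ≤ P.n * 2 ^ P.keyBits := by
  calc ∑ v ∈ nbrs E u, P.key coin v ≤ ∑ v ∈ nbrs E u, 2 ^ P.keyBits :=
        Finset.sum_le_sum fun e _ => (bitsVal_lt _ _).le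
    _ = (nbrs E u).card * 2 ^ P.keyBits := by simp
    _ ≤ P.n * 2 ^ P.keyBits :=
        Nat.mul_le_mul_right _ (by simpa using Finset.card_le_univ (nbrs E u))

/-- A bound on the time for one stream item. -/
def updateTime (P : Params) : ℕ := P.reps * (P.width * P.width * 3 + 6) + 6

theorem updateProg_spec {s : Config} {E : Present P.n} {u v : Fin P.n} {x : Option ℤˣ}
    (hf : P.budget.Fits s.mem) (he : P.Env coin s.mem) (hs : P.Sketched coin E s.mem)
    (hu : s.mem (aToken, 2) = u) (hv : s.mem (aToken, 3) = v) (huv : u ≠ v)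
    (h : (s.mem (aToken, 4) * s.mem (aToken, 1) = 0 ∧
          s.mem (aToken, 4) * (1 - s.mem (aToken, 1)) = 0 ∧ E s(u, v) ≠ some 1 ∧ x ≠ some 1) ∨
        (s.mem (aToken, 4) * s.mem (aToken, 1) = 1 ∧
          s.mem (aToken, 4) * (1 - s.mem (aToken, 1)) = 0 ∧ E s(u, v) ≠ some 1 ∧ x = some 1) ∨
        (s.mem (aToken, 4) * s.mem (aToken, 1) = 0 ∧
          s.mem (aToken, 4) * (1 - s.mem (aToken, 1)) = 1 ∧ E s(u, v) = some 1 ∧ x ≠ some 1)) :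
    Wp P.par coin P.budget (updateProg P.c) s P.updateTime
      fun s' => P.Sketched coin (Function.update E s(u, v) x) s'.mem := by
  set a := s.mem (aToken, 4) * s.mem (aToken, 1) with ha
  set b := s.mem (aToken, 4) * (1 - s.mem (aToken, 1)) with hb
  set E' := Function.update E s(u, v) x with hE'
  have hN := sum_nbrs_update huv h
  have hC := sum_posCodes_update huv h
  have huv' : (u : ℕ) ≠ v := fun h => huv (Fin.ext h)
  have hpl : ∀ s' : Config, (∀ i, s'.mem (aToken, i) = s.mem (aToken, i)) →
      plusE.eval P.par s'.mem = a ∧ minusE.eval P.par s'.mem = b ∧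
      fstE.eval P.par s'.mem = u ∧ sndE.eval P.par s'.mem = v := by
    intro s' h
    simp [plusE, minusE, fstE, sndE, h, hu, hv, ha, hb]
  -- the fingerprint of the first node
  refine Wp.mono (T := 1 + (1 + (1 + (P.reps * ((P.width * P.width * 3 + 3 + 1) + 2) + 2 + 1))))
    (Q := _) (Wp.seq' (R := fun s' => ∀ y : Fin P.n, s'.mem (aPrint, y) = if y = u then
      ∑ z ∈ nbrs E' y, P.key coin z else ∑ z ∈ nbrs E y, P.key coin z) ?_ ?_)
    (by unfold updateTime; ring_nf; omega) (fun _ _ _ h => h)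
  · obtain ⟨h1, h2, h3, h4⟩ := hpl s fun _ => rfl
    have hval : s.mem (aPrint, u) + a * s.mem (aKey, v) - b * s.mem (aKey, v) =
        ∑ z ∈ nbrs E' u, P.key coin z := by
      rw [hs.print, he.key v v.2, hN, if_pos rfl]
    refine Wp.store hf ?_ fun y => ?_
    · simp only [eval_sub, eval_add, eval_mul, eval_load, h1, h2, h3, h4, hval]
      exact (sum_nbrs_le _ _).trans (by simp [Budget.cap, budget])
    · simp only [eval_sub, eval_add, eval_mul, eval_load, h1, h2, h3, h4, hval, write_mem]
      by_cases hy : y = u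
      · simp [hy]
      · have : (y : ℕ) ≠ u := fun h => hy (Fin.ext h)
        simp [hy, this, hs.print]
  -- the fingerprint of the second node
  intro s1 hF1 hf1 hp1
  refine Wp.seq' (R := fun s' => ∀ y : Fin P.n, s'.mem (aPrint, y) =
      ∑ z ∈ nbrs E' y, P.key coin z) ?_ ?_
  · obtain ⟨h1, h2, h3, h4⟩ := hpl s1 (hF1.mem _ (by decide))
    have hval : s1.mem (aPrint, v) + a * s1.mem (aKey, u) - b * s1.mem (aKey, u) =
        ∑ z ∈ nbrs E' v, P.key coin z := by
      rw [hp1, if_neg huv.symm, hF1.mem _ (by decide), he.key u u.2,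
        hN (P.key coin) v, if_neg huv.symm, if_pos rfl]
    refine Wp.store hf1 ?_ fun y => ?_
    · simp only [eval_sub, eval_add, eval_mul, eval_load, h1, h2, h3, h4, hval]
      exact (sum_nbrs_le _ _).trans (by simp [Budget.cap, budget])
    · simp only [eval_sub, eval_add, eval_mul, eval_load, h1, h2, h3, h4, hval, write_mem]
      by_cases hy : y = v
      · simp [hy]
      · have : (y : ℕ) ≠ v := fun h => hy (Fin.ext h)
        simp only [this, and_false, if_false, hp1]
        split_ifs with h5
        · rfl
        · rw [hN, if_neg h5, if_neg hy]
  -- the code of the edge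
  intro s2 hF2 hf2 hp2
  refine Wp.seq' (R := fun s' => s'.mem (iEdge, 0) = pairCode P.n u v) ?_ ?_
  · obtain ⟨h1, h2, h3, h4⟩ := hpl s2 fun i => by
      rw [hF2.mem _ (by decide), hF1.mem _ (by decide)]
    have hval : (if (u : ℕ) < v then 1 else 0) * ((u : ℕ) * P.n + v) +
        (if (v : ℕ) < u then 1 else 0) * (v * P.n + u) = pairCode P.n u v := by
      unfold pairCode
      split_ifs <;> simp <;> omega
    refine Wp.store hf2 ?_ ?_
    · simp only [eval_add, eval_mul, eval_lt, h3, h4, hval, eval_nE, eval_zero]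
      simpa [Budget.cap, budget] using (pairCode_lt u v).le
    · simp only [eval_add, eval_mul, eval_lt, h3, h4, hval, eval_nE, eval_zero]
      simp
  -- the estimators
  intro s3 hF3 hf3 hp3
  have he3 : P.Env coin s3.mem := ((he.frame hF1 (by decide)).frame hF2 (by decide)).frame hF3
    (by decide)
  have ht3 : ∀ i, s3.mem (aToken, i) = s.mem (aToken, i) := fun i => by
    rw [hF3.mem _ (by decide), hF2.mem _ (by decide), hF1.mem _ (by decide)]
  refine Wp.seq' (R := fun s' => ∀ j < P.reps, s'.mem (aSketch, j) =
    ∑ e ∈ posCodes E', P.hash coin j e) ?_ ?_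
  · refine Wp.mono (Wp.for (fun k s' => ∀ j < P.reps, s'.mem (aSketch, j) = if j < k then
      ∑ e ∈ posCodes E', P.hash coin j e else ∑ e ∈ posCodes E, P.hash coin j e)
      P.reps (P.width * P.width * 3 + 3 + 1) hf3 (by simp [Budget.cap, budget])
      (by exact of_decide_eq_true rfl) ?_ ?_ ?_ ?_) le_rfl ?_
    · intro k s' c hk
      simpa using hk
    · intro j hj
      rw [hF3.mem _ (by decide), hF2.mem _ (by decide), hF1.mem _ (by decide), hs.sketch j hj]
      simp
    · intro s' hF'
      exact eval_repsE P (he3.frame hF' (by exact of_decide_eq_true rfl)).width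
    · intro k s' hk hF' hf' hk0 hI
      have he' := he3.frame hF' (by exact of_decide_eq_true rfl)
      refine Wp.seq' (hashProg_spec hf' he' (by rwa [hk0])) fun s4 hF4 hf4 hh4 => ?_
      have hE4 : s'.mem (iEdge, 0) = pairCode P.n u v := by
        rw [hF'.mem _ (by exact of_decide_eq_true rfl), hp3]
      have hk4 : s4.mem (iRep, 0) = k := by rw [hF4.mem _ (by decide), hk0]
      obtain ⟨h1, h2, _, _⟩ := hpl s4 fun i => by
        rw [hF4.mem _ (by decide), hF'.mem _ (by exact of_decide_eq_true rfl), ht3]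
      have hval : s4.mem (aSketch, k) + a * s4.mem (aHash, 0) - b * s4.mem (aHash, 0) =
          ∑ e ∈ posCodes E', P.hash coin k e := by
        rw [hF4.mem _ (by decide), hI k hk, if_neg (lt_irrefl _), hh4, hk0, hE4, hC]
      refine Wp.store hf4 ?_ ?_
      · simp only [eval_sub, eval_add, eval_mul, eval_load, eval_cell, h1, h2, hk4, hval]
        exact (sum_posCodes_le _ (hash_le_one _)).trans (by simp [Budget.cap, budget, hk])
      · intro j hj
        simp only [eval_sub, eval_add, eval_mul, eval_load, eval_cell, h1, h2, hk4, hval,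
          write_mem]
        by_cases hjk : j = k
        · simp [hjk]
        · have : j < k + 1 ↔ j < k := by omega
          simp [hjk, this, hF4.mem aSketch (by decide), hI j hj]
    · intro s' _ _ hI j hj
      rw [hI j hj, if_pos hj]
  -- the number of edges
  intro s5 hF5 hf5 hp5
  obtain ⟨h1, h2, _, _⟩ := hpl s5 fun i => by
    rw [hF5.mem _ (by exact of_decide_eq_true rfl), ht3]
  have hval : s5.mem (aCount, 0) + a - b = ∑ _e ∈ posCodes E', 1 := by
    rw [hC, hF5.mem _ (by exact of_decide_eq_true rfl), hF3.mem _ (by decide),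
      hF2.mem _ (by decide), hF1.mem _ (by decide), hs.count, mul_one, mul_one]
  refine Wp.store hf5 ?_ ⟨fun j hj => ?_, fun y => ?_, ?_⟩
  · simp only [eval_sub, eval_add, eval_cell, h1, h2, hval, eval_zero]
    exact (sum_posCodes_le _ fun _ => le_rfl).trans (by simp [Budget.cap, budget])
  · simp [hp5 j hj]
  · simp [hF5.mem aPrint (by exact of_decide_eq_true rfl), hF3.mem aPrint (by decide), hp2]
  · simpa only [eval_sub, eval_add, eval_cell, h1, h2, write_mem, eval_zero, and_self, if_true]
      using hval

theorem next_spec {s : Config} {a : Token} {l : List Token} (hf : P.budget.Fits s.mem)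
    (hs : s.stream = a :: l) (h1 : a.op ≤ P.n) (h2 : a.fst ≤ P.n) (h3 : a.snd ≤ P.n)
    (h4 : a.sign ≤ P.n) :
    Wp P.par coin P.budget (.next aToken) s 1 fun s' => s'.stream = l ∧
      s'.mem (aToken, 0) = 1 ∧ s'.mem (aToken, 1) = a.op ∧ s'.mem (aToken, 2) = a.fst ∧
      s'.mem (aToken, 3) = a.snd ∧ s'.mem (aToken, 4) = a.sign := by
  have hn : s.next aToken = (((({ s with stream := l }.write aToken 0 1).write aToken 1
      a.op).write aToken 2 a.fst).write aToken 3 a.snd).write aToken 4 a.sign := by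
    unfold Config.next
    rw [hs]
  refine Wp.next hf ?_ ?_
  · rw [hn]
    have hf' : P.budget.Fits ({ s with stream := l } : Config).mem := hf
    refine ((((hf'.write ?_).write ?_).write ?_).write ?_).write ?_ <;>
      simp [Budget.cap, budget, *, P.one_le_n]
  · rw [hn]
    simp

theorem next_nil_spec {s : Config} (hf : P.budget.Fits s.mem) (hs : s.stream = []) :
    Wp P.par coin P.budget (.next aToken) s 1 fun s' => s'.mem (aToken, 0) = 0 := by
  have hn : s.next aToken = s.write aToken 0 0 := by
    unfold Config.next
    rw [hs]
  refine Wp.next hf ?_ ?_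
  · rw [hn]
    exact hf.write (Nat.zero_le _)
  · rw [hn]
    simp

/-- Before each test of the stream loop: either the stream has ended, or the next item is in the
memory and the remaining stream leads from the present edges to the final ones. -/
def StreamInv (P : Params) (coin : ℕ → Bool) (E' : Present P.n) (N k : ℕ) (s : Config) : Prop :=
  P.Env coin s.mem ∧ ((s.mem (aToken, 0) = 0 ∧ P.Sketched coin E' s.mem) ∨
    ∃ (E : Present P.n) (σ : Update P.n) (l : List (Update P.n)),
      s.mem (aToken, 0) = 1 ∧ s.mem (aToken, 1) = σ.token.op ∧ s.mem (aToken, 2) = σ.token.fst ∧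
      s.mem (aToken, 3) = σ.token.snd ∧ s.mem (aToken, 4) = σ.token.sign ∧
      s.stream = l.map Update.token ∧ l.length + 1 + k = N ∧ P.Sketched coin E s.mem ∧
      (∀ u, E s(u, u) = none) ∧ Leads E (σ :: l) E')

theorem token_le (σ : Update P.n) :
    σ.token.op ≤ P.n ∧ σ.token.fst ≤ P.n ∧ σ.token.snd ≤ P.n ∧ σ.token.sign ≤ P.n := by
  have := P.one_le_n
  cases σ with
  | insert u v w => exact ⟨this, u.2.le, v.2.le, by simp only [Update.token]; split_ifs <;> omega⟩
  | delete u v w =>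
    exact ⟨Nat.zero_le _, u.2.le, v.2.le, by simp only [Update.token]; split_ifs <;> omega⟩

/-- Reading the next item establishes the invariant of the stream loop. -/
theorem next_inv {s : Config} {E E' : Present P.n} {l : List (Update P.n)} {N k : ℕ}
    (hf : P.budget.Fits s.mem) (he : P.Env coin s.mem) (hs : P.Sketched coin E s.mem)
    (hd : ∀ u, E s(u, u) = none) (hl : Leads E l E') (hst : s.stream = l.map Update.token)
    (hk : l.length + k = N) :
    Wp P.par coin P.budget (.next aToken) s 1 (P.StreamInv coin E' N k) := by
  have hsk : ∀ s', Frame (.next aToken) s s' → P.Sketched coin E s'.mem := fun s' hF =>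
    ⟨fun j hj => by rw [hF.mem _ (by decide), hs.sketch j hj],
      fun u => by rw [hF.mem _ (by decide), hs.print],
      by rw [hF.mem _ (by decide), hs.count]⟩
  cases l with
  | nil =>
    refine (next_nil_spec hf hst).mono le_rfl
      fun s' hF hf' h => ⟨he.frame hF (by decide), .inl ⟨h, ?_⟩⟩
    cases hl
    exact hsk s' hF
  | cons σ l =>
    obtain ⟨h1, h2, h3, h4⟩ := token_le σ
    refine (next_spec hf hst h1 h2 h3 h4).mono le_rfl
      fun s' hF hf' ⟨g0, g1, g2, g3, g4, g5⟩ => ⟨he.frame hF (by decide),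
        .inr ⟨E, σ, l, g1, g2, g3, g4, g5, g0, ?_, hsk s' hF, hd, hl⟩⟩
    simpa using hk

theorem streamProg_spec {s : Config} {E' : Present P.n} {l : List (Update P.n)}
    (hf : P.budget.Fits s.mem) (he : P.Env coin s.mem)
    (h0 : ∀ x ∈ [aSketch, aPrint, aCount], ∀ i, s.mem (x, i) = 0)
    (hl : Leads (fun _ => none) l E') (hst : s.stream = l.map Update.token) :
    Wp P.par coin P.budget (streamProg P.c) s (l.length * (P.updateTime + 2) + 2)
      fun s' => P.Sketched coin E' s'.mem := by
  have hempty : posCodes (fun _ => none : Present P.n) = ∅ := by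
    ext e; simp [mem_posCodes]
  have hs : P.Sketched coin (fun _ => none) s.mem :=
    ⟨fun j _ => by rw [h0 _ (by simp), hempty]; rfl, fun u => by
      rw [h0 _ (by simp)]; simp [nbrs], by rw [h0 _ (by simp), hempty]; rfl⟩
  refine Wp.mono (T := 1 + ((l.length - 0) * (P.updateTime + 1 + 1) + 1)) (Wp.seq'
    (next_inv (N := l.length) (k := 0) hf he hs (fun _ => rfl) hl hst (by simp))
    fun s1 hF1 hf1 h1 => ?_) (by rw [Nat.sub_zero, add_assoc P.updateTime]; omega)
    (fun _ _ _ h => h)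
  refine Wp.while (P.StreamInv coin E' l.length) l.length (P.updateTime + 1) ?_ h1 hf1
  rintro k s2 ⟨he2, h2⟩ hf2
  rcases h2 with ⟨h2, h3⟩ | ⟨E, σ, l', g0, g1, g2, g3, g4, g5, g6, g7, g8, g9⟩
  · exact .inl ⟨h2, h3⟩
  · right
    refine ⟨by simp [g0], by omega, ?_⟩
    obtain ⟨u, v, x, huv, q1, q2, q3, q4, q5, q6, q7⟩ := g9.step g8
    refine Wp.seq' (updateProg_spec (x := x) hf2 he2 g7 (by rw [g2, q2]) (by rw [g3, q3]) huv
      (by rw [g1, g4]; exact q7)) fun s3 hF3 hf3 h3 => ?_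
    exact next_inv hf3 (he2.frame hF3 (by exact of_decide_eq_true rfl)) h3 q6 q5
      (by rw [hF3.stream (by rfl), g5]) (by omega)

end Params


/-! ### The search for a good candidate -/

/-- The square of the difference of two natural numbers. -/
def sqDiff (a b : ℕ) : ℕ := (a - b) * (a - b) + (b - a) * (b - a)

theorem sqDiff_le {a b m : ℕ} (ha : a ≤ m) (hb : b ≤ m) : sqDiff a b ≤ m * m := by
  unfold sqDiff
  rcases le_total a b with h | h
  · rw [Nat.sub_eq_zero_of_le h, zero_mul, zero_add]
    exact Nat.mul_le_mul (by omega) (by omega)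
  · rw [Nat.sub_eq_zero_of_le h, zero_mul, add_zero]
    exact Nat.mul_le_mul (by omega) (by omega)

namespace Params

variable (P : Params) (coin : ℕ → Bool)

/-- The label with a given code: the codes `d < n` are labels themselves; the code `n + v` is the
label of the node `v` in the base partition `ρ`. -/
def decode (ρ : ℕ → ℕ) (d : ℕ) : ℕ := if d < P.n then d else ρ (d - P.n)

/-- The code of the label of the node `u` in the `k`-th candidate partition, after the first `i`
moves. The moves are the digits of `k` in the base `2 * n ^ 2`. -/
def code (k : ℕ) : ℕ → ℕ → ℕ
  | 0, u => P.n + u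
  | i + 1, u => if u = k / P.base ^ i % P.base % P.n then k / P.base ^ i % P.base / P.n
      else code k i u

/-- The label of the node `u` in the `k`-th candidate partition. -/
def label (ρ : ℕ → ℕ) (k u : ℕ) : ℕ := P.decode ρ (P.code k P.moves u)

/-- Whether `e` is the code of a pair of nodes with equal labels, as a number. -/
def same (ℓ : ℕ → ℕ) (e : ℕ) : ℕ :=
  (if e / P.n < e % P.n then 1 else 0) * (if ℓ (e / P.n) = ℓ (e % P.n) then 1 else 0)

/-- The sum of the squared differences between the sketches of the set `X` of pairs and those of
the partition `ℓ`, over the estimators of a group. With the signs `1 - 2 * hash`, the sketch of a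
set is its size minus twice its sum of hash values. -/
def groupSum (X : Finset ℕ) (ℓ : ℕ → ℕ) (i : ℕ) : ℕ :=
  ∑ j ∈ Finset.range P.size, sqDiff
    (∑ _e ∈ X, 1 + 2 * ∑ e ∈ Finset.range (P.n * P.n), P.same ℓ e * P.hash coin (i * P.size + j) e)
    (∑ e ∈ Finset.range (P.n * P.n), P.same ℓ e + 2 * ∑ e ∈ X, P.hash coin (i * P.size + j) e)

/-- Whether a group votes for the claim that the distance is at most `d`. -/
def Vote (X : Finset ℕ) (ℓ : ℕ → ℕ) (d i : ℕ) : Prop :=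
  3 * P.prec * P.groupSum coin X ℓ i < (3 * P.prec + 1) * (P.size * d) + 1

instance (X : Finset ℕ) (ℓ : ℕ → ℕ) (d i : ℕ) : Decidable (P.Vote coin X ℓ d i) :=
  inferInstanceAs (Decidable (_ < _))

/-- The number of groups that vote for the claim that the distance is at most `d`. -/
def votes (X : Finset ℕ) (ℓ : ℕ → ℕ) (d : ℕ) : ℕ :=
  ∑ i ∈ Finset.range P.groups, if P.Vote coin X ℓ d i then 1 else 0

/-- The step `k` of the search, which tests the candidate `k % cands` with the distance
`k / cands`, is successful. -/
def Accepts (X : Finset ℕ) (ρ : ℕ → ℕ) (k : ℕ) : Prop :=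
  P.groups ≤ 2 * P.votes coin X (P.label ρ (k % P.cands)) (k / P.cands)

/-- The number of steps of the search. -/
def steps : ℕ := (P.n * P.n + 1) * P.cands

/-- The labels of the base partition: the fingerprints of the closed positive neighbourhoods,
increased by `n` so that they differ from the labels `d < n` that moves can introduce. -/
noncomputable def baseLabel (E : Present P.n) (v : ℕ) : ℕ :=
  if h : v < P.n then P.n + ∑ z ∈ nbrs E ⟨v, h⟩, P.key coin z + P.key coin v else 0

/-- A bound on the time to sum the hash values of a candidate. -/
def sumTime : ℕ := P.n * P.n * (P.width * P.width * 3 + 7) + 4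

/-- A bound on the time to count the votes. -/
def voteTime : ℕ := P.groups * (P.size * (P.sumTime + 4) + 6) + 3

/-- A bound on the time of one step of the search. -/
def stepTime : ℕ := P.n * 3 + 2 + 1 + (P.moves * 4 + 2) + P.voteTime + 2

variable {P coin}

theorem same_le_one (ℓ : ℕ → ℕ) (e : ℕ) : P.same ℓ e ≤ 1 := by
  unfold same
  split_ifs <;> simp

theorem sum_range_le {f : ℕ → ℕ} (hf : ∀ e, f e ≤ 1) (k : ℕ) :
    ∑ e ∈ Finset.range k, f e ≤ k := by
  simpa using Finset.sum_le_sum (s := Finset.range k) fun e _ => hf e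

theorem Sketched.frame {E : Present P.n} {p : Prog} {s s' : Config}
    (h : P.Sketched coin E s.mem) (hF : Frame p s s')
    (hp : ∀ x ∈ [aSketch, aPrint, aCount], x ∉ p.writes) : P.Sketched coin E s'.mem := by
  have := fun x hx => hF.mem x (hp x hx)
  exact ⟨fun j hj => by rw [this _ (by simp), h.sketch j hj],
    fun u => by rw [this _ (by simp), h.print],
    by rw [this _ (by simp), h.count]⟩

theorem eval_base_label {E : Present P.n} {M : Memory} (he : P.Env coin M)
    (hs : P.Sketched coin E M) {v : ℕ} (hv : v < P.n) :
    P.n + M (aPrint, v) + M (aKey, v) = P.baseLabel coin E v := by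
  rw [baseLabel, dif_pos hv, he.key v hv, ← hs.print ⟨v, hv⟩]

theorem baseLabel_le (E : Present P.n) (v : ℕ) :
    P.baseLabel coin E v ≤ P.n + (P.n + 1) * 2 ^ P.keyBits := by
  unfold baseLabel
  split_ifs with h
  · have h1 := sum_nbrs_le (coin := coin) E ⟨v, h⟩
    have h2 : P.key coin v < 2 ^ P.keyBits := bitsVal_lt _ _
    rw [add_mul]
    omega
  · exact Nat.zero_le _

theorem decode_le (E : Present P.n) (d : ℕ) :
    P.decode (P.baseLabel coin E) d ≤ P.n + (P.n + 1) * 2 ^ P.keyBits := by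
  unfold decode
  split_ifs with h
  · exact h.le.trans (Nat.le_add_right _ _)
  · exact baseLabel_le _ _

theorem labelProg_spec {s : Config} {E : Present P.n} (hf : P.budget.Fits s.mem)
    (he : P.Env coin s.mem) (hs : P.Sketched coin E s.mem) :
    Wp P.par coin P.budget labelProg s (P.n * 3 + 2 + (1 + (P.moves * 4 + 2)))
      fun s' => ∀ u < P.n, s'.mem (aLabel, u) =
        P.label (P.baseLabel coin E) (s.mem (aCand, 0) % P.cands) u := by
  set ρ := P.baseLabel coin E with hρ
  have hn := P.one_le_n
  refine Wp.seq' (R := fun s' => ∀ u < P.n, s'.mem (aLabel, u) = ρ u) ?_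
    fun s1 hF1 hf1 h1 => ?_
  · refine Wp.for (fun k s' => ∀ u < k, s'.mem (aLabel, u) = ρ u) P.n 1 hf
      (by simp [Budget.cap, budget]) (by decide) ?_ (by simp) (by simp) ?_
    · intro k s' a h
      simpa using h
    · intro k s' hk hF hfit hk0 hI
      have hv := eval_base_label (he.frame hF (by decide)) (hs.frame hF (by decide)) hk
      refine Wp.store hfit ?_ fun u hu => ?_
      · simp only [eval_add, eval_nE, eval_load, eval_cell, hk0, hv]
        exact (baseLabel_le _ _).trans (by simp [Budget.cap, budget, hk])
      · simp only [eval_add, eval_nE, eval_load, eval_cell, hk0, hv, write_mem]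
        rcases (Nat.lt_succ_iff.1 hu).lt_or_eq with hu | rfl
        · simp [hu.ne, hI u hu]
        · simp [hρ]
  have he1 := he.frame hF1 (by decide)
  have hs1 := hs.frame hF1 (by decide)
  have hc1 : s1.mem (aCand, 0) = s.mem (aCand, 0) := hF1.mem _ (by decide) _
  set c := s.mem (aCand, 0) % P.cands with hc
  refine Wp.seq' (R := fun s' => s'.mem (aMoves, 0) = c) ?_ fun s2 hF2 hf2 h2 => ?_
  · refine Wp.store hf1 ?_ ?_
    · simp only [eval_mod, eval_cell, hc1, candsE, he1.cands]
      simpa [Budget.cap, budget] using (Nat.mod_lt _ cands_pos).le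
    · simp [hc1, candsE, he1.cands, hc]
  have he2 := he1.frame hF2 (by decide)
  have hs2 := hs1.frame hF2 (by decide)
  refine Wp.mono (Wp.for (fun i s' => s'.mem (aMoves, 0) = c / P.base ^ i ∧
    ∀ u < P.n, s'.mem (aLabel, u) = P.decode ρ (P.code c i u)) P.moves 2 hf2
      (by simp [Budget.cap, budget, moves]) (by decide) ?_ ?_ (by simp) ?_) le_rfl
    (fun _ _ _ h => h.2)
  · intro k s' a h
    simpa using h
  · refine ⟨by simp [h2], fun u hu => ?_⟩
    rw [hF2.mem _ (by decide), h1 u hu]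
    simp [decode, code]
  · rintro i s' hi hF hfit hi0 ⟨h3, h4⟩
    have he' := he2.frame hF (by decide)
    have hs' := hs2.frame hF (by decide)
    set d := c / P.base ^ i % P.base with hd
    have hdb : d < P.base := Nat.mod_lt _ base_pos
    have hd2 : d / P.n < 2 * P.n := Nat.div_lt_of_lt_mul (by
      calc d < P.base := hdb
        _ = P.n * (2 * P.n) := by unfold base; ring)
    have hm : movedE.eval P.par s'.mem = d % P.n := by simp [movedE, h3, hd]
    have hcd : codeE.eval P.par s'.mem = d / P.n := by simp [codeE, h3, hd]
    have hval : (Expr.lt codeE nE * codeE + (1 - .lt codeE nE) *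
        (nE + .load aPrint (codeE - nE) + .load aKey (codeE - nE))).eval P.par s'.mem =
        P.decode ρ (d / P.n) := by
      simp only [eval_add, eval_mul, eval_sub, eval_lt, eval_one, eval_load, eval_nE, hcd]
      unfold decode
      split_ifs with h
      · simp
      · simp [eval_base_label he' hs' (show d / P.n - P.n < P.n by omega), hρ]
    refine Wp.seq' (T := 1) (T' := 1) (R := fun s3 => ∀ u < P.n, s3.mem (aLabel, u) =
      P.decode ρ (P.code c (i + 1) u)) ?_ fun s3 hF3 hf3 h5 => ?_
    · refine Wp.store hfit ?_ fun u hu => ?_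
      · rw [hval, hm]
        exact (decode_le _ _).trans (by simp [Budget.cap, budget, Nat.mod_lt _ hn])
      · rw [hval, hm, write_mem, code, ← hd]
        split_ifs with h6 h7 h7
        · rfl
        · exact absurd h6.2 h7
        · exact absurd ⟨rfl, h7⟩ h6
        · exact h4 u hu
    · have hq : s3.mem (aMoves, 0) = c / P.base ^ i := by rw [hF3.mem _ (by decide), h3]
      have hq' : c / P.base ^ i / P.base = c / P.base ^ (i + 1) := by
        rw [Nat.div_div_eq_div_mul, pow_succ]
      refine Wp.store hf3 ?_ ⟨?_, fun u hu => ?_⟩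
      · simp only [eval_div, eval_cell, eval_baseE, hq, hq', eval_zero]
        refine (Nat.div_le_self _ _).trans ?_
        simpa [Budget.cap, budget, hc] using (Nat.mod_lt _ cands_pos).le
      · simp [hq, hq']
      · simp [h5 u hu]

theorem sumProg_spec {s : Config} {ℓ : ℕ → ℕ} (hf : P.budget.Fits s.mem)
    (he : P.Env coin s.mem) (hj : s.mem (iRep, 0) < P.reps)
    (hl : ∀ u < P.n, s.mem (aLabel, u) = ℓ u) :
    Wp P.par coin P.budget sumProg s P.sumTime fun s' =>
      s'.mem (aAcc, 0) = ∑ e ∈ Finset.range (P.n * P.n), P.same ℓ e *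
        P.hash coin (s.mem (iRep, 0)) e ∧
      s'.mem (aPairs, 0) = ∑ e ∈ Finset.range (P.n * P.n), P.same ℓ e := by
  have hn := P.one_le_n
  refine Wp.mono (T := 1 + (1 + (P.n * P.n * ((P.width * P.width * 3 + 3 + 2) + 2) + 2)))
    (Q := _) (Wp.seq ?_) (by
      unfold sumTime
      rw [show P.width * P.width * 3 + 3 + 2 + 2 = P.width * P.width * 3 + 7 from rfl]
      omega) (fun _ _ _ h => h)
  refine Wp.store hf (Nat.zero_le _) ?_
  refine Wp.seq ?_
  have hf1 := hf.write (x := aAcc) (i := 0) (a := 0) (Nat.zero_le _)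
  refine Wp.store hf1 (Nat.zero_le _) ?_
  have hf2 := hf1.write (x := aPairs) (i := 0) (a := 0) (Nat.zero_le _)
  have he2 := (he.write (x := aAcc) 0 0 (by decide)).write (x := aPairs) 0 0 (by decide)
  refine Wp.for (fun k s' =>
      s'.mem (aAcc, 0) = ∑ e ∈ Finset.range k, P.same ℓ e * P.hash coin (s.mem (iRep, 0)) e ∧
      s'.mem (aPairs, 0) = ∑ e ∈ Finset.range k, P.same ℓ e) (P.n * P.n)
    (P.width * P.width * 3 + 3 + 2) hf2 (by simp [Budget.cap, budget]) (by decide) ?_ (by simp)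
    (by simp) ?_
  · intro k s' a h
    simpa using h
  · rintro k s' hk hF hfit hk0 ⟨h1, h2⟩
    have he' := he2.frame hF (by decide)
    have hrep : s'.mem (iRep, 0) = s.mem (iRep, 0) := by
      rw [hF.mem _ (by decide)]; simp
    have hlab : ∀ u < P.n, s'.mem (aLabel, u) = ℓ u := fun u hu => by
      rw [hF.mem _ (by decide)]; simp [hl u hu]
    have hk1 : k / P.n < P.n := Nat.div_lt_of_lt_mul hk
    have hk2 : k % P.n < P.n := Nat.mod_lt _ hn
    refine Wp.seq' (T' := 2) (hashProg_spec hfit he' (by rwa [hrep])) fun s3 hF3 hf3 h3 => ?_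
    rw [hrep, hk0] at h3
    have hk3 : s3.mem (iEdge, 0) = k := by rw [hF3.mem _ (by decide), hk0]
    have hlab3 : ∀ u < P.n, s3.mem (aLabel, u) = ℓ u := fun u hu => by
      rw [hF3.mem _ (by decide), hlab u hu]
    have hsame : sameE.eval P.par s3.mem = P.same ℓ k := by
      simp [sameE, same, hk3, hlab3 _ hk1, hlab3 _ hk2]
    have hA : s3.mem (aAcc, 0) + P.same ℓ k * P.hash coin (s.mem (iRep, 0)) k =
        ∑ e ∈ Finset.range (k + 1), P.same ℓ e * P.hash coin (s.mem (iRep, 0)) e := by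
      rw [hF3.mem _ (by decide), h1, Finset.sum_range_succ]
    have hB : s3.mem (aPairs, 0) + P.same ℓ k = ∑ e ∈ Finset.range (k + 1), P.same ℓ e := by
      rw [hF3.mem _ (by decide), h2, Finset.sum_range_succ]
    refine Wp.seq' (T := 1) (T' := 1) (R := fun s' => s'.mem (aAcc, 0) =
      ∑ e ∈ Finset.range (k + 1), P.same ℓ e * P.hash coin (s.mem (iRep, 0)) e) ?_
      fun s4 hF4 hf4 h4 => ?_
    · refine Wp.store hf3 ?_ ?_
      · simp only [eval_add, eval_mul, eval_cell, h3, hsame, hA, eval_zero]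
        refine (sum_range_le (fun e => ?_) _).trans (show k + 1 ≤ P.n * P.n from hk) |>.trans
          (by simp [Budget.cap, budget])
        exact Nat.mul_le_mul (same_le_one _ _) (hash_le_one _ _)
      · simpa [h3, hsame] using hA
    · have hsame4 : sameE.eval P.par s4.mem = P.same ℓ k := by
        rw [← hsame]
        simp only [sameE, eval_mul, eval_lt, eval_eq, eval_div, eval_mod, eval_cell, eval_load,
          eval_nE, hF4.mem iEdge (by decide), hF4.mem aLabel (by decide)]
        rfl
      have hB4 : s4.mem (aPairs, 0) + P.same ℓ k =
          ∑ e ∈ Finset.range (k + 1), P.same ℓ e := by rw [hF4.mem _ (by decide), hB]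
      refine Wp.store hf4 ?_ ⟨by simpa using h4, by simpa [hsame4] using hB4⟩
      simp only [eval_add, eval_cell, hsame4, hB4, eval_zero]
      exact (sum_range_le (same_le_one _) _).trans (show k + 1 ≤ P.n * P.n from hk) |>.trans
          (by simp [Budget.cap, budget])

theorem voteProg_spec {s : Config} {E : Present P.n} {ℓ : ℕ → ℕ} (hf : P.budget.Fits s.mem)
    (he : P.Env coin s.mem) (hs : P.Sketched coin E s.mem)
    (hl : ∀ u < P.n, s.mem (aLabel, u) = ℓ u) :
    Wp P.par coin P.budget (voteProg P.c) s P.voteTime fun s' =>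
      s'.mem (aVotes, 0) = P.votes coin (posCodes E) ℓ (s.mem (aCand, 0) / P.cands) := by
  set X := posCodes E with hX
  set d := s.mem (aCand, 0) / P.cands with hd
  refine Wp.mono (T := 1 + (P.groups * ((1 + (P.size * ((1 + (P.sumTime + 1)) + 2) + 2 + 1)) + 2)
    + 2)) (Q := _) (Wp.seq ?_) (by unfold voteTime; ring_nf; omega) (fun _ _ _ h => h)
  refine Wp.store hf (Nat.zero_le _) ?_
  have hf1 := hf.write (x := aVotes) (i := 0) (a := 0) (Nat.zero_le _)
  have he1 := he.write (x := aVotes) 0 0 (by decide)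
  refine Wp.for (fun k s' => s'.mem (aVotes, 0) = ∑ i ∈ Finset.range k,
      if P.Vote coin X ℓ d i then 1 else 0) P.groups
    (1 + (P.size * ((1 + (P.sumTime + 1)) + 2) + 2 + 1)) hf1 (by simp [Budget.cap, budget])
    (by exact of_decide_eq_true rfl) ?_ (by simp) ?_ ?_
  · intro k s' a h
    simpa using h
  · intro s' hF
    exact eval_groupsE P (he1.frame hF (by exact of_decide_eq_true rfl)).width
  intro i s2 hi hF2 hf2 hi0 hI
  have he2 := he1.frame hF2 (by exact of_decide_eq_true rfl)
  have hfr2 : ∀ x ∈ [aLabel, aCand, aCount, aSketch], ∀ j, s2.mem (x, j) = s.mem (x, j) := by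
    intro x hx j
    have hx' : x ≠ aVotes := by rintro rfl; exact absurd hx (by decide)
    rw [hF2.mem x (by revert x; exact of_decide_eq_true rfl)]
    simp [hx']
  refine Wp.seq ?_
  refine Wp.store hf2 (Nat.zero_le _) ?_
  have hf3 := hf2.write (x := aSquares) (i := 0) (a := 0) (Nat.zero_le _)
  have he3 := he2.write (x := aSquares) 0 0 (by decide)
  refine Wp.seq' (R := fun s' => s'.mem (aSquares, 0) = P.groupSum coin X ℓ i) ?_
    fun s4 hF4 hf4 h4 => ?_
  · refine Wp.for (fun k s' => s'.mem (aSquares, 0) = ∑ j ∈ Finset.range k, sqDiff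
      (∑ _e ∈ X, 1 + 2 * ∑ e ∈ Finset.range (P.n * P.n),
        P.same ℓ e * P.hash coin (i * P.size + j) e)
      (∑ e ∈ Finset.range (P.n * P.n), P.same ℓ e + 2 * ∑ e ∈ X,
        P.hash coin (i * P.size + j) e)) P.size (1 + (P.sumTime + 1)) hf3
      (by simp [Budget.cap, budget]) (by exact of_decide_eq_true rfl) ?_ (by simp) (by simp) ?_
    · intro k s' a h
      simpa using h
    intro j s4 hj hF4 hf4 hj0 hI4
    have he4 := he3.frame hF4 (by exact of_decide_eq_true rfl)
    have hfr4 : ∀ x ∈ [aLabel, aCand, aCount, aSketch], ∀ j, s4.mem (x, j) = s.mem (x, j) := by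
      intro x hx j
      have hx' : x ≠ aSquares := by rintro rfl; exact absurd hx (by decide)
      rw [hF4.mem x (by revert x; exact of_decide_eq_true rfl)]
      simp [hx', hfr2 x hx]
    have hi4 : s4.mem (iGroup, 0) = i := by
      rw [hF4.mem _ (by exact of_decide_eq_true rfl)]; simp [hi0]
    have hrep : i * P.size + j < P.reps := by
      calc i * P.size + j < (i + 1) * P.size := by rw [add_mul]; omega
        _ ≤ P.groups * P.size := Nat.mul_le_mul_right _ hi
    refine Wp.seq' (R := fun s' => s'.mem (iRep, 0) = i * P.size + j) ?_ fun s5 hF5 hf5 h5 => ?_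
    · refine Wp.store hf4 ?_ (by simp [hi4, hj0])
      simpa [hi4, hj0, Budget.cap, budget] using hrep.le
    refine Wp.seq' (sumProg_spec (ℓ := ℓ) hf5 (he4.frame hF5 (by decide)) (by rwa [h5]) ?_)
      fun s6 hF6 hf6 h6 => ?_
    · intro u hu
      rw [hF5.mem _ (by decide), hfr4 _ (by decide), hl u hu]
    have hcnt : s6.mem (aCount, 0) = ∑ _e ∈ X, 1 := by
      rw [hF6.mem _ (by decide), hF5.mem _ (by decide), hfr4 _ (by decide), hs.count]
    have hrep6 : s6.mem (iRep, 0) = i * P.size + j := by rw [hF6.mem _ (by decide), h5]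
    have hsk : s6.mem (aSketch, i * P.size + j) = ∑ e ∈ X, P.hash coin (i * P.size + j) e := by
      rw [hF6.mem _ (by decide), hF5.mem _ (by decide), hfr4 _ (by decide), hs.sketch _ hrep]
    have hsq : s6.mem (aSquares, 0) = s4.mem (aSquares, 0) := by
      rw [hF6.mem _ (by decide), hF5.mem _ (by decide)]
    have hval : (Expr.cell aSquares + sqDiffE (.cell aCount + 2 * .cell aAcc)
        (.cell aPairs + 2 * .load aSketch (.cell iRep))).eval P.par s6.mem =
        ∑ j ∈ Finset.range (j + 1), sqDiff
        (∑ _e ∈ X, 1 + 2 * ∑ e ∈ Finset.range (P.n * P.n),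
          P.same ℓ e * P.hash coin (i * P.size + j) e)
        (∑ e ∈ Finset.range (P.n * P.n), P.same ℓ e + 2 * ∑ e ∈ X,
          P.hash coin (i * P.size + j) e) := by
      simp only [eval_add, eval_cell, sqDiffE, eval_mul, eval_sub, eval_ofNat, eval_load, hcnt,
        hrep6, hsk, hsq, hI4, h6.1, h6.2, h5, Finset.sum_range_succ _ j]
      rfl
    refine Wp.store hf6 ?_ ?_
    · rw [hval]
      have hle : ∀ j, sqDiff
          (∑ _e ∈ X, 1 + 2 * ∑ e ∈ Finset.range (P.n * P.n),
            P.same ℓ e * P.hash coin (i * P.size + j) e)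
          (∑ e ∈ Finset.range (P.n * P.n), P.same ℓ e + 2 * ∑ e ∈ X,
            P.hash coin (i * P.size + j) e) ≤ 9 * (P.n * P.n) * (P.n * P.n) := by
        intro j
        have g1 := sum_posCodes_le E fun _ => le_refl 1
        have g2 := sum_posCodes_le E (hash_le_one (P := P) (coin := coin) (i * P.size + j))
        have g3 := sum_range_le (same_le_one (P := P) ℓ) (P.n * P.n)
        have g4 : ∑ e ∈ Finset.range (P.n * P.n), P.same ℓ e * P.hash coin (i * P.size + j) e ≤
            P.n * P.n := sum_range_le (f := fun e => P.same ℓ e * P.hash coin (i * P.size + j) e)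
          (fun e => Nat.mul_le_mul (same_le_one _ _) (hash_le_one _ _)) (P.n * P.n)
        rw [← hX] at g1 g2
        refine (sqDiff_le (m := 3 * (P.n * P.n)) (by omega) (by omega)).trans (le_of_eq ?_)
        ring
      refine (Finset.sum_le_sum fun j _ => hle j).trans ?_
      simp only [Finset.sum_const, Finset.card_range, smul_eq_mul]
      refine (Nat.mul_le_mul_right _ (show j + 1 ≤ P.size from hj)).trans ?_
      simp [Budget.cap, budget]
    · rw [hval]
      simp
  · have hcand : s4.mem (aCand, 0) / s4.mem (aCands, 0) = d := by
      rw [(he3.frame hF4 (by exact of_decide_eq_true rfl)).cands,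
        hF4.mem _ (by exact of_decide_eq_true rfl)]
      simp [hfr2 aCand (by decide), hd]
    have hvotes : s4.mem (aVotes, 0) = ∑ i ∈ Finset.range i,
        if P.Vote coin X ℓ d i then 1 else 0 := by
      rw [hF4.mem _ (by exact of_decide_eq_true rfl)]
      simp [hI]
    have hval : (Expr.cell aVotes + .lt (3 * precE * .cell aSquares)
        ((3 * precE + 1) * (sizeE * (.cell aCand / candsE)) + 1)).eval P.par s4.mem =
        ∑ i ∈ Finset.range (i + 1), if P.Vote coin X ℓ d i then 1 else 0 := by
      rw [Finset.sum_range_succ, ← hvotes]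
      simp only [eval_add, eval_cell, eval_lt, eval_mul, eval_ofNat, eval_precE,
        eval_sizeE, eval_div, candsE, hcand, h4, Vote]
      rfl
    refine Wp.store hf4 ?_ ?_
    · rw [hval]
      refine (sum_range_le (fun i => by split_ifs <;> simp) _).trans
        (show i + 1 ≤ P.groups from hi) |>.trans (by simp [Budget.cap, budget])
    · rw [hval]
      simp

/-- The result of the search: the first successful step, and the labels of its candidate. -/
def SearchResult (P : Params) (coin : ℕ → Bool) (E : Present P.n) (s : Config) : Prop :=
  s.mem (aCand, 0) ≤ P.steps ∧
  (∀ k < s.mem (aCand, 0), ¬ P.Accepts coin (posCodes E) (P.baseLabel coin E) k) ∧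
  (s.mem (aCand, 0) < P.steps →
    P.Accepts coin (posCodes E) (P.baseLabel coin E) (s.mem (aCand, 0)) ∧
    ∀ u < P.n, s.mem (aLabel, u) =
      P.label (P.baseLabel coin E) (s.mem (aCand, 0) % P.cands) u)

theorem searchProg_spec {s : Config} {E : Present P.n} (hf : P.budget.Fits s.mem)
    (he : P.Env coin s.mem) (hs : P.Sketched coin E s.mem) (h0 : s.mem (aCand, 0) = 0)
    (h0' : s.mem (aFound, 0) = 0) :
    Wp P.par coin P.budget (searchProg P.c) s (P.steps * (P.stepTime + 1) + 1)
      (P.SearchResult coin E) := by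
  refine Wp.mono (T := (P.steps - 0) * (P.stepTime + 1) + 1) (Q := _)
    (Wp.while (k := 0) (s := s) (fun k s' => P.Env coin s'.mem ∧ P.Sketched coin E s'.mem ∧
      ((k ≤ P.steps ∧ s'.mem (aFound, 0) = 0 ∧ s'.mem (aCand, 0) = k ∧
        ∀ i < k, ¬ P.Accepts coin (posCodes E) (P.baseLabel coin E) i) ∨
      (s'.mem (aFound, 0) = 1 ∧ s'.mem (aCand, 0) < P.steps ∧ P.SearchResult coin E s')))
      P.steps P.stepTime ?_ ⟨he, hs, .inl ⟨Nat.zero_le _, h0', h0, by simp⟩⟩ hf)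
    (by simp) (fun _ _ _ h => h)
  rintro k s1 ⟨he1, hs1, h1⟩ hf1
  have hcond : (Expr.lt (.cell aCand) ((nE * nE + 1) * candsE) * (1 - .cell aFound)).eval P.par
      s1.mem = (if s1.mem (aCand, 0) < P.steps then 1 else 0) * (1 - s1.mem (aFound, 0)) := by
    simp only [steps, candsE, eval_mul, eval_lt, eval_sub, eval_one, eval_cell, eval_add, eval_nE,
      he1.cands]
    rfl
  rw [hcond]
  rcases h1 with ⟨hk, h2, h3, h4⟩ | ⟨h2, _, h3⟩
  swap
  · left
    exact ⟨by simp [h2], h3⟩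
  rcases hk.lt_or_eq with hk | rfl
  swap
  · left
    exact ⟨by simp [h3], h3.le, by rwa [h3], fun h => absurd h3 h.ne⟩
  right
  refine ⟨by simp [h2, h3, hk], hk, ?_⟩
  refine Wp.mono (T := P.n * 3 + 2 + (1 + (P.moves * 4 + 2)) + (P.voteTime + (1 + 1))) (Wp.seq'
    (labelProg_spec hf1 he1 hs1) fun s2 hF2 hf2 hl2 => ?_) (by unfold stepTime; omega)
    (fun _ _ _ h => h)
  have he2 := he1.frame hF2 (by decide)
  have hs2 := hs1.frame hF2 (by decide)
  have hc2 : s2.mem (aCand, 0) = k := by rw [hF2.mem _ (by decide), h3]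
  rw [h3] at hl2
  refine Wp.seq' (voteProg_spec hf2 he2 hs2 hl2) fun s3 hF3 hf3 hv3 => ?_
  have he3 := he2.frame hF3 (by exact of_decide_eq_true rfl)
  have hs3 := hs2.frame hF3 (by exact of_decide_eq_true rfl)
  have hc3 : s3.mem (aCand, 0) = k := by rw [hF3.mem _ (by exact of_decide_eq_true rfl), hc2]
  have hl3 : ∀ u < P.n, s3.mem (aLabel, u) =
      P.label (P.baseLabel coin E) (k % P.cands) u := fun u hu => by
    rw [hF3.mem _ (by exact of_decide_eq_true rfl), hl2 u hu]
  rw [hc2] at hv3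
  have hval : (1 - Expr.lt (2 * .cell aVotes) (groupsE P.c)).eval P.par s3.mem =
      1 - if 2 * P.votes coin (posCodes E) (P.label (P.baseLabel coin E) (k % P.cands))
        (k / P.cands) < P.groups then 1 else 0 := by
    simp [eval_groupsE P he3.width, hv3]
  refine Wp.seq' (R := fun s' => s'.mem (aFound, 0) =
    1 - if 2 * P.votes coin (posCodes E) (P.label (P.baseLabel coin E) (k % P.cands))
        (k / P.cands) < P.groups then 1 else 0) ?_ fun s4 hF4 hf4 h4' => ?_
  · refine Wp.store hf3 ?_ ?_
    · rw [hval]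
      exact (Nat.sub_le _ _).trans (by simp [Budget.cap, budget])
    · rw [hval]
      simp
  have he4 := he3.frame hF4 (by exact of_decide_eq_true rfl)
  have hs4 := hs3.frame hF4 (by exact of_decide_eq_true rfl)
  have hc4 : s4.mem (aCand, 0) = k := by rw [hF4.mem _ (by exact of_decide_eq_true rfl), hc3]
  have hl4 : ∀ u < P.n, s4.mem (aLabel, u) =
      P.label (P.baseLabel coin E) (k % P.cands) u := fun u hu => by
    rw [hF4.mem _ (by exact of_decide_eq_true rfl), hl3 u hu]
  refine Wp.mono (T := 1) (Q := fun s5 => s5.mem (aCand, 0) = k + (1 - s4.mem (aFound, 0))) ?_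
    le_rfl fun s5 hF5 hf5 hc5 => ?_
  · refine Wp.store hf4 ?_ (by simp [hc4])
    simp only [eval_add, eval_sub, eval_one, eval_cell, hc4, eval_zero]
    refine (show k + (1 - _) ≤ P.steps by omega).trans ?_
    simp [Budget.cap, budget, steps]
  refine ⟨he4.frame hF5 (by decide), hs4.frame hF5 (by decide), ?_⟩
  have hf5 : s5.mem (aFound, 0) = s4.mem (aFound, 0) := hF5.mem _ (by decide) _
  by_cases hacc : P.Accepts coin (posCodes E) (P.baseLabel coin E) k
  · right
    have hlt := not_lt.2 hacc
    rw [if_neg hlt] at h4'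
    rw [h4'] at hc5 hf5
    have hc5' : s5.mem (aCand, 0) = k := by simpa using hc5
    refine ⟨by simpa using hf5, by rw [hc5']; exact hk, ?_⟩
    unfold SearchResult
    rw [hc5']
    refine ⟨hk.le, h4, fun _ => ⟨hacc, fun u hu => ?_⟩⟩
    rw [hF5.mem _ (by decide), hl4 u hu]
  · left
    have hlt := not_le.1 hacc
    rw [if_pos hlt] at h4'
    rw [h4'] at hc5 hf5
    refine ⟨hk, by simpa using hf5, by simpa using hc5, fun i hi => ?_⟩
    rcases (Nat.lt_succ_iff.1 hi).lt_or_eq with hi | rfl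
    · exact h4 i hi
    · exact hacc

theorem outputProg_spec {s : Config} (hf : P.budget.Fits s.mem) (he : P.Env coin s.mem)
    (hc : s.mem (aCand, 0) ≤ P.steps) :
    Wp P.par coin P.budget outputProg s 2 fun s' =>
      s'.mem (aOut, 0) = s.mem (aCand, 0) / P.cands + s.mem (aCand, 0) / P.cands / P.prec ∧
      s'.mem (aOut, 1) = 1 := by
  refine Wp.seq' (T := 1) (T' := 1) (R := fun s' => s'.mem (aOut, 0) =
    s.mem (aCand, 0) / P.cands + s.mem (aCand, 0) / P.cands / P.prec) ?_ fun s' _ hf' h => ?_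
  · have h1 : s.mem (aCand, 0) / P.cands ≤ P.n * P.n + 1 :=
      (Nat.div_le_iff_le_mul_add_pred cands_pos).2 (hc.trans (by
        unfold steps; rw [mul_comm]; exact Nat.le_add_right _ _))
    have h2 := Nat.div_le_self (s.mem (aCand, 0) / P.cands) P.prec
    refine Wp.store hf ?_ (by simp [candsE, he.cands])
    simp only [eval_add, eval_div, eval_cell, candsE, he.cands, eval_precE, eval_zero]
    exact (show _ ≤ 2 * (P.n * P.n + 1) by omega).trans (by simp [Budget.cap, budget])
  · refine Wp.store hf' ?_ ⟨by simpa using h, by simp⟩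
    simp only [eval_one, Budget.cap, budget]
    simp only [Nat.ofNat_pos, Nat.one_lt_ofNat, and_self, if_true]
    omega

/-- A bound on the time of the program for a stream of length `l`. -/
def totalTime (P : Params) (l : ℕ) : ℕ :=
  (P.width * 3 + 2 + (P.moves * 3 + 3 + (P.n * (P.keyBits * 4 + 4) + 2 +
        (P.reps * (P.width * P.width) * 4 + 2)))) +
    ((l * (P.updateTime + 2) + 2) + ((P.steps * (P.stepTime + 1) + 1) + 2))

theorem mainProg_spec {E : Present P.n} {σ : List (Update P.n)}
    (hl : Leads (fun _ => none) σ E) :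
    Wp P.par coin P.budget (mainProg P.c) ⟨0, σ.map Update.token, 0⟩ (P.totalTime σ.length)
      fun s => P.SearchResult coin E s ∧
        s.mem (aOut, 0) = s.mem (aCand, 0) / P.cands + s.mem (aCand, 0) / P.cands / P.prec ∧
        s.mem (aOut, 1) = 1 := by
  refine Wp.seq' (setupProg_spec rfl rfl) fun s1 hF1 hf1 he1 => ?_
  have h0 : ∀ x, x ∉ (setupProg P.c).writes → ∀ i, s1.mem (x, i) = 0 := fun x hx i => by
    rw [hF1.mem x hx]
    rfl
  refine Wp.seq' (streamProg_spec hf1 he1 (fun x hx => h0 x (by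
    revert x; exact of_decide_eq_true rfl)) hl (hF1.stream rfl)) fun s2 hF2 hf2 hs2 => ?_
  have he2 := he1.frame hF2 (by exact of_decide_eq_true rfl)
  refine Wp.seq' (searchProg_spec hf2 he2 hs2 ?_ ?_) fun s3 hF3 hf3 h3 => ?_
  · rw [hF2.mem _ (by exact of_decide_eq_true rfl), h0 _ (by exact of_decide_eq_true rfl)]
  · rw [hF2.mem _ (by exact of_decide_eq_true rfl), h0 _ (by exact of_decide_eq_true rfl)]
  refine (outputProg_spec hf3 (he2.frame hF3 (by exact of_decide_eq_true rfl)) h3.1).mono le_rfl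
    fun s4 hF4 _ h4 => ?_
  have hc4 : s4.mem (aCand, 0) = s3.mem (aCand, 0) := hF4.mem _ (by decide) _
  unfold SearchResult at h3 ⊢
  rw [hc4]
  refine ⟨⟨h3.1, h3.2.1, fun h => ⟨(h3.2.2 h).1, fun u hu => ?_⟩⟩, h4⟩
  rw [hF4.mem _ (by decide), (h3.2.2 h).2 u hu]

end Params


/-! ### Fourth moments of random quadratic forms -/

/-- Four numbers with `w` binary digits cancel in pairs if the products of any two digits do. The
digits themselves do not suffice (`0`, `1`, `2`, `3` have the bitwise sum zero), and so the hash
values have to be quadratic forms. If `a` differs from `b`, `c` and `d` at the digits `i`, `j` and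
`k`, then the equations for the pairs among `i`, `j` and `k` are contradictory. -/
theorem paired_of_bits {w a b c d : ℕ} (ha : a < 2 ^ w) (hb : b < 2 ^ w) (hc : c < 2 ^ w)
    (hd : d < 2 ^ w)
    (h : ∀ i < w, ∀ j < w, ((a.testBit i && a.testBit j) ^^ (b.testBit i && b.testBit j) ^^
      (c.testBit i && c.testBit j) ^^ (d.testBit i && d.testBit j)) = false) :
    (a = b ∧ c = d) ∨ (a = c ∧ b = d) ∨ (a = d ∧ b = c) := by
  have hlt : ∀ {x y : ℕ}, x < 2 ^ w → y < 2 ^ w → (∀ i < w, x.testBit i = y.testBit i) →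
      x = y := by
    intro x y hx hy hxy
    refine Nat.eq_of_testBit_eq fun i => ?_
    rcases lt_or_ge i w with hi | hi
    · exact hxy i hi
    · have h2 := Nat.pow_le_pow_right two_pos hi
      rw [Nat.testBit_lt_two_pow (hx.trans_le h2), Nat.testBit_lt_two_pow (hy.trans_le h2)]
  -- the digits of `d` are determined by the other ones
  have hdi : ∀ i < w, d.testBit i = (a.testBit i ^^ b.testBit i ^^ c.testBit i) := by
    intro i hi
    have := h i hi i hi
    revert this
    generalize a.testBit i = a, b.testBit i = b, c.testBit i = c, d.testBit i = d
    revert a b c d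
    decide
  by_cases hab : a = b
  · left
    refine ⟨hab, hlt hc hd fun i hi => ?_⟩
    rw [hdi i hi, hab]
    simp
  by_cases hac : a = c
  · right; left
    refine ⟨hac, hlt hb hd fun i hi => ?_⟩
    rw [hdi i hi, hac]
    generalize b.testBit i = b, c.testBit i = c
    revert b c
    decide
  by_cases had : a = d
  · right; right
    refine ⟨had, hlt hb hc fun i hi => ?_⟩
    have := hdi i hi
    rw [← had] at this
    revert this
    generalize a.testBit i = a, b.testBit i = b, c.testBit i = c
    revert a b c
    decide
  exfalso
  obtain ⟨i, hi, h1⟩ : ∃ i < w, a.testBit i ≠ b.testBit i := by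
    by_contra! hcon
    exact hab (hlt ha hb hcon)
  obtain ⟨j, hj, h2⟩ : ∃ i < w, a.testBit i ≠ c.testBit i := by
    by_contra! hcon
    exact hac (hlt ha hc hcon)
  obtain ⟨k, hk, h3⟩ : ∃ i < w, a.testBit i ≠ d.testBit i := by
    by_contra! hcon
    exact had (hlt ha hd hcon)
  have hij := h i hi j hj
  have hik := h i hi k hk
  have hjk := h j hj k hk
  rw [hdi i hi, hdi j hj] at hij
  rw [hdi i hi, hdi k hk] at hik
  rw [hdi j hj, hdi k hk] at hjk
  rw [hdi k hk] at h3
  revert h1 h2 h3 hij hik hjk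
  generalize a.testBit i = a1, b.testBit i = b1, c.testBit i = c1, a.testBit j = a2,
    b.testBit j = b2, c.testBit j = c2, a.testBit k = a3, b.testBit k = b3, c.testBit k = c3
  revert a1 b1 c1 a2 b2 c2 a3 b3 c3
  decide

/-- The product of the binary digits of `e` at the positions `k / w` and `k % w`. -/
def digitProd (w k e : ℕ) : ℕ := (e / 2 ^ (k / w) % 2) * (e / 2 ^ (k % w) % 2)

theorem digitProd_eq (w k e : ℕ) :
    digitProd w k e = (e.testBit (k / w) && e.testBit (k % w)).toNat := by
  have h : ∀ i, e / 2 ^ i % 2 = (e.testBit i).toNat := by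
    intro i
    rw [Nat.testBit_eq_decide_div_mod_eq]
    rcases Nat.mod_two_eq_zero_or_one (e / 2 ^ i) with h | h <;> simp [h]
  rw [digitProd, h, h]
  cases e.testBit (k / w) <;> cases e.testBit (k % w) <;> rfl

/-- The sign that the quadratic form with coefficients `q` gives to `e`. -/
def sign (w : ℕ) (q : Fin (w * w) → Bool) (e : ℕ) : ℤ :=
  (-1) ^ ∑ k, (q k).toNat * digitProd w k e

theorem sign_mul_self (w : ℕ) (q : Fin (w * w) → Bool) (e : ℕ) : sign w q e * sign w q e = 1 := by
  unfold sign
  rw [← mul_pow]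
  simp

/-- Four values of a random quadratic form are uncorrelated, unless they cancel in pairs. -/
theorem sum_sign_eq_zero {w a b c d : ℕ} (ha : a < 2 ^ w) (hb : b < 2 ^ w) (hc : c < 2 ^ w)
    (hd : d < 2 ^ w) (h : ¬ ((a = b ∧ c = d) ∨ (a = c ∧ b = d) ∨ (a = d ∧ b = c))) :
    ∑ q : Fin (w * w) → Bool, sign w q a * sign w q b * (sign w q c * sign w q d) = 0 := by
  obtain ⟨i, hi, j, hj, hij⟩ : ∃ i < w, ∃ j < w,
      ((a.testBit i && a.testBit j) ^^ (b.testBit i && b.testBit j) ^^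
      (c.testBit i && c.testBit j) ^^ (d.testBit i && d.testBit j)) = true := by
    by_contra! hcon
    exact h (paired_of_bits ha hb hc hd (by simpa using hcon))
  have hw : 0 < w := by omega
  have hk : i * w + j < w * w := by
    calc i * w + j < (i + 1) * w := by rw [add_mul]; omega
      _ ≤ w * w := Nat.mul_le_mul_right _ hi
  have h1 : (i * w + j) / w = i := by
    rw [mul_comm, Nat.mul_add_div hw, Nat.div_eq_of_lt hj, add_zero]
  have h2 : (i * w + j) % w = j := by
    rw [mul_comm, Nat.mul_add_mod, Nat.mod_eq_of_lt hj]
  set m : ℕ → ℕ := fun k => digitProd w k a + digitProd w k b + digitProd w k c + digitProd w k d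
    with hm
  have hodd : (-1 : ℤ) ^ m (i * w + j) = -1 := by
    rw [hm]
    simp only [digitProd_eq, h1, h2]
    revert hij
    generalize (a.testBit i && a.testBit j) = a, (b.testBit i && b.testBit j) = b,
      (c.testBit i && c.testBit j) = c, (d.testBit i && d.testBit j) = d
    revert a b c d
    decide
  have hprod : ∀ q : Fin (w * w) → Bool, sign w q a * sign w q b * (sign w q c * sign w q d) =
      ∏ k : Fin (w * w), (-1 : ℤ) ^ ((q k).toNat * m k) := by
    intro q
    unfold sign
    rw [← pow_add, ← pow_add, ← pow_add, Finset.prod_pow_eq_pow_sum, ← Finset.sum_add_distrib,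
      ← Finset.sum_add_distrib, ← Finset.sum_add_distrib]
    congr 1
    refine Finset.sum_congr rfl fun k _ => ?_
    rw [hm]
    ring
  simp only [hprod]
  have := Finset.prod_univ_sum (fun _ : Fin (w * w) => (Finset.univ : Finset Bool))
    (fun k x => (-1 : ℤ) ^ (x.toNat * m k))
  rw [Fintype.piFinset_univ] at this
  rw [← this]
  refine Finset.prod_eq_zero (Finset.mem_univ ⟨i * w + j, hk⟩) ?_
  simp [hodd]

/-- The second moment of a signed sum. -/
theorem sum_sq_signed {w : ℕ} {S : Finset ℕ} (hS : ∀ e ∈ S, e < 2 ^ w) (δ : ℕ → ℤ) :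
    ∑ q : Fin (w * w) → Bool, (∑ e ∈ S, δ e * sign w q e) ^ 2 =
    2 ^ (w * w) * ∑ e ∈ S, δ e ^ 2 := by
  have h : ∀ a ∈ S, ∀ b ∈ S, ∑ q : Fin (w * w) → Bool, δ a * sign w q a * (δ b * sign w q b) =
      if a = b then 2 ^ (w * w) * δ a ^ 2 else 0 := by
    intro a ha b hb
    have e1 : ∀ q : Fin (w * w) → Bool, δ a * sign w q a * (δ b * sign w q b) =
        δ a * δ b * (sign w q a * sign w q b * (sign w q a * sign w q a)) := by
      intro q
      rw [sign_mul_self]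
      ring
    simp only [e1, ← Finset.mul_sum]
    split_ifs with hab
    · subst hab
      simp only [sign_mul_self, mul_one, Finset.sum_const, Finset.card_univ, Fintype.card_fun,
        Fintype.card_bool, Fintype.card_fin, nsmul_eq_mul]
      push_cast
      ring
    · rw [sum_sign_eq_zero (hS a ha) (hS b hb) (hS a ha) (hS a ha) (by tauto), mul_zero]
  simp only [sq, Finset.sum_mul_sum]
  rw [Finset.sum_comm]
  calc ∑ a ∈ S, ∑ q : Fin (w * w) → Bool, ∑ b ∈ S, δ a * sign w q a * (δ b * sign w q b)
      = ∑ a ∈ S, ∑ b ∈ S, if a = b then 2 ^ (w * w) * δ a ^ 2 else 0 := by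
        refine Finset.sum_congr rfl fun a ha => ?_
        rw [Finset.sum_comm]
        exact Finset.sum_congr rfl fun b hb => h a ha b hb
    _ = _ := by
        rw [Finset.mul_sum]
        refine Finset.sum_congr rfl fun a ha => ?_
        rw [Finset.sum_ite_eq, if_pos ha, sq]

/-- The fourth moment of a signed sum is at most three times the square of its second moment, as
only the terms that cancel in pairs contribute. -/
theorem sum_pow_four_signed_le {w : ℕ} {S : Finset ℕ} (hS : ∀ e ∈ S, e < 2 ^ w) (δ : ℕ → ℤ) :
    ∑ q : Fin (w * w) → Bool, (∑ e ∈ S, δ e * sign w q e) ^ 4 ≤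
    3 * 2 ^ (w * w) * (∑ e ∈ S, δ e ^ 2) ^ 2 := by
  have h : ∀ a ∈ S, ∀ b ∈ S, ∀ c ∈ S, ∀ d ∈ S, ∑ q : Fin (w * w) → Bool,
      δ a * sign w q a * (δ b * sign w q b) * (δ c * sign w q c * (δ d * sign w q d)) ≤
      2 ^ (w * w) * ((if a = b ∧ c = d then δ a ^ 2 * δ c ^ 2 else 0) +
        (if a = c ∧ b = d then δ a ^ 2 * δ b ^ 2 else 0) +
        (if a = d ∧ b = c then δ a ^ 2 * δ b ^ 2 else 0)) := by
    intro a ha b hb c hc d hd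
    have e1 : ∀ q : Fin (w * w) → Bool,
        δ a * sign w q a * (δ b * sign w q b) * (δ c * sign w q c * (δ d * sign w q d)) =
        δ a * δ b * δ c * δ d * (sign w q a * sign w q b * (sign w q c * sign w q d)) := by
      intro q
      ring
    simp only [e1, ← Finset.mul_sum]
    have hpos : ∀ (p : Prop) [Decidable p] (x y : ℤ), 0 ≤ if p then x ^ 2 * y ^ 2 else 0 := by
      intro p _ x y
      split_ifs <;> positivity
    by_cases hp : (a = b ∧ c = d) ∨ (a = c ∧ b = d) ∨ (a = d ∧ b = c)
    · have e2 : ∀ q : Fin (w * w) → Bool,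
          sign w q a * sign w q b * (sign w q c * sign w q d) = 1 := by
        intro q
        rcases hp with ⟨rfl, rfl⟩ | ⟨rfl, rfl⟩ | ⟨rfl, rfl⟩
        · simp [sign_mul_self]
        · rw [mul_mul_mul_comm, sign_mul_self, sign_mul_self, one_mul]
        · rw [mul_comm (sign w q b), mul_mul_mul_comm, sign_mul_self, sign_mul_self, one_mul]
      simp only [e2, Finset.sum_const, Finset.card_univ, Fintype.card_fun,
        Fintype.card_bool, Fintype.card_fin, nsmul_eq_mul, mul_one]
      push_cast
      rw [mul_comm]
      refine mul_le_mul_of_nonneg_left ?_ (by positivity)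
      have p1 := hpos (a = b ∧ c = d) (δ a) (δ c)
      have p2 := hpos (a = c ∧ b = d) (δ a) (δ b)
      have p3 := hpos (a = d ∧ b = c) (δ a) (δ b)
      rcases hp with hp | hp | hp
      · rw [if_pos hp]
        have : δ a * δ b * δ c * δ d = δ a ^ 2 * δ c ^ 2 := by rw [← hp.1, ← hp.2]; ring
        linarith
      · rw [if_pos hp]
        have : δ a * δ b * δ c * δ d = δ a ^ 2 * δ b ^ 2 := by rw [← hp.1, ← hp.2]; ring
        linarith
      · rw [if_pos hp]
        have : δ a * δ b * δ c * δ d = δ a ^ 2 * δ b ^ 2 := by rw [← hp.1, ← hp.2]; ring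
        linarith
    · rw [sum_sign_eq_zero (hS a ha) (hS b hb) (hS c hc) (hS d hd) hp, mul_zero]
      have p1 := hpos (a = b ∧ c = d) (δ a) (δ c)
      have p2 := hpos (a = c ∧ b = d) (δ a) (δ b)
      have p3 := hpos (a = d ∧ b = c) (δ a) (δ b)
      positivity
  have hexp : ∀ q : Fin (w * w) → Bool, (∑ e ∈ S, δ e * sign w q e) ^ 4 =
      ∑ a ∈ S, ∑ b ∈ S, ∑ c ∈ S, ∑ d ∈ S,
        δ a * sign w q a * (δ b * sign w q b) * (δ c * sign w q c * (δ d * sign w q d)) := by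
    intro q
    rw [show (4 : ℕ) = 2 + 2 from rfl, pow_add, sq, Finset.sum_mul_sum]
    simp_rw [Finset.sum_mul, Finset.mul_sum]
  simp only [hexp]
  calc _ = ∑ a ∈ S, ∑ b ∈ S, ∑ c ∈ S, ∑ d ∈ S, ∑ q : Fin (w * w) → Bool,
        δ a * sign w q a * (δ b * sign w q b) * (δ c * sign w q c * (δ d * sign w q d)) := by
        rw [Finset.sum_comm]
        refine Finset.sum_congr rfl fun a _ => ?_
        rw [Finset.sum_comm]
        refine Finset.sum_congr rfl fun b _ => ?_
        rw [Finset.sum_comm]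
        refine Finset.sum_congr rfl fun c _ => ?_
        rw [Finset.sum_comm]
    _ ≤ ∑ a ∈ S, ∑ b ∈ S, ∑ c ∈ S, ∑ d ∈ S, 2 ^ (w * w) *
        ((if a = b ∧ c = d then δ a ^ 2 * δ c ^ 2 else 0) +
        (if a = c ∧ b = d then δ a ^ 2 * δ b ^ 2 else 0) +
        (if a = d ∧ b = c then δ a ^ 2 * δ b ^ 2 else 0)) :=
        Finset.sum_le_sum fun a ha => Finset.sum_le_sum fun b hb => Finset.sum_le_sum fun c hc =>
          Finset.sum_le_sum fun d hd => h a ha b hb c hc d hd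
    _ = ∑ a ∈ S, ∑ b ∈ S, 2 ^ (w * w) * (3 * (δ a ^ 2 * δ b ^ 2)) := by
        have hd : ∀ (p : Prop) [Decidable p] (x : ℤ), ∀ c ∈ S,
            (∑ d ∈ S, if p ∧ c = d then x else 0) = if p then x else 0 := by
          intro p _ x c hc
          split_ifs with hp <;> simp [hp, hc]
        have hd' : ∀ (p : Prop) [Decidable p] (x : ℤ), ∀ c ∈ S,
            (∑ d ∈ S, if c = d ∧ p then x else 0) = if p then x else 0 := by
          intro p _ x c hc
          split_ifs with hp <;> simp [hp, hc]
        simp only [← Finset.mul_sum, Finset.sum_add_distrib]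
        congr 1
        have t1 : ∑ a ∈ S, ∑ b ∈ S, ∑ c ∈ S, ∑ d ∈ S,
            (if a = b ∧ c = d then δ a ^ 2 * δ c ^ 2 else 0) =
            ∑ a ∈ S, ∑ b ∈ S, δ a ^ 2 * δ b ^ 2 := by
          refine Finset.sum_congr rfl fun a ha => ?_
          rw [Finset.sum_comm]
          refine Finset.sum_congr rfl fun c hc => ?_
          rw [Finset.sum_congr rfl fun b _ => hd (a = b) _ c hc, Finset.sum_ite_eq, if_pos ha]
        have t2 : ∑ a ∈ S, ∑ b ∈ S, ∑ c ∈ S, ∑ d ∈ S,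
            (if a = c ∧ b = d then δ a ^ 2 * δ b ^ 2 else 0) =
            ∑ a ∈ S, ∑ b ∈ S, δ a ^ 2 * δ b ^ 2 := by
          refine Finset.sum_congr rfl fun a ha => Finset.sum_congr rfl fun b hb => ?_
          rw [Finset.sum_congr rfl fun c _ => hd (a = c) _ b hb, Finset.sum_ite_eq, if_pos ha]
        have t3 : ∑ a ∈ S, ∑ b ∈ S, ∑ c ∈ S, ∑ d ∈ S,
            (if a = d ∧ b = c then δ a ^ 2 * δ b ^ 2 else 0) =
            ∑ a ∈ S, ∑ b ∈ S, δ a ^ 2 * δ b ^ 2 := by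
          refine Finset.sum_congr rfl fun a ha => Finset.sum_congr rfl fun b hb => ?_
          rw [Finset.sum_congr rfl fun c _ => hd' (b = c) _ a ha, Finset.sum_ite_eq, if_pos hb]
        rw [t1, t2, t3]
        simp only [← Finset.mul_sum]
        ring
    _ = _ := by
        rw [sq (∑ e ∈ S, δ e ^ 2), Finset.sum_mul_sum]
        simp only [Finset.mul_sum]
        refine Finset.sum_congr rfl fun a _ => Finset.sum_congr rfl fun b _ => ?_
        ring

/-! ### Averages of independent estimators, and majorities of groups -/

/-- Sums of independent copies of a centred variable: first and second moments. -/
theorem sum_sq_sum_of_centred {Q : Type*} [Fintype Q] (f : Q → ℤ) (hf : ∑ q, f q = 0) (g : ℕ) :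
    ∑ y : Fin g → Q, ∑ j, f (y j) = 0 ∧
      (Fintype.card Q : ℤ) * ∑ y : Fin g → Q, (∑ j, f (y j)) ^ 2 =
        g * (Fintype.card Q : ℤ) ^ g * ∑ q, f q ^ 2 := by
  induction g with
  | zero => simp
  | succ g ih =>
    have hsplit : ∀ F : (Fin (g + 1) → Q) → ℤ, ∑ y, F y = ∑ q, ∑ y, F (Fin.cons q y) := by
      intro F
      rw [← (Fin.consEquiv fun _ => Q).sum_comp, Fintype.sum_prod_type]
      rfl
    constructor
    · rw [hsplit]
      simp only [Fin.sum_univ_succ, Fin.cons_zero, Fin.cons_succ, Finset.sum_add_distrib,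
        Finset.sum_const, ih.1, smul_zero, add_zero, ← Finset.smul_sum, hf]
    · rw [hsplit]
      have hsq : ∀ (q : Q) (y : Fin g → Q), (∑ j, f ((Fin.cons q y : Fin (g + 1) → Q) j)) ^ 2 =
          f q ^ 2 + 2 * (f q * ∑ j, f (y j)) + (∑ j, f (y j)) ^ 2 := by
        intro q y
        simp only [Fin.sum_univ_succ, Fin.cons_zero, Fin.cons_succ]
        ring
      simp only [hsq, Finset.sum_add_distrib, ← Finset.mul_sum, ih.1, mul_zero, add_zero,
        Finset.sum_const, Finset.card_univ, nsmul_eq_mul, Fintype.card_fun, Fintype.card_fin]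
      rw [mul_add, ih.2]
      push_cast
      ring

/-- The sum `Z` of `g` estimates of `D` is good if its relative error is at most `1 / (3 * E)`. -/
def GoodSum (E g D Z : ℤ) : Prop :=
  (3 * E - 1) * (g * D) ≤ 3 * E * Z ∧ 3 * E * Z ≤ (3 * E + 1) * (g * D)

instance (E g D Z : ℤ) : Decidable (GoodSum E g D Z) := inferInstanceAs (Decidable (_ ∧ _))

/-- Chebyshev's inequality for a group of estimators. -/
theorem card_bad_group_le {w : ℕ} {S : Finset ℕ} (hS : ∀ e ∈ S, e < 2 ^ w) (δ : ℕ → ℤ) {E g : ℕ}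
    (hE : 1 ≤ E) (hg : g = 288 * (E * E)) :
    16 * (Finset.univ.filter fun y : Fin g → Fin (w * w) → Bool =>
      ¬ GoodSum E g (∑ e ∈ S, δ e ^ 2) (∑ j, (∑ e ∈ S, δ e * sign w (y j) e) ^ 2)).card ≤
      Fintype.card (Fin g → Fin (w * w) → Bool) := by
  set D := ∑ e ∈ S, δ e ^ 2 with hD
  have hD0 : 0 ≤ D := Finset.sum_nonneg fun e _ => sq_nonneg _
  set N : ℤ := 2 ^ (w * w) with hN
  have hNpos : 0 < N := by positivity
  have hcard : (Fintype.card (Fin (w * w) → Bool) : ℤ) = N := by simp [hN]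
  set f : (Fin (w * w) → Bool) → ℤ := fun q => (∑ e ∈ S, δ e * sign w q e) ^ 2 - D with hf
  have h2 := sum_sq_signed hS δ
  have h4 := sum_pow_four_signed_le hS δ
  have hf0 : ∑ q, f q = 0 := by
    simp only [hf, Finset.sum_sub_distrib, h2, Finset.sum_const, Finset.card_univ, nsmul_eq_mul,
      hcard]
    ring
  have hf2 : ∑ q, f q ^ 2 ≤ 2 * N * D ^ 2 := by
    have : ∀ q, f q ^ 2 = (∑ e ∈ S, δ e * sign w q e) ^ 4 -
        2 * D * (∑ e ∈ S, δ e * sign w q e) ^ 2 + D ^ 2 := by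
      intro q
      simp only [hf]
      ring
    simp only [this, Finset.sum_add_distrib, Finset.sum_sub_distrib, ← Finset.mul_sum, h2,
      Finset.sum_const, Finset.card_univ, nsmul_eq_mul, hcard]
    rw [← hN, ← hD] at *
    linarith
  set B := Finset.univ.filter fun y : Fin g → Fin (w * w) → Bool =>
      ¬ GoodSum E g D (∑ j, (∑ e ∈ S, δ e * sign w (y j) e) ^ 2) with hB
  have hV := (sum_sq_sum_of_centred f hf0 g).2
  rw [hcard] at hV
  set V := ∑ y : Fin g → Fin (w * w) → Bool, (∑ j, f (y j)) ^ 2 with hVdef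
  have hV2 : V ≤ 2 * g * N ^ g * D ^ 2 := by
    have : N * V ≤ N * (2 * g * N ^ g * D ^ 2) := by
      rw [hV]
      calc (g : ℤ) * N ^ g * ∑ q, f q ^ 2 ≤ g * N ^ g * (2 * N * D ^ 2) :=
            mul_le_mul_of_nonneg_left hf2 (by positivity)
        _ = _ := by ring
    exact le_of_mul_le_mul_left this hNpos
  have hbad : ∀ y ∈ B, (g * D : ℤ) ^ 2 + 1 ≤ (3 * E) ^ 2 * (∑ j, f (y j)) ^ 2 := by
    intro y hy
    have hy' := (Finset.mem_filter.1 hy).2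
    have hsum : ∑ j, f (y j) = ∑ j, (∑ e ∈ S, δ e * sign w (y j) e) ^ 2 - g * D := by
      simp [hf, Finset.sum_sub_distrib]
    set Z := ∑ j, (∑ e ∈ S, δ e * sign w (y j) e) ^ 2 with hZ
    rw [hsum, ← mul_pow]
    have hgD : (0 : ℤ) ≤ g * D := by positivity
    unfold GoodSum at hy'
    rw [not_and_or, not_le, not_le] at hy'
    rcases hy' with h | h
    · have : (g * D : ℤ) + 1 ≤ -(3 * E * (Z - g * D)) := by linarith
      nlinarith
    · have : (g * D : ℤ) + 1 ≤ 3 * E * (Z - g * D) := by linarith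
      nlinarith
  have hmarkov : (B.card : ℤ) * ((g * D : ℤ) ^ 2 + 1) ≤ (3 * E) ^ 2 * V := by
    calc (B.card : ℤ) * ((g * D : ℤ) ^ 2 + 1) = ∑ _y ∈ B, ((g * D : ℤ) ^ 2 + 1) := by simp
      _ ≤ ∑ y ∈ B, (3 * E) ^ 2 * (∑ j, f (y j)) ^ 2 := Finset.sum_le_sum hbad
      _ ≤ ∑ y : Fin g → Fin (w * w) → Bool, (3 * E : ℤ) ^ 2 * (∑ j, f (y j)) ^ 2 :=
          Finset.sum_le_sum_of_subset_of_nonneg (Finset.subset_univ _) fun _ _ _ =>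
            mul_nonneg (sq_nonneg _) (sq_nonneg _)
      _ = _ := by rw [← Finset.mul_sum]
  have htot : (Fintype.card (Fin g → Fin (w * w) → Bool) : ℤ) = N ^ g := by
    simp [hN]
  zify
  rw [htot]
  have hg' : (g : ℤ) = 288 * (E * E) := by exact_mod_cast hg
  have hB0 : (0 : ℤ) ≤ B.card := by positivity
  rcases hD0.eq_or_lt with h0 | hpos
  · rw [← h0] at hmarkov hV2
    have : (B.card : ℤ) ≤ 0 := by nlinarith
    have : (0 : ℤ) ≤ N ^ g := by positivity
    linarith
  · have h1 : (B.card : ℤ) * (g * D) ^ 2 ≤ (3 * E) ^ 2 * (2 * g * N ^ g * D ^ 2) := by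
      have := mul_le_mul_of_nonneg_left hV2 (show (0 : ℤ) ≤ (3 * E) ^ 2 by positivity)
      nlinarith
    have hgpos : (0 : ℤ) < g := by rw [hg']; positivity
    have h3 : (g * D ^ 2 * (18 * (E * E)) : ℤ) * (16 * B.card) ≤
        (g * D ^ 2 * (18 * (E * E))) * N ^ g := by
      calc (g * D ^ 2 * (18 * (E * E)) : ℤ) * (16 * B.card) =
          B.card * (D ^ 2 * g * (288 * (E * E))) := by ring
        _ = B.card * (g * D) ^ 2 := by rw [← hg']; ring
        _ ≤ _ := h1
        _ = _ := by ring
    exact le_of_mul_le_mul_left h3 (by positivity)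

/-- If a bad event has probability at most `1/16`, then among `m` independent trials at least half
of them are bad with probability at most `2 ^ (-m)`. The proof bounds the expectation of `16` to
the number of bad trials. -/
theorem card_majority_bad_le {Y : Type*} [Fintype Y] [DecidableEq Y] (B : Finset Y)
    (hB : 16 * B.card ≤ Fintype.card Y) (m : ℕ) :
    (Finset.univ.filter fun ω : Fin m → Y =>
      m ≤ 2 * (Finset.univ.filter fun i => ω i ∈ B).card).card * 2 ^ m ≤
      Fintype.card Y ^ m := by
  set A := Finset.univ.filter fun ω : Fin m → Y =>
      m ≤ 2 * (Finset.univ.filter fun i => ω i ∈ B).card with hA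
  have h1 : ∑ ω : Fin m → Y, ∏ i, (if ω i ∈ B then 16 else 1) =
      (∑ y : Y, if y ∈ B then 16 else 1) ^ m :=
    (Fintype.sum_pow (fun y => if y ∈ B then 16 else 1) m).symm
  have h2 : (∑ y : Y, if y ∈ B then 16 else 1) ≤ 2 * Fintype.card Y := by
    have : (∑ y : Y, if y ∈ B then 16 else 1) = ∑ y : Y, (1 + if y ∈ B then 15 else 0) :=
      Finset.sum_congr rfl fun y _ => by split_ifs <;> rfl
    rw [this, Finset.sum_add_distrib]
    simp
    omega
  have h3 : ∀ ω ∈ A, 4 ^ m ≤ ∏ i, (if ω i ∈ B then 16 else 1) := by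
    intro ω hω
    have hω' := (Finset.mem_filter.1 hω).2
    rw [Finset.prod_ite, Finset.prod_const, Finset.prod_const_one, mul_one,
      show 16 = 4 ^ 2 from rfl, ← pow_mul]
    exact Nat.pow_le_pow_right (by norm_num) hω'
  have h4 : A.card * 4 ^ m ≤ 2 ^ m * Fintype.card Y ^ m := by
    calc A.card * 4 ^ m = ∑ _ω ∈ A, 4 ^ m := by simp
      _ ≤ ∑ ω ∈ A, ∏ i, (if ω i ∈ B then 16 else 1) := Finset.sum_le_sum h3
      _ ≤ ∑ ω : Fin m → Y, ∏ i, (if ω i ∈ B then 16 else 1) :=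
          Finset.sum_le_sum_of_subset (Finset.subset_univ _)
      _ ≤ _ := by rw [h1, ← mul_pow]; exact Nat.pow_le_pow_left h2 m
  rw [show 4 = 2 * 2 from rfl, mul_pow, ← mul_assoc, mul_comm] at h4
  exact le_of_mul_le_mul_left h4 (by positivity)


/-! ### Events that depend on finitely many random bits -/

theorem coinMeasure_cylinder {ι : Type*} [Fintype ι] (φ : ι → ℕ) (hφ : Function.Injective φ)
    (x : ι → Bool) : coinMeasure {coin | ∀ i, coin (φ i) = x i} =
      (2 : ENNReal)⁻¹ ^ Fintype.card ι := by
  classical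
  have hset : {coin : ℕ → Bool | ∀ i, coin (φ i) = x i} =
      Set.pi (Finset.univ.image φ : Finset ℕ) fun k => {b | ∀ i, φ i = k → b = x i} := by
    ext coin
    simp only [Set.mem_pi, Set.mem_ofPred_eq, Finset.coe_image, Finset.coe_univ, Set.image_univ,
      Set.mem_range, forall_exists_index, forall_apply_eq_imp_iff]
    exact ⟨fun h a i hi => by rw [← hi, h], fun h i => h i i rfl⟩
  rw [hset, coinMeasure, MeasureTheory.Measure.infinitePi_pi _ fun _ _ => MeasurableSet.of_discrete,
    Finset.prod_image hφ.injOn]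
  have h1 : ∀ i, {b | ∀ i', φ i' = φ i → b = x i'} = {x i} := by
    intro i
    ext b
    simp only [Set.mem_ofPred_eq, Set.mem_singleton_iff]
    exact ⟨fun h => h i rfl, fun h i' hi => by rw [hφ hi, h]⟩
  simp only [h1]
  have h2 : ∀ b : Bool, (PMF.uniformOfFintype Bool).toMeasure {b} = 2⁻¹ := by
    intro b
    rw [PMF.toMeasure_apply_singleton _ _ (MeasurableSet.singleton b)]
    simp
  simp [h2]

/-- The probability of an event that depends on finitely many random bits, by counting. The
outcomes `ω : Ω` stand for the values of the bits with the positions `φ i`. -/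
theorem coinMeasure_le_of_card {ι Ω : Type*} [Fintype ι] [Fintype Ω] (φ : ι → ℕ)
    (hφ : Function.Injective φ) (F : (ℕ → Bool) → Ω) (x : Ω → ι → Bool)
    (hF : ∀ coin i, x (F coin) i = coin (φ i)) (hΩ : Fintype.card Ω = 2 ^ Fintype.card ι)
    (A : Finset Ω) {k : ℕ} (hA : A.card * 2 ^ k ≤ Fintype.card Ω) :
    coinMeasure {coin | F coin ∈ A} ≤ (2 : ENNReal)⁻¹ ^ k := by
  have hsub : {coin | F coin ∈ A} ⊆ ⋃ ω ∈ A, {coin | ∀ i, coin (φ i) = x ω i} := by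
    intro coin hc
    simp only [Set.mem_iUnion]
    exact ⟨F coin, hc, fun i => (hF coin i).symm⟩
  calc coinMeasure {coin | F coin ∈ A}
      ≤ coinMeasure (⋃ ω ∈ A, {coin | ∀ i, coin (φ i) = x ω i}) := MeasureTheory.measure_mono hsub
    _ ≤ ∑ ω ∈ A, coinMeasure {coin | ∀ i, coin (φ i) = x ω i} :=
        MeasureTheory.measure_biUnion_finset_le _ _
    _ = A.card * (2 : ENNReal)⁻¹ ^ Fintype.card ι := by
        simp [coinMeasure_cylinder φ hφ]
    _ ≤ (2 : ENNReal)⁻¹ ^ k := by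
        rw [hΩ] at hA
        have h2 : (A.card : ENNReal) * 2 ^ k ≤ 2 ^ Fintype.card ι := by exact_mod_cast hA
        rw [← ENNReal.inv_pow, ← ENNReal.inv_pow, ← div_eq_mul_inv]
        refine ENNReal.div_le_of_le_mul ?_
        rw [mul_comm, ← div_eq_mul_inv]
        rw [ENNReal.le_div_iff_mul_le (.inl (by simp)) (.inl (by simp))]
        exact h2

/-- Two different sums of independent uniform variables are seldom equal: at an index that occurs
in one sum only, the other values leave just one possibility. -/
theorem card_sum_eq_le {V Q : Type*} [Fintype V] [DecidableEq V] [Fintype Q] [DecidableEq Q]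
    (val : Q → ℕ) (hval : Function.Injective val) {A B : Finset V} (hAB : A ≠ B) :
    (Finset.univ.filter fun ω : V → Q => ∑ v ∈ A, val (ω v) = ∑ v ∈ B, val (ω v)).card *
      Fintype.card Q ≤ Fintype.card (V → Q) := by
  obtain ⟨v, hv⟩ : ∃ v, ¬ (v ∈ A ↔ v ∈ B) := by
    by_contra! h
    exact hAB (Finset.ext h)
  rw [← Finset.card_univ (α := Q), ← Finset.card_product, ← Finset.card_univ]
  refine Finset.card_le_card_of_injOn (fun p => Function.update p.1 v p.2) (fun _ _ =>
    Finset.mem_coe.2 (Finset.mem_univ _)) ?_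
  rintro ⟨ω, x⟩ hω ⟨ω', x'⟩ hω' h
  have h1 : ∑ v ∈ A, val (ω v) = ∑ v ∈ B, val (ω v) := by simpa using hω
  have h2 : ∑ v ∈ A, val (ω' v) = ∑ v ∈ B, val (ω' v) := by simpa using hω'
  simp only at h
  have hx : x = x' := by simpa using congrFun h v
  have hne : ∀ u ≠ v, ω u = ω' u := fun u hu => by simpa [hu] using congrFun h u
  -- the value at `v` is determined by the other ones
  have hC : ∀ C : Finset V, v ∉ C → ∑ u ∈ C, val (ω u) = ∑ u ∈ C, val (ω' u) := fun C hC =>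
    Finset.sum_congr rfl fun u hu => by rw [hne u (by rintro rfl; exact hC hu)]
  have hD : ∀ C : Finset V, v ∈ C → ∑ u ∈ C, val (ω u) + val (ω' v) =
      ∑ u ∈ C, val (ω' u) + val (ω v) := fun C hC' => by
    have := hC (C.erase v) (Finset.notMem_erase v C)
    rw [← Finset.sum_erase_add C _ hC', ← Finset.sum_erase_add C (fun u => val (ω' u)) hC']
    omega
  have hv' : ω v = ω' v := by
    apply hval
    by_cases hvA : v ∈ A
    · have hvB : v ∉ B := fun h => hv ⟨fun _ => h, fun _ => hvA⟩
      have := hD A hvA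
      have := hC B hvB
      omega
    · have hvB : v ∈ B := by_contra fun h => hv ⟨fun h' => absurd h' hvA, fun h' => absurd h' h⟩
      have := hD B hvB
      have := hC A hvA
      omega
  refine Prod.ext (funext fun u => ?_) hx
  by_cases hu : u = v
  · rw [hu]; exact hv'
  · exact hne u hu

theorem bitsVal_inj {f g : ℕ → Bool} {k : ℕ} (h : bitsVal f k = bitsVal g k) :
    ∀ i < k, f i = g i := by
  induction k with
  | zero => simp
  | succ k ih =>
    rw [bitsVal, bitsVal] at h
    have h1 := Bool.toNat_le (f k)
    have h2 := Bool.toNat_le (g k)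
    intro i hi
    rcases (Nat.lt_succ_iff.1 hi).lt_or_eq with hi | rfl
    · exact ih (by omega) i hi
    · have h3 : (f i).toNat = (g i).toNat := by omega
      revert h3
      cases f i <;> cases g i <;> simp

theorem bitsVal_congr {f g : ℕ → Bool} {k : ℕ} (h : ∀ i < k, f i = g i) :
    bitsVal f k = bitsVal g k := by
  induction k with
  | zero => rfl
  | succ k ih => rw [bitsVal, bitsVal, ih fun i hi => h i (by omega), h k (by omega)]

namespace Params

variable (P : Params)

/-- Different sets of nodes have equal key sums with small probability. -/
theorem measure_key_collision_le {A B : Finset (Fin P.n)} (hAB : A ≠ B) :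
    coinMeasure {coin | ∑ v ∈ A, P.key coin v = ∑ v ∈ B, P.key coin v} ≤
      (2 : ENNReal)⁻¹ ^ P.keyBits := by
  classical
  set val : (Fin P.keyBits → Bool) → ℕ := fun x =>
    bitsVal (fun i => if h : i < P.keyBits then x ⟨i, h⟩ else false) P.keyBits with hval
  have hinj : Function.Injective val := by
    intro x y hxy
    funext i
    have := bitsVal_inj hxy i i.2
    simpa using this
  set F : (ℕ → Bool) → Fin P.n → Fin P.keyBits → Bool := fun coin v i =>
    coin (v * P.keyBits + i) with hF
  have hkey : ∀ coin (v : Fin P.n), P.key coin v = val (F coin v) := by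
    intro coin v
    refine bitsVal_congr fun i hi => ?_
    simp [hi, hF]
  have := coinMeasure_le_of_card (ι := Fin P.n × Fin P.keyBits)
    (fun p => p.1 * P.keyBits + p.2) (fun p q h => by
      obtain ⟨h1, h2⟩ := mul_add_inj p.2.2 q.2.2 h
      exact Prod.ext (Fin.ext h1) (Fin.ext h2)) F (fun ω p => ω p.1 p.2) (fun _ _ => rfl)
    (by simp [← pow_mul, mul_comm]) _ (k := P.keyBits)
    (by simpa using card_sum_eq_le (V := Fin P.n) val hinj hAB)
  simpa [hkey] using this

variable (coin : ℕ → Bool)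

/-- The coefficients of the quadratic form of an estimator. -/
def coeffs (i : Fin P.groups) (j : Fin P.size) (k : Fin (P.width * P.width)) : Bool :=
  coin (P.n * P.keyBits + ((i * P.size + j) * (P.width * P.width) + k))

/-- The difference of the indicators of a set of pairs and of a partition. -/
def diff (X : Finset ℕ) (ℓ : ℕ → ℕ) (e : ℕ) : ℤ := (if e ∈ X then 1 else 0) - P.same ℓ e

/-- The number of pairs on which a set of pairs and a partition differ. -/
def dist (X : Finset ℕ) (ℓ : ℕ → ℕ) : ℤ := ∑ e ∈ Finset.range (P.n * P.n), P.diff X ℓ e ^ 2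

variable {P}

theorem cast_sqDiff (a b : ℕ) : (sqDiff a b : ℤ) = ((a : ℤ) - b) ^ 2 := by
  unfold sqDiff
  rcases le_total a b with h | h
  · rw [Nat.sub_eq_zero_of_le h]
    push_cast [Nat.cast_sub h]
    ring
  · rw [Nat.sub_eq_zero_of_le h]
    push_cast [Nat.cast_sub h]
    ring

theorem sign_eq_hash (i : Fin P.groups) (j : Fin P.size) (e : ℕ) :
    sign P.width (P.coeffs coin i j) e = 1 - 2 * P.hash coin (i * P.size + j) e := by
  have h : P.hash coin (i * P.size + j) e =
      (∑ k, (P.coeffs coin i j k).toNat * digitProd P.width k e) % 2 := by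
    rw [hash, Finset.sum_range]
    rfl
  rw [h, sign]
  rcases Nat.mod_two_eq_zero_or_one (∑ k, (P.coeffs coin i j k).toNat * digitProd P.width k e)
    with h | h
  · rw [h, (Nat.even_iff.2 h).neg_one_pow]; rfl
  · rw [h, (Nat.odd_iff.2 h).neg_one_pow]; rfl

theorem cast_groupSum {X : Finset ℕ} (hX : X ⊆ Finset.range (P.n * P.n)) (ℓ : ℕ → ℕ)
    (i : Fin P.groups) : (P.groupSum coin X ℓ i : ℤ) = ∑ j,
      (∑ e ∈ Finset.range (P.n * P.n), P.diff X ℓ e * sign P.width (P.coeffs coin i j) e) ^ 2 := by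
  rw [groupSum, Finset.sum_range]
  push_cast
  refine Finset.sum_congr rfl fun j _ => ?_
  rw [cast_sqDiff]
  congr 1
  simp only [sign_eq_hash, diff, sub_mul, ite_mul, one_mul, zero_mul, Finset.sum_sub_distrib]
  rw [← Finset.sum_filter, Finset.filter_mem_eq_inter, Finset.inter_eq_right.2 hX]
  push_cast
  simp only [mul_sub, Finset.sum_sub_distrib, mul_one, Finset.mul_sum]
  simp only [mul_left_comm]
  ring

theorem one_le_prec : 1 ≤ P.prec := le_min P.one_le_E (Nat.le_add_left _ _)

/-- With high probability, most groups of estimators are good for a fixed partition. -/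
theorem measure_bad_le {X : Finset ℕ} (hX : X ⊆ Finset.range (P.n * P.n)) (ℓ : ℕ → ℕ) :
    coinMeasure {coin | P.groups ≤ 2 * ((Finset.range P.groups).filter fun i =>
      ¬ GoodSum P.prec P.size (P.dist X ℓ) (P.groupSum coin X ℓ i)).card} ≤
      (2 : ENNReal)⁻¹ ^ P.groups := by
  classical
  set B := Finset.univ.filter fun y : Fin P.size → Fin (P.width * P.width) → Bool =>
      ¬ GoodSum P.prec P.size (P.dist X ℓ) (∑ j, (∑ e ∈ Finset.range (P.n * P.n),
        P.diff X ℓ e * sign P.width (y j) e) ^ 2) with hB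
  have hB16 : 16 * B.card ≤ Fintype.card (Fin P.size → Fin (P.width * P.width) → Bool) :=
    card_bad_group_le (S := Finset.range (P.n * P.n))
      (fun e he => (Finset.mem_range.1 he).trans sq_lt_two_pow_width)
      (P.diff X ℓ) one_le_prec rfl
  have h := card_majority_bad_le B hB16 P.groups
  have hcard : ∀ coin, ((Finset.range P.groups).filter fun i =>
      ¬ GoodSum P.prec P.size (P.dist X ℓ) (P.groupSum coin X ℓ i)).card =
      (Finset.univ.filter fun i => P.coeffs coin i ∈ B).card := by
    intro coin
    rw [Finset.card_filter, Finset.card_filter, Finset.sum_range]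
    refine Finset.sum_congr rfl fun i _ => ?_
    simp only [hB, Finset.mem_filter, Finset.mem_univ, true_and, cast_groupSum coin hX]
  have := coinMeasure_le_of_card (ι := Fin P.groups × Fin P.size × Fin (P.width * P.width))
    (fun p => P.n * P.keyBits + ((p.1 * P.size + p.2.1) * (P.width * P.width) + p.2.2))
    (fun p q h => by
      obtain ⟨h1, h2⟩ := mul_add_inj p.2.2.2 q.2.2.2 (Nat.add_left_cancel h)
      obtain ⟨h3, h4⟩ := mul_add_inj p.2.1.2 q.2.1.2 h1
      exact Prod.ext (Fin.ext h3) (Prod.ext (Fin.ext h4) (Fin.ext h2))) P.coeffs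
    (fun ω p => ω p.1 p.2.1 p.2.2) (fun _ _ => rfl)
    (by simp [← pow_mul, mul_comm]) _ (k := P.groups)
    (by simpa using h)
  simpa [hcard] using this

end Params


/-! ### Disagreements and clean nodes -/

theorem weight_eq_or {n : ℕ} (G : UnitGraph n) (p : Fin n × Fin n) :
    G.weight p = 1 ∨ G.weight p = -1 := by
  unfold UnitGraph.weight
  rcases Int.units_eq_one_or (G s(p.1, p.2)) with h | h <;> simp [h]

open Classical in
/-- The pairs that do not agree with a partition. -/
noncomputable def badPairs {n : ℕ} (G : UnitGraph n) (P : Setoid (Fin n)) :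
    Finset (Fin n × Fin n) := (pairs n).filter fun p => ¬ Agrees G P p

theorem disagree_eq_card {n : ℕ} (G : UnitGraph n) (P : Setoid (Fin n)) :
    disagree G P = (badPairs G P).card := by
  classical
  have h : ∀ p, |G.weight p| = 1 := fun p => by
    rcases weight_eq_or G p with h | h <;> simp [h]
  have := Finset.card_filter_add_card_filter_not (s := pairs n) (Agrees G P)
  unfold disagree agree badPairs
  simp only [h, Finset.sum_const, nsmul_eq_mul, mul_one]
  rw [← this]
  push_cast
  ring

theorem agrees_iff {n : ℕ} (G : UnitGraph n) (P : Setoid (Fin n)) (u v : Fin n) :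
    Agrees G P (u, v) ↔ (G s(u, v) = 1 ↔ P u v) := by
  unfold Agrees UnitGraph.weight
  rcases Int.units_eq_one_or (G s(u, v)) with h | h <;> simp [h]

theorem card_badPairs_le {n : ℕ} (G : UnitGraph n) (P : Setoid (Fin n)) :
    (badPairs G P).card ≤ n * n := by
  simpa using Finset.card_le_univ (badPairs G P)

/-- The edges that are present at the end of a stream that presents `G`. -/
structure Presents {n : ℕ} (E : Present n) (G : UnitGraph n) : Prop where
  diag : ∀ u, E s(u, u) = none
  edge : ∀ u v, u ≠ v → E s(u, v) = some (G s(u, v))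

theorem Leads.diag {n : ℕ} {E E' : Present n} {σ : List (Update n)} (h : Leads E σ E')
    (hd : ∀ u, E s(u, u) = none) : ∀ u, E' s(u, u) = none := by
  induction σ generalizing E with
  | nil => cases h; exact hd
  | cons a l ih =>
    obtain ⟨u, v, x, _, _, _, _, _, h1, h2, _⟩ := h.step hd
    exact ih h1 h2

/-- The closed positive neighbourhood of a node. -/
noncomputable def closedNbrs {n : ℕ} (E : Present n) (u : Fin n) : Finset (Fin n) :=
  insert u (nbrs E u)

/-- A node is clean for a partition if its closed positive neighbourhood is its cluster. -/
def Clean {n : ℕ} (E : Present n) (P : Setoid (Fin n)) (u : Fin n) : Prop :=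
  ∀ v, v ∈ closedNbrs E u ↔ P u v

section Clean

variable {n : ℕ} {E : Present n} {G : UnitGraph n} {P : Setoid (Fin n)}

theorem mem_closedNbrs (h : Presents E G) {u v : Fin n} :
    v ∈ closedNbrs E u ↔ v = u ∨ (u ≠ v ∧ G s(u, v) = 1) := by
  rw [closedNbrs, Finset.mem_insert, mem_nbrs]
  by_cases huv : u = v
  · simp [huv]
  · simp [huv, h.edge u v huv]

/-- Clean nodes are in the same cluster if and only if their neighbourhoods coincide. -/
theorem Clean.closedNbrs_eq_iff {u v : Fin n} (hu : Clean E P u) (hv : Clean E P v) :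
    closedNbrs E u = closedNbrs E v ↔ P u v := by
  constructor
  · intro h
    rw [← hu v, h]
    exact Finset.mem_insert_self _ _
  · intro h
    ext z
    rw [hu z, hv z]
    exact ⟨fun h' => P.trans (P.symm h) h', fun h' => P.trans h h'⟩

open Classical in
/-- A partition with few disagreements has few nodes that are not clean. -/
theorem card_not_clean_le (h : Presents E G) :
    (Finset.univ.filter fun u => ¬ Clean E P u).card ≤ 2 * (badPairs G P).card := by
  have hsub : (Finset.univ.filter fun u => ¬ Clean E P u) ⊆
      (badPairs G P).image Prod.fst ∪ (badPairs G P).image Prod.snd := by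
    intro u hu
    have hu' := (Finset.mem_filter.1 hu).2
    unfold Clean at hu'
    push Not at hu'
    obtain ⟨v, hv⟩ := hu'
    have huv : u ≠ v := by
      rintro rfl
      rcases hv with ⟨_, hv⟩ | ⟨hv, _⟩
      · exact hv (P.refl _)
      · exact hv (Finset.mem_insert_self _ _)
    have hv' : ¬ (G s(u, v) = 1 ↔ P u v) := by
      rw [mem_closedNbrs h] at hv
      have := huv.symm
      tauto
    rw [Finset.mem_union]
    rcases lt_or_gt_of_ne huv with hlt | hlt
    · left
      refine Finset.mem_image.2 ⟨(u, v), Finset.mem_filter.2 ⟨by simp [pairs, hlt], ?_⟩, rfl⟩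
      rwa [agrees_iff]
    · right
      refine Finset.mem_image.2 ⟨(v, u), Finset.mem_filter.2 ⟨by simp [pairs, hlt], ?_⟩, rfl⟩
      rw [agrees_iff, Sym2.eq_swap]
      have : P v u ↔ P u v := ⟨P.symm, P.symm⟩
      rwa [this]
  calc _ ≤ _ := Finset.card_le_card hsub
    _ ≤ _ := Finset.card_union_le _ _
    _ ≤ (badPairs G P).card + (badPairs G P).card :=
        add_le_add Finset.card_image_le Finset.card_image_le
    _ = _ := by ring

end Clean

/-- Prescribing the digits of a number. -/
theorem exists_digits (b : ℕ) (hb : 0 < b) (s : ℕ) (f : ℕ → ℕ) (hf : ∀ i < s, f i < b) :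
    ∃ k < b ^ s, ∀ i < s, k / b ^ i % b = f i := by
  induction s generalizing f with
  | zero => exact ⟨0, by simp, by simp⟩
  | succ s ih =>
    obtain ⟨k, hk, h⟩ := ih (fun i => f (i + 1)) fun i hi => hf _ (by omega)
    have h0 := hf 0 (by omega)
    refine ⟨f 0 + b * k, ?_, ?_⟩
    · rw [pow_succ']
      nlinarith
    · intro i hi
      cases i with
      | zero => simp [Nat.mod_eq_of_lt h0]
      | succ i =>
        rw [pow_succ', ← Nat.div_div_eq_div_mul, Nat.add_mul_div_left _ _ hb,
          Nat.div_eq_of_lt h0, zero_add]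
        exact h i (by omega)

namespace Params

variable {P : Params} {coin : ℕ → Bool}

theorem mem_posCodes_iff {E : Present P.n} {G : UnitGraph P.n} (h : Presents E G)
    (u v : Fin P.n) : (u : ℕ) * P.n + v ∈ posCodes E ↔ u < v ∧ G s(u, v) = 1 := by
  by_cases huv : u < v
  · have : (u : ℕ) * P.n + v = pairCode P.n u v := (if_pos huv).symm
    rw [this, pairCode_mem huv.ne, h.edge _ _ huv.ne]
    simp [huv]
  · simp only [huv, false_and, iff_false]
    intro hm
    obtain ⟨u', v', h1, _, h3⟩ := mem_posCodes.1 hm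
    unfold pairCode at h3
    split_ifs at h3 with h4 <;>
      obtain ⟨h5, h6⟩ := mul_add_inj (Fin.is_lt _) (Fin.is_lt _) h3
    · exact huv (by rw [← Fin.ext h5, ← Fin.ext h6]; exact h4)
    · refine huv ?_
      rw [← Fin.ext h5, ← Fin.ext h6]
      exact lt_of_le_of_ne (not_lt.1 h4) h1.symm

theorem same_eq (ℓ : ℕ → ℕ) (u v : Fin P.n) :
    P.same ℓ (u * P.n + v) = if u < v ∧ ℓ u = ℓ v then 1 else 0 := by
  have h1 : ((u : ℕ) * P.n + v) / P.n = u := by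
    rw [mul_comm, Nat.mul_add_div u.pos, Nat.div_eq_of_lt v.2, add_zero]
  have h2 : ((u : ℕ) * P.n + v) % P.n = v := by
    rw [mul_comm, Nat.mul_add_mod, Nat.mod_eq_of_lt v.2]
  rw [same, h1, h2]
  by_cases h3 : u < v <;> by_cases h4 : ℓ u = ℓ v <;> simp [h3, h4]

/-- The distance between the positive edges and a partition is the number of disagreements. -/
theorem dist_eq_disagree {E : Present P.n} {G : UnitGraph P.n} (h : Presents E G) (ℓ : ℕ → ℕ) :
    P.dist (posCodes E) ℓ = disagree G (Setoid.ker fun v : Fin P.n => ℓ v) := by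
  classical
  rw [dist, Finset.sum_range, ← finProdFinEquiv.sum_comp, disagree_eq_card, badPairs, pairs,
    Finset.filter_filter, Finset.card_filter]
  push_cast
  refine Finset.sum_congr rfl fun p _ => ?_
  obtain ⟨u, v⟩ := p
  have he : ((finProdFinEquiv (u, v) : Fin (P.n * P.n)) : ℕ) = u * P.n + v := by
    simp only [finProdFinEquiv, Equiv.coe_fn_mk]
    ring
  rw [he, diff, same_eq, agrees_iff, Setoid.ker_def]
  simp only [mem_posCodes_iff h]
  by_cases h1 : u < v <;> by_cases h2 : G s(u, v) = 1 <;> by_cases h3 : ℓ u = ℓ v <;>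
    simp [h1, h2, h3]

/-- Two labellings define the same partition. -/
def SameKer (P : Params) (ℓ ℓ' : ℕ → ℕ) : Prop :=
  ∀ u < P.n, ∀ v < P.n, ℓ u = ℓ v ↔ ℓ' u = ℓ' v

theorem same_congr {ℓ ℓ' : ℕ → ℕ} (h : P.SameKer ℓ ℓ') {e : ℕ} (he : e < P.n * P.n) :
    P.same ℓ e = P.same ℓ' e := by
  have h1 : e / P.n < P.n := Nat.div_lt_of_lt_mul he
  have h2 : e % P.n < P.n := Nat.mod_lt _ P.one_le_n
  simp only [same, h _ h1 _ h2]

theorem groupSum_congr {ℓ ℓ' : ℕ → ℕ} (h : P.SameKer ℓ ℓ') (X : Finset ℕ) (i : ℕ) :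
    P.groupSum coin X ℓ i = P.groupSum coin X ℓ' i := by
  unfold groupSum
  refine Finset.sum_congr rfl fun j _ => ?_
  have h1 : ∑ e ∈ Finset.range (P.n * P.n), P.same ℓ e =
      ∑ e ∈ Finset.range (P.n * P.n), P.same ℓ' e :=
    Finset.sum_congr rfl fun e he => same_congr h (Finset.mem_range.1 he)
  have h2 : ∀ k, ∑ e ∈ Finset.range (P.n * P.n), P.same ℓ e * P.hash coin k e =
      ∑ e ∈ Finset.range (P.n * P.n), P.same ℓ' e * P.hash coin k e :=
    fun k => Finset.sum_congr rfl fun e he => by rw [same_congr h (Finset.mem_range.1 he)]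
  rw [h1, h2]

theorem dist_congr {ℓ ℓ' : ℕ → ℕ} (h : P.SameKer ℓ ℓ') (X : Finset ℕ) :
    P.dist X ℓ = P.dist X ℓ' := by
  unfold dist diff
  exact Finset.sum_congr rfl fun e he => by rw [same_congr h (Finset.mem_range.1 he)]

theorem code_lt (k i : ℕ) {u : ℕ} (hu : u < P.n) : P.code k i u < 2 * P.n := by
  induction i with
  | zero => rw [code]; omega
  | succ i ih =>
    rw [code]
    split_ifs
    · refine Nat.div_lt_of_lt_mul ((Nat.mod_lt _ base_pos).trans_eq ?_)
      unfold base
      ring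
    · exact ih

/-- A candidate partition depends on the base partition only, not on its labels. -/
theorem label_sameKer {ρ ρ' : ℕ → ℕ} (h : P.SameKer ρ ρ') (h1 : ∀ u < P.n, P.n ≤ ρ u)
    (h2 : ∀ u < P.n, P.n ≤ ρ' u) (k : ℕ) : P.SameKer (P.label ρ k) (P.label ρ' k) := by
  intro u hu v hv
  have hcu := code_lt (P := P) k P.moves hu
  have hcv := code_lt (P := P) k P.moves hv
  unfold label decode
  split_ifs with h3 h4 h4
  · rfl
  · have := h1 (P.code k P.moves v - P.n) (by omega)
    have := h2 (P.code k P.moves v - P.n) (by omega)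
    omega
  · have := h1 (P.code k P.moves u - P.n) (by omega)
    have := h2 (P.code k P.moves u - P.n) (by omega)
    omega
  · exact h _ (by omega) _ (by omega)

/-- A choice of labels for the base partition that does not depend on the random bits. -/
noncomputable def refLabel (E : Present P.n) (v : ℕ) : ℕ :=
  if h : v < P.n then P.n + Fintype.equivFin (Finset (Fin P.n)) (closedNbrs E ⟨v, h⟩) else 0

theorem le_refLabel (E : Present P.n) : ∀ u < P.n, P.n ≤ refLabel E u := by
  intro u hu
  rw [refLabel, dif_pos hu]
  omega

theorem refLabel_eq_iff (E : Present P.n) (u v : Fin P.n) :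
    refLabel E u = refLabel E v ↔ closedNbrs E u = closedNbrs E v := by
  rw [refLabel, refLabel, dif_pos u.2, dif_pos v.2, Nat.add_left_cancel_iff, Fin.val_inj,
    EmbeddingLike.apply_eq_iff_eq]

theorem baseLabel_eq {E : Present P.n} (hd : ∀ u, E s(u, u) = none) (u : Fin P.n) :
    P.baseLabel coin E u = P.n + ∑ z ∈ closedNbrs E u, P.key coin z := by
  rw [baseLabel, dif_pos u.2, closedNbrs, Finset.sum_insert, add_assoc, Nat.add_comm (P.key _ _)]
  rw [mem_nbrs, hd]
  simp

/-- No two different closed neighbourhoods have the same fingerprint. -/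
def NoCollision (P : Params) (coin : ℕ → Bool) (E : Present P.n) : Prop :=
  ∀ u v : Fin P.n, closedNbrs E u ≠ closedNbrs E v →
    ∑ z ∈ closedNbrs E u, P.key coin z ≠ ∑ z ∈ closedNbrs E v, P.key coin z

theorem baseLabel_sameKer {E : Present P.n} (hd : ∀ u, E s(u, u) = none)
    (hc : P.NoCollision coin E) : P.SameKer (P.baseLabel coin E) (refLabel E) := by
  intro u hu v hv
  rw [refLabel_eq_iff E ⟨u, hu⟩ ⟨v, hv⟩, baseLabel_eq hd ⟨u, hu⟩, baseLabel_eq hd ⟨v, hv⟩,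
    Nat.add_left_cancel_iff]
  exact ⟨fun h => by_contra fun h' => hc _ _ h' h, fun h => by rw [h]⟩

theorem code_of_moves {k s : ℕ} {p c : ℕ → ℕ}
    (h : ∀ i < s, k / P.base ^ i % P.base % P.n = p i ∧ k / P.base ^ i % P.base / P.n = c (p i))
    (u : ℕ) : P.code k s u = if ∃ i < s, p i = u then c u else P.n + u := by
  induction s with
  | zero => simp [code]
  | succ s ih =>
    rw [code, (h s (by omega)).1, (h s (by omega)).2, ih fun i hi => h i (by omega)]
    by_cases hu : u = p s
    · rw [if_pos hu, if_pos ⟨s, by omega, hu.symm⟩, hu]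
    · rw [if_neg hu]
      congr 1
      refine propext ⟨fun ⟨i, hi, hpi⟩ => ⟨i, by omega, hpi⟩, fun ⟨i, hi, hpi⟩ => ⟨i, ?_, hpi⟩⟩
      rcases (Nat.lt_succ_iff.1 hi).lt_or_eq with hi | hi
      · exact hi
      · exact absurd (hi ▸ hpi).symm hu

/-- Every partition with few unclean nodes is a candidate. Clean nodes keep their base labels. An
unclean node gets the base label of a clean node of its cluster if there is one, and otherwise a
representative of its cluster as a new label. -/
theorem exists_candidate {E : Present P.n} {Q : Setoid (Fin P.n)}
    (hq : ∃ U : Finset (Fin P.n), U.card ≤ P.moves ∧ ∀ u ∉ U, Clean E Q u) :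
    ∃ k < P.cands, ∀ u v : Fin P.n,
      P.label (refLabel E) k u = P.label (refLabel E) k v ↔ Q u v := by
  classical
  obtain ⟨U₀, hU₀, hclean₀⟩ := hq
  obtain ⟨U, hUU, hU⟩ := Finset.exists_superset_card_eq hU₀ (by simp [moves])
  have hclean : ∀ u ∉ U, Clean E Q u := fun u hu => hclean₀ u fun h => hu (hUU h)
  set rep : Fin P.n → Fin P.n := fun u => (Quotient.mk Q u).out with hrep
  have hrepQ : ∀ u, Q (rep u) u := fun u => Quotient.exact (Quotient.out_eq (Quotient.mk Q u))
  have hrep_iff : ∀ u v, rep u = rep v ↔ Q u v := by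
    intro u v
    constructor
    · intro h
      have h1 := hrepQ v
      rw [← h] at h1
      exact Q.trans (Q.symm (hrepQ u)) h1
    · intro h
      exact congrArg Quotient.out (Quotient.sound h)
  -- the code of the label of a node
  set cl : Fin P.n → ℕ := fun u => if h : ∃ v, Clean E Q v ∧ Q u v then P.n + (h.choose : ℕ)
    else rep u with hcl
  have hcl_lt : ∀ u, cl u < 2 * P.n := by
    intro u
    simp only [hcl]
    split_ifs with h
    · have := h.choose.2; omega
    · have := (rep u).2; omega
  set c : ℕ → ℕ := fun u => if h : u < P.n then cl ⟨u, h⟩ else 0 with hc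
  set en := U.equivFinOfCardEq hU with hen
  set p : ℕ → ℕ := fun i => if h : i < P.moves then ((en.symm ⟨i, h⟩ : U) : Fin P.n) else 0 with hp
  have hn := P.one_le_n
  have hpn : ∀ i, p i < P.n := by
    intro i
    simp only [hp]
    split_ifs
    · exact Fin.is_lt _
    · exact hn
  have hc_lt : ∀ u, c u < 2 * P.n := by
    intro u
    simp only [hc]
    split_ifs
    · exact hcl_lt _
    · omega
  obtain ⟨k, hk, hdig⟩ := exists_digits P.base base_pos P.moves (fun i => p i + P.n * c (p i)) (by
    intro i _
    have h1 := hpn i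
    have h2 := hc_lt (p i)
    unfold base
    nlinarith)
  refine ⟨k, hk, ?_⟩
  have hcode : ∀ u : Fin P.n, P.code k P.moves u = if u ∈ U then cl u else P.n + u := by
    intro u
    rw [code_of_moves (p := p) (c := c) fun i hi => by
      rw [hdig i hi]
      exact ⟨by rw [Nat.add_mul_mod_self_left, Nat.mod_eq_of_lt (hpn i)],
        by rw [Nat.add_mul_div_left _ _ hn, Nat.div_eq_of_lt (hpn i), zero_add]⟩]
    have : (∃ i < P.moves, p i = u) ↔ u ∈ U := by
      constructor
      · rintro ⟨i, hi, h⟩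
        simp only [hp, dif_pos hi] at h
        rw [← Fin.ext h]
        exact (en.symm ⟨i, hi⟩).2
      · intro hu
        refine ⟨en ⟨u, hu⟩, Fin.is_lt _, ?_⟩
        simp [hp]
    simp only [this, hc, u.2, dif_pos]
  -- every label is either the base label of a clean node of the cluster, or the representative
  -- of a cluster without clean nodes
  have hlab : ∀ u : Fin P.n, (∃ v, Clean E Q v ∧ Q u v ∧ P.label (refLabel E) k u = refLabel E v) ∨
      ((¬ ∃ v, Clean E Q v ∧ Q u v) ∧ P.label (refLabel E) k u = rep u) := by
    intro u
    unfold label decode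
    rw [hcode u]
    by_cases hu : u ∈ U
    · rw [if_pos hu]
      by_cases h : ∃ v, Clean E Q v ∧ Q u v
      · left
        refine ⟨h.choose, h.choose_spec.1, h.choose_spec.2, ?_⟩
        have : cl u = P.n + h.choose := by simp only [hcl]; rw [dif_pos h]
        rw [this, if_neg (by omega), Nat.add_sub_cancel_left]
      · right
        have : cl u = rep u := by simp only [hcl]; rw [dif_neg h]
        rw [this, if_pos (rep u).2]
        exact ⟨h, rfl⟩
    · left
      refine ⟨u, hclean u hu, Q.refl u, ?_⟩
      rw [if_neg hu, if_neg (by omega), Nat.add_sub_cancel_left]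
  intro u v
  rcases hlab u with ⟨u', hu1, hu2, hu3⟩ | ⟨hu1, hu2⟩ <;>
    rcases hlab v with ⟨v', hv1, hv2, hv3⟩ | ⟨hv1, hv2⟩
  · rw [hu3, hv3, refLabel_eq_iff, hu1.closedNbrs_eq_iff hv1]
    exact ⟨fun h => Q.trans (Q.trans hu2 h) (Q.symm hv2),
      fun h => Q.trans (Q.trans (Q.symm hu2) h) hv2⟩
  · have h1 := le_refLabel E u' u'.2
    have h2 := (rep v).2
    rw [hu3, hv2]
    constructor
    · intro h; omega
    · intro h; exact absurd ⟨u', hu1, Q.trans (Q.symm h) hu2⟩ hv1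
  · have h1 := le_refLabel E v' v'.2
    have h2 := (rep u).2
    rw [hv3, hu2]
    constructor
    · intro h; omega
    · intro h; exact absurd ⟨v', hv1, Q.trans h hv2⟩ hu1
  · rw [hu2, hv2, Fin.val_inj, hrep_iff]

end Params


/-! ### Correctness of the search -/

namespace Params

variable {P : Params} {coin : ℕ → Bool}

theorem votes_eq_card (X : Finset ℕ) (ℓ : ℕ → ℕ) (d : ℕ) :
    P.votes coin X ℓ d = ((Finset.range P.groups).filter fun i => P.Vote coin X ℓ d i).card := by
  rw [votes, Finset.card_filter]

theorem size_pos : 0 < P.size := by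
  have := P.one_le_prec
  unfold size
  positivity

theorem vote_of_goodSum {X : Finset ℕ} {ℓ : ℕ → ℕ} {d i : ℕ} (hd : P.dist X ℓ ≤ d)
    (h : GoodSum P.prec P.size (P.dist X ℓ) (P.groupSum coin X ℓ i)) : P.Vote coin X ℓ d i := by
  have h1 : (3 * P.prec * P.groupSum coin X ℓ i : ℤ) ≤ (3 * P.prec + 1) * (P.size * d) :=
    h.2.trans (by gcongr)
  unfold Vote
  exact Nat.lt_succ_of_le (by exact_mod_cast h1)

theorem dist_le_of_vote {X : Finset ℕ} {ℓ : ℕ → ℕ} {d i : ℕ} (hv : P.Vote coin X ℓ d i)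
    (h : GoodSum P.prec P.size (P.dist X ℓ) (P.groupSum coin X ℓ i)) :
    P.dist X ℓ ≤ (d + d / P.prec : ℕ) := by
  have hE : (1 : ℤ) ≤ P.prec := by exact_mod_cast P.one_le_prec
  have hg : (0 : ℤ) < P.size := by exact_mod_cast P.size_pos
  have hv' : (3 * P.prec * P.groupSum coin X ℓ i : ℤ) ≤ (3 * P.prec + 1) * (P.size * d) := by
    exact_mod_cast Nat.le_of_lt_succ hv
  obtain ⟨D, hD⟩ : ∃ D : ℕ, P.dist X ℓ = D :=
    Int.eq_ofNat_of_zero_le (Finset.sum_nonneg fun e _ => sq_nonneg _)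
  have h1 := h.1.trans hv'
  rw [hD] at h1 ⊢
  have h2 : (3 * P.prec - 1 : ℤ) * D ≤ (3 * P.prec + 1) * d := by
    refine le_of_mul_le_mul_left ?_ hg
    linarith
  have h3 : (P.prec : ℤ) * D ≤ (P.prec + 1) * d := by
    refine le_of_mul_le_mul_left (a := (3 * P.prec - 1 : ℤ)) ?_ (by linarith)
    have h4 : (P.prec * (3 * P.prec + 1) : ℤ) * d ≤ ((3 * P.prec - 1) * (P.prec + 1)) * d := by
      refine mul_le_mul_of_nonneg_right ?_ (Nat.cast_nonneg d)
      nlinarith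
    nlinarith
  have h5 : P.prec * D ≤ P.prec * d + d := by
    have : P.prec * D ≤ (P.prec + 1) * d := by exact_mod_cast h3
    linarith
  have h6 : D - d ≤ d / P.prec := by
    rw [Nat.le_div_iff_mul_le P.one_le_prec, Nat.sub_mul]
    rw [mul_comm D, mul_comm d]
    omega
  exact_mod_cast (by omega : D ≤ d + d / P.prec)

/-- The groups whose average is not a good approximation of the distance. -/
def badGroups (P : Params) (coin : ℕ → Bool) (X : Finset ℕ) (ℓ : ℕ → ℕ) : Finset ℕ :=
  (Finset.range P.groups).filter fun i =>
    ¬ GoodSum P.prec P.size (P.dist X ℓ) (P.groupSum coin X ℓ i)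

theorem badGroups_congr {ℓ ℓ' : ℕ → ℕ} (h : P.SameKer ℓ ℓ') (X : Finset ℕ) :
    P.badGroups coin X ℓ = P.badGroups coin X ℓ' := by
  unfold badGroups
  simp only [dist_congr h, groupSum_congr h]

theorem le_votes {X : Finset ℕ} {ℓ : ℕ → ℕ} {d : ℕ}
    (hb : 2 * (P.badGroups coin X ℓ).card < P.groups) (hd : P.dist X ℓ ≤ d) :
    P.groups ≤ 2 * P.votes coin X ℓ d := by
  have h1 := Finset.card_filter_add_card_filter_not (s := Finset.range P.groups)
    fun i => GoodSum P.prec P.size (P.dist X ℓ) (P.groupSum coin X ℓ i)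
  have h2 : ((Finset.range P.groups).filter fun i =>
      GoodSum P.prec P.size (P.dist X ℓ) (P.groupSum coin X ℓ i)).card ≤ P.votes coin X ℓ d := by
    rw [votes_eq_card]
    exact Finset.card_le_card fun i hi => Finset.mem_filter.2
      ⟨(Finset.mem_filter.1 hi).1, vote_of_goodSum hd (Finset.mem_filter.1 hi).2⟩
  rw [Finset.card_range] at h1
  unfold badGroups at hb
  omega

theorem dist_le_of_votes {X : Finset ℕ} {ℓ : ℕ → ℕ} {d : ℕ}
    (hb : 2 * (P.badGroups coin X ℓ).card < P.groups) (hv : P.groups ≤ 2 * P.votes coin X ℓ d) :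
    P.dist X ℓ ≤ (d + d / P.prec : ℕ) := by
  obtain ⟨i, hi, hib⟩ : ∃ i ∈ (Finset.range P.groups).filter fun i => P.Vote coin X ℓ d i,
      i ∉ P.badGroups coin X ℓ := by
    refine Finset.exists_mem_notMem_of_card_lt_card ?_
    rw [← votes_eq_card]
    omega
  obtain ⟨hi, hvi⟩ := Finset.mem_filter.1 hi
  refine dist_le_of_vote hvi ?_
  by_contra h
  exact hib (Finset.mem_filter.2 ⟨hi, h⟩)

/-- The random bits are good if fingerprints identify the closed neighbourhoods, and if for every
candidate partition most groups of estimators are good. -/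
structure GoodBits (P : Params) (coin : ℕ → Bool) (E : Present P.n) : Prop where
  noCollision : P.NoCollision coin E
  card_bad : ∀ k < P.cands,
    2 * (P.badGroups coin (posCodes E) (P.label (refLabel E) k)).card < P.groups

theorem GoodBits.sameKer {E : Present P.n} (h : P.GoodBits coin E)
    (hd : ∀ u, E s(u, u) = none) (k : ℕ) :
    P.SameKer (P.label (P.baseLabel coin E) k) (P.label (refLabel E) k) := by
  refine label_sameKer (baseLabel_sameKer hd h.noCollision) (fun u hu => ?_) (le_refLabel E) k
  rw [baseLabel_eq hd ⟨u, hu⟩]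
  exact Nat.le_add_right _ _

theorem div_prec_le {d : ℕ} {ε : ℝ} (hε : 0 < ε) (hE : P.E = ⌈1 / ε⌉₊)
    (hd : d ≤ P.moves * (P.n * P.n)) : ((d / P.prec : ℕ) : ℝ) ≤ ε * d := by
  rcases le_total P.E (P.moves * (P.n * P.n) + 1) with h | h
  · have h1 : P.prec = P.E := min_eq_left h
    have h2 : (0 : ℝ) < P.E := by exact_mod_cast P.one_le_E
    refine Nat.cast_div_le.trans ?_
    rw [h1, div_le_iff₀ h2]
    have h3 : 1 ≤ ε * P.E := by
      have := Nat.le_ceil (1 / ε)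
      rw [← hE, div_le_iff₀ hε] at this
      linarith
    nlinarith [(Nat.cast_nonneg d : (0 : ℝ) ≤ d)]
  · have h1 : P.prec = P.moves * (P.n * P.n) + 1 := min_eq_right h
    rw [Nat.div_eq_of_lt (by omega), Nat.cast_zero]
    positivity

/-- Whatever the search finds with good random bits is an approximate solution: some candidate is
optimal, so the search stops at a distance that is at most the minimum, and the partition that it
stops with is not much more costly than this distance. -/
theorem GoodBits.isApprox {E : Present P.n} {G : UnitGraph P.n} {ε : ℝ} {s : Config}
    (h : P.GoodBits coin E) (hG : Presents E G) (hε : 0 < ε) (hE : P.E = ⌈1 / ε⌉₊)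
    (ht : minDisagree G ≤ P.t) (hs : P.SearchResult coin E s)
    (h0 : s.mem (0, 0) = s.mem (aCand, 0) / P.cands + s.mem (aCand, 0) / P.cands / P.prec)
    (h1 : s.mem (0, 1) = 1) : IsApprox G ε s.mem := by
  classical
  obtain ⟨Q, hQ⟩ := (minDisagree_spec G).1
  set m := (badPairs G Q).card with hm
  have hmd : minDisagree G = m := by rw [← hQ, disagree_eq_card]
  have hmt : m ≤ P.t := by rw [hmd] at ht; exact_mod_cast ht
  have hmn : m ≤ P.n * P.n := card_badPairs_le G Q
  have hcp := P.cands_pos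
  obtain ⟨k, hk, hkQ⟩ : ∃ k < P.cands, ∀ u v : Fin P.n,
      P.label (refLabel E) k u = P.label (refLabel E) k v ↔ Q u v := by
    refine exists_candidate ⟨Finset.univ.filter fun u => ¬ Clean E Q u, le_min ?_ ?_, ?_⟩
    · exact (card_not_clean_le hG).trans (by omega)
    · simpa using Finset.card_le_univ (Finset.univ.filter fun u => ¬ Clean E Q u)
    · intro u hu
      simpa using hu
  have hker : (Setoid.ker fun v : Fin P.n => P.label (refLabel E) k v) = Q :=
    Setoid.ext fun u v => hkQ u v
  have hgroup : ∀ j, 2 * (P.badGroups coin (posCodes E)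
      (P.label (P.baseLabel coin E) (j % P.cands))).card < P.groups := fun j => by
    rw [badGroups_congr (h.sameKer hG.diag _)]
    exact h.card_bad _ (Nat.mod_lt _ hcp)
  -- the search accepts the optimal candidate with the right distance, if it gets there
  have hdiv : (m * P.cands + k) / P.cands = m := by
    rw [mul_comm, Nat.mul_add_div hcp, Nat.div_eq_of_lt hk, add_zero]
  have hmod : (m * P.cands + k) % P.cands = k := by
    rw [mul_comm, Nat.mul_add_mod, Nat.mod_eq_of_lt hk]
  have hacc : P.Accepts coin (posCodes E) (P.baseLabel coin E) (m * P.cands + k) := by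
    refine le_votes (hgroup _) ?_
    rw [hmod, hdiv, dist_congr (h.sameKer hG.diag _), dist_eq_disagree hG, hker, hQ, hmd]
  have hle : s.mem (aCand, 0) ≤ m * P.cands + k := by
    by_contra hlt
    exact hs.2.1 _ (not_le.1 hlt) hacc
  have hlt : s.mem (aCand, 0) < P.steps := by
    refine hle.trans_lt ?_
    unfold steps
    nlinarith
  obtain ⟨hacc', hlab⟩ := hs.2.2 hlt
  set j := s.mem (aCand, 0) with hj
  set d := j / P.cands with hd
  have hdm : d ≤ m := by rw [← hdiv]; exact Nat.div_le_div_right hle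
  have hout : outPartition P.n s.mem =
      Setoid.ker fun v : Fin P.n => P.label (P.baseLabel coin E) (j % P.cands) v :=
    Setoid.ext fun u v => by
      show s.mem (1, (u : ℕ)) = s.mem (1, (v : ℕ)) ↔ _
      rw [show s.mem (1, (u : ℕ)) = _ from hlab u u.2, show s.mem (1, (v : ℕ)) = _ from hlab v v.2]
      rfl
  have hD : disagree G (outPartition P.n s.mem) ≤ (d + d / P.prec : ℕ) := by
    rw [hout, ← dist_eq_disagree hG]
    exact dist_le_of_votes (hgroup _) hacc'
  have hval : outValue s.mem = ((d + d / P.prec : ℕ) : ℝ) := by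
    rw [outValue, h0, h1, Nat.cast_one, div_one]
  have hup : ((d + d / P.prec : ℕ) : ℝ) ≤ (1 + ε) * minDisagree G := by
    have hdm' : d ≤ P.moves * (P.n * P.n) := by
      rcases Nat.eq_zero_or_pos m with h | h
      · omega
      · have h2 : 1 ≤ P.moves := le_min (by omega) P.one_le_n
        nlinarith
    have h3 := div_prec_le hε hE hdm'
    have h4 : (d : ℝ) ≤ m := by exact_mod_cast hdm
    rw [hmd]
    push_cast
    nlinarith
  have hD' : (disagree G (outPartition P.n s.mem) : ℝ) ≤ ((d + d / P.prec : ℕ) : ℝ) := by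
    have := (Int.cast_le (R := ℝ)).2 hD
    rwa [Int.cast_natCast] at this
  refine ⟨by rw [h1]; exact one_ne_zero, ?_, hval ▸ hup, hD'.trans hup⟩
  rw [hval]
  exact le_trans (Int.cast_le.2 ((minDisagree_spec G).2 _)) hD'

/-! ### The failure probability -/

theorem one_le_width : 1 ≤ P.width := by
  have := P.one_le_n
  exact (lt_width_iff (P := P) 0).2 (by nlinarith)

theorem base_le : P.base ≤ 2 ^ (2 * P.width) := by
  have h1 := sq_lt_two_pow_width (P := P)
  have h2 : 2 ^ 1 ≤ 2 ^ P.width := Nat.pow_le_pow_right two_pos one_le_width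
  rw [two_mul P.width, pow_add]
  unfold base
  nlinarith

theorem cands_le : P.cands ≤ 2 ^ (2 * P.width * P.moves) := by
  rw [pow_mul]
  exact Nat.pow_le_pow_left base_le _

theorem badBits_subset (E : Present P.n) : {coin | ¬ P.GoodBits coin E} ⊆
    (⋃ p ∈ Finset.univ.filter fun p : Fin P.n × Fin P.n =>
      closedNbrs E p.1 ≠ closedNbrs E p.2, {coin | ∑ v ∈ closedNbrs E p.1, P.key coin v =
        ∑ v ∈ closedNbrs E p.2, P.key coin v}) ∪
    ⋃ k ∈ Finset.range P.cands, {coin | P.groups ≤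
      2 * (P.badGroups coin (posCodes E) (P.label (refLabel E) k)).card} := by
  intro coin h
  by_contra hn
  rw [Set.mem_union, not_or] at hn
  obtain ⟨h1, h2⟩ := hn
  simp only [Set.mem_iUnion, Set.mem_ofPred_eq, not_exists] at h1 h2
  refine h ⟨fun u v huv => ?_, fun k hk => ?_⟩
  · exact h1 (u, v) (Finset.mem_filter.2 ⟨Finset.mem_univ _, huv⟩)
  · exact not_le.1 (h2 k (Finset.mem_range.2 hk))

/-- A union bound over the pairs of neighbourhoods and over the candidates. -/
theorem measure_badBits_le (E : Present P.n) :
    coinMeasure {coin | ¬ P.GoodBits coin E} ≤ ENNReal.ofReal (1 / (P.n : ℝ) ^ P.c) := by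
  classical
  have hw := P.one_le_width
  set w := P.width with hwdef
  set q : ENNReal := (2 : ENNReal)⁻¹ ^ ((P.c + 1) * w) with hq
  have hinv : ∀ a : ℕ, (2 : ENNReal) ^ a * 2⁻¹ ^ a = 1 := fun a => by
    rw [← mul_pow, ENNReal.mul_inv_cancel (by simp) (by simp), one_pow]
  have h1 : coinMeasure (⋃ p ∈ Finset.univ.filter fun p : Fin P.n × Fin P.n =>
      closedNbrs E p.1 ≠ closedNbrs E p.2, {coin | ∑ v ∈ closedNbrs E p.1, P.key coin v =
        ∑ v ∈ closedNbrs E p.2, P.key coin v}) ≤ q := by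
    refine (MeasureTheory.measure_biUnion_finset_le _ _).trans ?_
    refine (Finset.sum_le_sum (g := fun _ => (2 : ENNReal)⁻¹ ^ P.keyBits) fun p hp =>
      P.measure_key_collision_le (Finset.mem_filter.1 hp).2).trans ?_
    rw [Finset.sum_const, nsmul_eq_mul]
    have hc : ((Finset.univ.filter fun p : Fin P.n × Fin P.n =>
        closedNbrs E p.1 ≠ closedNbrs E p.2).card : ENNReal) ≤ 2 ^ w := by
      have : (Finset.univ.filter fun p : Fin P.n × Fin P.n =>
        closedNbrs E p.1 ≠ closedNbrs E p.2).card ≤ 2 ^ w :=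
        (Finset.card_le_univ _).trans (by simpa using sq_lt_two_pow_width.le)
      exact_mod_cast this
    refine (mul_le_mul_left hc _).trans_eq ?_
    rw [keyBits, show (P.c + 2) * P.width = w + (P.c + 1) * w by rw [hwdef]; ring, pow_add,
      ← mul_assoc, hinv, one_mul]
  have h2 : coinMeasure (⋃ k ∈ Finset.range P.cands, {coin | P.groups ≤
      2 * (P.badGroups coin (posCodes E) (P.label (refLabel E) k)).card}) ≤ q := by
    refine (MeasureTheory.measure_biUnion_finset_le _ _).trans ?_
    refine (Finset.sum_le_sum fun k _ => measure_bad_le (posCodes_subset E) _).trans ?_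
    rw [Finset.sum_const, nsmul_eq_mul, Finset.card_range]
    have hc : (P.cands : ENNReal) ≤ 2 ^ (2 * w * P.moves) := by exact_mod_cast cands_le
    refine (mul_le_mul_left hc _).trans_eq ?_
    rw [groups, show (2 * P.moves + (P.c + 1)) * P.width = 2 * w * P.moves + (P.c + 1) * w by
      rw [hwdef]; ring, pow_add, ← mul_assoc, hinv, one_mul]
  refine (MeasureTheory.measure_mono (badBits_subset E)).trans
    ((MeasureTheory.measure_union_le _ _).trans ((add_le_add h1 h2).trans ?_))
  have hn : (0 : ℝ) < P.n := by exact_mod_cast P.one_le_n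
  have h3 : (P.n : ℝ) ≤ 2 ^ w := by
    have h4 := sq_lt_two_pow_width (P := P)
    have h5 := P.one_le_n
    have : P.n ≤ 2 ^ w := by nlinarith
    exact_mod_cast this
  have h4 : q + q = ENNReal.ofReal (2 * 2⁻¹ ^ ((P.c + 1) * w)) := by
    rw [← two_mul, ENNReal.ofReal_mul two_pos.le, ENNReal.ofReal_pow (by norm_num),
      ENNReal.ofReal_inv_of_pos two_pos]
    simp [hq]
  rw [h4]
  refine ENNReal.ofReal_le_ofReal ?_
  have h5 : (2 : ℝ) * 2⁻¹ ^ w ≤ 1 := by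
    calc (2 : ℝ) * 2⁻¹ ^ w ≤ 2 * 2⁻¹ ^ 1 := by
          gcongr 2 * ?_
          exact pow_le_pow_of_le_one (by norm_num) (by norm_num) hw
      _ = 1 := by norm_num
  calc (2 : ℝ) * 2⁻¹ ^ ((P.c + 1) * w) = (2 * 2⁻¹ ^ w) * (2⁻¹ ^ w) ^ P.c := by
        rw [← pow_mul, mul_assoc, ← pow_add]
        ring_nf
    _ ≤ 1 * (2⁻¹ ^ w) ^ P.c := by gcongr
    _ = 1 / (2 ^ w) ^ P.c := by rw [one_mul, inv_pow, inv_pow, one_div]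
    _ ≤ 1 / (P.n : ℝ) ^ P.c := by gcongr

end Params


namespace Params

/-! ### The space bound -/

variable {P : Params}

/-- Numbers that fit into about `a * width` bits. -/
def Small (P : Params) (a x : ℕ) : Prop := x ≤ 2 ^ (a * P.width)

namespace Small

variable {a b x y : ℕ}

theorem mono (h : P.Small a x) (hab : a ≤ b) : P.Small b x :=
  h.trans (Nat.pow_le_pow_right two_pos (Nat.mul_le_mul_right _ hab))

theorem mul (h : P.Small a x) (h' : P.Small b y) : P.Small (a + b) (x * y) := by
  unfold Small at *
  rw [add_mul, pow_add]
  exact Nat.mul_le_mul h h'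

theorem of_le_two_pow (h : x ≤ 2 ^ a) : P.Small a x :=
  h.trans (Nat.pow_le_pow_right two_pos (Nat.le_mul_of_pos_right _ one_le_width))

theorem add (h : P.Small a x) (h' : P.Small b y) : P.Small (a + b + 1) (x + y) := by
  have h1 := (h.mono (Nat.le_add_right a b)).trans le_rfl
  have h2 := (h'.mono (Nat.le_add_left b a)).trans le_rfl
  have h3 : P.Small 1 2 := of_le_two_pow le_rfl
  refine le_trans ?_ (mul (a := a + b) le_rfl h3)
  omega

theorem size_le (h : P.Small a x) : Nat.size x ≤ (a + 1) * P.width := by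
  refine Nat.size_le.2 (h.trans_lt (Nat.pow_lt_pow_right one_lt_two ?_))
  have := P.one_le_width
  nlinarith

end Small

theorem small_sq : P.Small 1 (P.n * P.n) := by
  rw [Small, one_mul]
  exact sq_lt_two_pow_width.le

theorem small_n : P.Small 1 P.n := (Nat.le_mul_self _).trans small_sq

theorem small_width : P.Small 1 P.width := by
  rw [Small, one_mul]
  exact Nat.lt_two_pow_self.le

theorem small_const (a : ℕ) : P.Small a a := .of_le_two_pow Nat.lt_two_pow_self.le

theorem moves_le : P.moves ≤ P.n := min_le_right _ _

theorem small_moves : P.Small 1 P.moves := moves_le.trans small_n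

theorem small_prec : P.Small 4 P.prec :=
  (min_le_right _ _).trans ((small_moves.mul small_sq).add (small_const 1))

theorem small_size : P.Small 296 P.size := (small_const 288).mul (small_prec.mul small_prec)

theorem small_groups : P.Small (P.c + 7) P.groups :=
  ((((small_const 2).mul small_moves).add (small_const (P.c + 1))).mul small_width).mono (by omega)

theorem small_reps : P.Small (P.c + 303) P.reps := (small_groups.mul small_size).mono (by omega)

theorem small_two_pow_keyBits : P.Small (P.c + 2) (2 ^ P.keyBits) := le_rfl

theorem one_le_reps : 1 ≤ P.reps := by
  have h1 := P.one_le_width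
  have h2 := P.size_pos
  have h3 : 0 < P.groups := Nat.mul_pos (by omega) h1
  exact Nat.mul_pos h3 h2

theorem len_le (x : ℕ) : P.budget.len x ≤ 5 * P.n + 2 * (P.reps * (P.width * P.width)) := by
  have h1 := P.one_le_n
  have h2 := P.one_le_width
  have h3 := P.one_le_reps
  have h4 : P.width ≤ P.width * P.width := Nat.le_mul_self _
  have h5 : P.width * P.width ≤ P.reps * (P.width * P.width) := Nat.le_mul_of_pos_left _ h3
  have h6 : P.reps ≤ P.reps * (P.width * P.width) :=
    Nat.le_mul_of_pos_right _ (Nat.mul_pos h2 h2)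
  simp only [budget]
  split <;> omega

theorem small_len (x : ℕ) : P.Small (P.c + 400) (P.budget.len x) := by
  have h1 : P.Small (P.c + 400) P.n := small_n.mono (by omega)
  have h2 : P.Small (P.c + 400) (P.width + 1) :=
    (small_width.add (small_const 1)).mono (by omega)
  have h3 : P.Small (P.c + 400) (P.reps * (P.width * P.width)) :=
    (small_reps.mul (small_width.mul small_width)).mono (by omega)
  have h4 : P.Small (P.c + 400) P.reps := small_reps.mono (by omega)
  have h5 : P.Small (P.c + 400) 5 := (small_const 5).mono (by omega)
  have h6 : P.Small (P.c + 400) 2 := (small_const 2).mono (by omega)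
  have h7 : P.Small (P.c + 400) 1 := (small_const 1).mono (by omega)
  simp only [budget]
  split <;> assumption

/-- The only long numbers are the scalar variables that range over the candidates. -/
theorem small_val (x : ℕ) : P.Small (P.c + 400) (P.budget.val x) ∨
    (P.budget.len x = 1 ∧ P.Small (2 * P.n + 4) (P.budget.val x)) := by
  have hc : P.Small (2 * P.n) P.cands := by
    refine cands_le.trans (Nat.pow_le_pow_right two_pos ?_)
    have := P.moves_le
    calc 2 * P.width * P.moves = 2 * P.moves * P.width := by ring
      _ ≤ 2 * P.n * P.width := by gcongr
  have h1 : P.Small (P.c + 400) 1 := (small_const 1).mono (by omega)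
  have hn : P.Small (P.c + 400) P.n := small_n.mono (by omega)
  have hnn : P.Small (P.c + 400) (P.n * P.n) := small_sq.mono (by omega)
  have hg : P.Small (P.c + 400) P.groups := small_groups.mono (by omega)
  have hk : P.Small (P.c + 400) (2 ^ P.keyBits) := small_two_pow_keyBits.mono (by omega)
  have hw := small_width (P := P)
  have hn1 := small_n.add (P := P) (small_const 1)
  simp only [budget]
  split
  · exact .inl (((small_const 2).mul (small_sq.add (small_const 1))).mono (by omega))
  · exact .inl ((small_n.add (hn1.mul small_two_pow_keyBits)).mono (by omega))
  · exact .inl (hw.mono (by omega))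
  · exact .inl ((show P.Small 1 (2 ^ P.width) by rw [Small, one_mul]).mono (by omega))
  · exact .inr ⟨rfl, hc.mono (by omega)⟩
  · exact .inl hk
  · exact .inl h1
  · exact .inl hnn
  · exact .inl ((small_n.mul small_two_pow_keyBits).mono (by omega))
  · exact .inl hnn
  · exact .inl hn
  · exact .inl h1
  · exact .inl hn
  · exact .inl (((small_const (P.c + 2)).mul hw).mono (by omega))
  · exact .inl ((small_reps.mul (hw.mul hw)).mono (by omega))
  · exact .inl h1
  · exact .inl ((hw.mul hw).mono (by omega))
  · exact .inl hnn
  · exact .inl (small_reps.mono (by omega))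
  · exact .inr ⟨rfl, ((small_sq.add (small_const 1)).mul hc).mono (by omega)⟩
  · exact .inl h1
  · exact .inr ⟨rfl, hc.mono (by omega)⟩
  · exact .inl hg
  · exact .inl (small_size.mono (by omega))
  · exact .inl hnn
  · exact .inl hnn
  · exact .inl ((small_size.mul (((small_const 9).mul small_sq).mul small_sq)).mono (by omega))
  · exact .inl hg
  · exact .inl (Nat.zero_le _)

theorem space_le : P.budget.space ≤ 28 * (1000 * (P.c + 401) *
    (P.n + P.reps * (P.width * P.width)) * P.width) := by
  have hw := P.one_le_width
  have hn := P.one_le_n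
  set w := P.width with hwdef
  set A := P.n + P.reps * (w * w) with hA
  have key : ∀ x ∈ Finset.range 28, P.budget.len x * (Nat.size x + Nat.size (P.budget.len x) +
      Nat.size (P.budget.val x)) ≤ 1000 * (P.c + 401) * A * w := by
    intro x hx
    have hx5 : Nat.size x ≤ 5 := Nat.size_le.2 (by have := Finset.mem_range.1 hx; omega)
    have hl : P.budget.len x ≤ 5 * P.n + 2 * (P.reps * (w * w)) := P.len_le x
    have hl' := (P.small_len x).size_le
    have hlA : P.budget.len x ≤ 5 * A := by omega
    rcases P.small_val x with hv | ⟨h1, hv⟩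
    · have hv' := hv.size_le
      calc _ ≤ 5 * A * (5 * (P.c + 401) * w + (P.c + 401) * w + (P.c + 401) * w) := by
            gcongr
            · nlinarith
        _ ≤ _ := by nlinarith [Nat.zero_le (A * (P.c + 401) * w)]
    · have hv' := hv.size_le
      rw [h1] at hl' ⊢
      have h6 : P.n ≤ A := Nat.le_add_right _ _
      have h7 : 1 ≤ A := hn.trans h6
      have h8 : 1 ≤ (P.c + 401) * A * w :=
        Nat.mul_pos (Nat.mul_pos (by omega) h7) hw
      have h9 : (P.c + 401) * w ≤ (P.c + 401) * A * w := by nlinarith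
      have h10 : (2 * P.n + 5) * w ≤ 7 * ((P.c + 401) * A * w) := by
        have : 2 * P.n + 5 ≤ 7 * ((P.c + 401) * A) := by nlinarith
        nlinarith
      have h11 : Nat.size (P.budget.val x) ≤ (2 * P.n + 5) * w := hv'
      rw [one_mul]
      have h12 : 1000 * (P.c + 401) * A * w = 1000 * ((P.c + 401) * A * w) := by ring
      rw [h12]
      have h13 : Nat.size 1 ≤ (P.c + 401) * w := hl'
      omega
  unfold Budget.space
  refine (Finset.sum_le_sum key).trans ?_
  rw [Finset.sum_const, Finset.card_range, smul_eq_mul]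

theorem width_le_log (P : Params) : (P.width : ℝ) ≤ 4 * Real.log (P.n + 2) := by
  have hn : (1 : ℝ) ≤ P.n := by exact_mod_cast P.one_le_n
  have h1 : 2 ^ (P.width - 1) ≤ P.n * P.n :=
    (lt_width_iff _).1 (Nat.sub_lt P.one_le_width one_pos)
  have h2 : ((P.width - 1 : ℕ) : ℝ) * Real.log 2 ≤ 2 * Real.log P.n := by
    have h3 : ((2 : ℝ) ^ (P.width - 1)) ≤ (P.n : ℝ) ^ 2 := by
      rw [sq]; exact_mod_cast h1
    have := Real.log_le_log (by positivity) h3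
    rwa [Real.log_pow, Real.log_pow, Nat.cast_ofNat] at this
  rw [Nat.cast_sub P.one_le_width, Nat.cast_one] at h2
  have h4 : Real.log P.n ≤ Real.log (P.n + 2) := Real.log_le_log (by linarith) (by linarith)
  have h5 : 1 ≤ Real.log (P.n + 2) := by
    rw [Real.le_log_iff_exp_le (by linarith)]
    exact (Real.exp_one_lt_d9.le).trans (by linarith)
  have h6 := Real.log_two_gt_d9
  have h7 : (1 : ℝ) ≤ P.width := by exact_mod_cast P.one_le_width
  nlinarith

/-- The number of sketches, up to a logarithmic factor. It is linear in `n` if the precision is `1`,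
since there are at most `n` moves. Otherwise `0 < t` and `ε < 1`; there are at most `2 * t` moves,
and the precision is at most `2 / ε`. -/
theorem max_moves_mul_prec_sq_le {ε : ℝ} (hε : 0 < ε) (hE : P.E = ⌈1 / ε⌉₊) :
    max (P.moves : ℝ) 1 * (P.prec * P.prec) ≤ 8 * (P.n + P.t / ε ^ 2) := by
  have hn : (1 : ℝ) ≤ P.n := by exact_mod_cast P.one_le_n
  have hm : (P.moves : ℝ) ≤ P.n := by exact_mod_cast P.moves_le
  have hq : (1 : ℝ) ≤ P.prec := by exact_mod_cast P.one_le_prec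
  have ht0 : (0 : ℝ) ≤ P.t / ε ^ 2 := by positivity
  by_cases h1 : P.prec = 1
  · rw [h1]
    have : max (P.moves : ℝ) 1 ≤ P.n := max_le hm hn
    push_cast
    linarith
  have ht : 1 ≤ P.t := by
    by_contra h
    have h2 : P.moves = 0 := by
      unfold moves
      omega
    refine h1 (le_antisymm ?_ P.one_le_prec)
    rw [prec, h2, zero_mul, zero_add]
    exact min_le_right _ _
  have hqE : P.prec ≤ P.E := min_le_left _ _
  have hE2 : 2 ≤ P.E := by
    have := P.one_le_prec
    omega
  have hε1 : 1 < 1 / ε := by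
    have : 1 < ⌈1 / ε⌉₊ := by omega
    simpa using Nat.lt_ceil.1 this
  have hq2 : (P.prec : ℝ) ≤ 2 * (1 / ε) := by
    have h3 : (P.E : ℝ) < 1 / ε + 1 := by
      rw [hE]
      exact Nat.ceil_lt_add_one (by positivity)
    have h4 : (P.prec : ℝ) ≤ P.E := by exact_mod_cast hqE
    linarith
  have hm2 : max (P.moves : ℝ) 1 ≤ 2 * P.t := by
    have h5 : P.moves ≤ 2 * P.t := min_le_left _ _
    have h6 : (P.moves : ℝ) ≤ 2 * P.t := by exact_mod_cast h5
    have h7 : (1 : ℝ) ≤ P.t := by exact_mod_cast ht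
    exact max_le h6 (by linarith)
  calc max (P.moves : ℝ) 1 * (P.prec * P.prec)
      ≤ 2 * P.t * (2 * (1 / ε) * (2 * (1 / ε))) := by gcongr
    _ = 8 * (P.t / ε ^ 2) := by field_simp; ring
    _ ≤ 8 * (P.n + P.t / ε ^ 2) := by linarith

theorem space_le_log {ε : ℝ} (hε : 0 < ε) (hE : P.E = ⌈1 / ε⌉₊) :
    (P.budget.space : ℝ) ≤ 28 * (1000 * (P.c + 401) * (1 + 2304 * (P.c + 3)) * 256) *
      (P.n + P.t / ε ^ 2) * Real.log (P.n + 2) ^ 4 := by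
  have hw : (1 : ℝ) ≤ P.width := by exact_mod_cast P.one_le_width
  have hn : (1 : ℝ) ≤ P.n := by exact_mod_cast P.one_le_n
  have hm := P.max_moves_mul_prec_sq_le hε hE
  have ht0 : (0 : ℝ) ≤ P.t / ε ^ 2 := by positivity
  set w : ℝ := (P.width : ℝ) with hwdef
  set B : ℝ := P.n + P.t / ε ^ 2 with hB
  have hB0 : 0 ≤ B := by linarith
  have hreps : (P.reps : ℝ) ≤ 2304 * (P.c + 3) * B * w := by
    have h1 : (P.reps : ℝ) = (2 * P.moves + (P.c + 1)) * w * (288 * (P.prec * P.prec)) := by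
      rw [hwdef]
      unfold reps groups size
      push_cast
      ring
    have h2 : (2 * P.moves + (P.c + 1) : ℝ) ≤ (P.c + 3) * max (P.moves : ℝ) 1 := by
      have h3 := le_max_left (P.moves : ℝ) 1
      have h4 := le_max_right (P.moves : ℝ) 1
      have h5 : (0 : ℝ) ≤ P.c := Nat.cast_nonneg _
      nlinarith
    rw [h1]
    calc _ ≤ (P.c + 3) * max (P.moves : ℝ) 1 * w * (288 * (P.prec * P.prec)) := by gcongr
      _ = 288 * (P.c + 3) * w * (max (P.moves : ℝ) 1 * (P.prec * P.prec)) := by ring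
      _ ≤ 288 * (P.c + 3) * w * (8 * B) := by gcongr
      _ = _ := by ring
  have hs : (P.budget.space : ℝ) ≤ 28 * (1000 * (P.c + 401) * (P.n + P.reps * (w * w)) * w) := by
    have h1 := (Nat.cast_le (α := ℝ)).2 P.space_le
    simpa only [Nat.cast_mul, Nat.cast_add, Nat.cast_ofNat] using h1
  have hnB : (P.n : ℝ) ≤ B * w ^ 3 := by
    have h1 : (1 : ℝ) ≤ w ^ 3 := one_le_pow₀ hw
    nlinarith
  calc (P.budget.space : ℝ) ≤ _ := hs
    _ ≤ 28 * (1000 * (P.c + 401) * (B * w ^ 3 + 2304 * (P.c + 3) * B * w * (w * w)) * w) := by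
        gcongr
    _ = 28 * (1000 * (P.c + 401) * (1 + 2304 * (P.c + 3))) * B * w ^ 4 := by ring
    _ ≤ 28 * (1000 * (P.c + 401) * (1 + 2304 * (P.c + 3))) * B *
        (4 * Real.log (P.n + 2)) ^ 4 := by
        gcongr
        exact P.width_le_log
    _ = _ := by ring

/-! ### The time bound -/

/-- Quantities that are polynomially bounded in `n * ⌈1/ε⌉`, for fixed `c` and `t`. -/
def Poly (c t : ℕ) (f : Params → ℕ) : Prop :=
  ∃ D, ∀ P : Params, P.c = c → P.t = t → f P ≤ D * (P.n * P.E) ^ D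

theorem one_le_mul (P : Params) : 1 ≤ P.n * P.E := Nat.mul_pos P.one_le_n P.one_le_E

namespace Poly

variable {c t : ℕ} {f g : Params → ℕ}

theorem of_le (hg : Poly c t g) (h : ∀ P : Params, P.c = c → P.t = t → f P ≤ g P) : Poly c t f :=
  hg.imp fun _ hD P hc ht => (h P hc ht).trans (hD P hc ht)

theorem const (k : ℕ) : Poly c t fun _ => k :=
  ⟨k, fun P _ _ => Nat.le_mul_of_pos_right _ (Nat.pow_pos P.one_le_mul)⟩

theorem nodes : Poly c t n :=
  ⟨1, fun P _ _ => by rw [pow_one, one_mul]; exact Nat.le_mul_of_pos_right _ P.one_le_E⟩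

theorem precision : Poly c t E :=
  ⟨1, fun P _ _ => by rw [pow_one, one_mul]; exact Nat.le_mul_of_pos_left _ P.one_le_n⟩

theorem add (hf : Poly c t f) (hg : Poly c t g) : Poly c t fun P => f P + g P := by
  obtain ⟨D, hD⟩ := hf
  obtain ⟨D', hD'⟩ := hg
  refine ⟨D + D', fun P hc ht => ?_⟩
  have h1 := P.one_le_mul
  rw [add_mul]
  refine add_le_add ((hD P hc ht).trans ?_) ((hD' P hc ht).trans ?_)
  · exact Nat.mul_le_mul_left _ (Nat.pow_le_pow_right h1 (by omega))
  · exact Nat.mul_le_mul_left _ (Nat.pow_le_pow_right h1 (by omega))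

theorem mul (hf : Poly c t f) (hg : Poly c t g) : Poly c t fun P => f P * g P := by
  obtain ⟨D, hD⟩ := hf
  obtain ⟨D', hD'⟩ := hg
  refine ⟨D * D' + D + D', fun P hc ht => ?_⟩
  have h1 := P.one_le_mul
  calc f P * g P ≤ (D * (P.n * P.E) ^ D) * (D' * (P.n * P.E) ^ D') :=
        Nat.mul_le_mul (hD P hc ht) (hD' P hc ht)
    _ = D * D' * (P.n * P.E) ^ (D + D') := by ring
    _ ≤ (D * D' + D + D') * (P.n * P.E) ^ (D * D' + D + D') :=
        Nat.mul_le_mul (by omega) (Nat.pow_le_pow_right h1 (by omega))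

theorem pow (hf : Poly c t f) (k : ℕ) : Poly c t fun P => f P ^ k := by
  induction k with
  | zero => simpa using const 1
  | succ k ih => simpa only [pow_succ] using ih.mul hf

theorem width : Poly c t width :=
  (nodes.mul nodes).of_le fun _ _ _ => Nat.size_le.2 Nat.lt_two_pow_self

theorem keyBits : Poly c t keyBits :=
  ((const (c + 2)).mul width).of_le fun P hc _ => by rw [Params.keyBits, hc]

theorem moves : Poly c t moves :=
  (const (2 * t)).of_le fun P _ ht => by rw [Params.moves, ht]; exact min_le_left _ _

theorem groups : Poly c t groups :=
  ((((const 2).mul moves).add (const (c + 1))).mul width).of_le fun P hc _ => by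
    rw [Params.groups, hc]

theorem size : Poly c t size :=
  ((const 288).mul (precision.mul precision)).of_le fun P _ _ => by
    have h : P.prec ≤ P.E := min_le_left _ _
    rw [Params.size]
    gcongr

theorem reps : Poly c t reps := groups.mul size

theorem cands : Poly c t cands :=
  (((const 2).mul (nodes.mul nodes)).pow (2 * t)).of_le fun P _ ht => by
    rw [Params.cands, ← ht]
    exact Nat.pow_le_pow_right base_pos (min_le_left _ _)

theorem steps : Poly c t steps := ((nodes.mul nodes).add (const 1)).mul cands

theorem updateTime : Poly c t updateTime :=
  (reps.mul (((width.mul width).mul (const 3)).add (const 6))).add (const 6)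

theorem sumTime : Poly c t sumTime :=
  ((nodes.mul nodes).mul (((width.mul width).mul (const 3)).add (const 7))).add (const 4)

theorem voteTime : Poly c t voteTime :=
  (groups.mul ((size.mul (sumTime.add (const 4))).add (const 6))).add (const 3)

theorem stepTime : Poly c t stepTime :=
  (((((nodes.mul (const 3)).add (const 2)).add (const 1)).add
    ((moves.mul (const 4)).add (const 2))).add voteTime).add (const 2)

end Poly

/-- For fixed `c` and `t`, the program runs in polynomial time. -/
theorem exists_totalTime_le (c t : ℕ) : ∃ D, ∀ P : Params, P.c = c → P.t = t → ∀ l,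
    P.totalTime l ≤ D * (P.n * P.E) ^ D * (l + 1) := by
  have h : Poly c t fun P => P.totalTime 0 + P.updateTime + 2 :=
    ((((Poly.width.mul (.const 3)).add (.const 2)).add (((Poly.moves.mul (.const 3)).add
      (.const 3)).add (((Poly.nodes.mul ((Poly.keyBits.mul (.const 4)).add (.const 4))).add
        (.const 2)).add (((Poly.reps.mul (Poly.width.mul .width)).mul (.const 4)).add
          (.const 2))))).add ((((Poly.const 0).mul (Poly.updateTime.add (.const 2))).add
            (.const 2)).add (((Poly.steps.mul (Poly.stepTime.add (.const 1))).add
              (.const 1)).add (.const 2)))).add .updateTime |>.add (.const 2)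
  obtain ⟨D, hD⟩ := h
  refine ⟨D, fun P hc ht l => ?_⟩
  refine le_trans ?_ (Nat.mul_le_mul_right _ (hD P hc ht))
  have h1 : P.totalTime l = P.totalTime 0 + l * (P.updateTime + 2) := by
    unfold totalTime
    ring
  rw [h1]
  nlinarith

end Params

end CorrClust

theorem mainTheorem7 (c : ℕ) :
    ∃ (p : CorrClust.Prog) (C : ℝ) (k : ℕ), ∀ t : ℕ, ∃ D : ℕ,
      ∀ (n : ℕ) (_hn : 1 ≤ n) (ε : ℝ) (_hε : 0 < ε) (G : CorrClust.UnitGraph n)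
        (σ : List (CorrClust.Update n)),
        CorrClust.IsStreamOf σ G → CorrClust.minDisagree G ≤ (t : ℤ) →
          (∀ coin : ℕ → Bool, ∃ (M : CorrClust.Memory) (T S : ℕ),
            CorrClust.Runs p n t ε σ coin M T S ∧
            (S : ℝ) ≤ C * (n + t / ε ^ 2) * Real.log (n + 2) ^ k ∧
            T ≤ D * (n * ⌈1 / ε⌉₊) ^ D * (σ.length + 1)) ∧
          CorrClust.coinMeasure {coin | ¬ ∃ (M : CorrClust.Memory) (T S : ℕ),
            CorrClust.Runs p n t ε σ coin M T S ∧ CorrClust.IsApprox G ε M} ≤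
              ENNReal.ofReal (1 / (n : ℝ) ^ c) := by
  refine ⟨CorrClust.mainProg c,
    28 * (1000 * (c + 401) * (1 + 2304 * (c + 3)) * 256), 4, fun t => ?_⟩
  obtain ⟨D, hD⟩ := CorrClust.Params.exists_totalTime_le c t
  refine ⟨D, fun n hn ε hε G σ hσ ht => ?_⟩
  obtain ⟨E, hl, hG⟩ := hσ
  let P : CorrClust.Params := ⟨c, n, t, ⌈1 / ε⌉₊, hn, Nat.ceil_pos.2 (by positivity)⟩
  have hpres : CorrClust.Presents E G := ⟨hl.diag fun _ => rfl, hG⟩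
  refine ⟨fun coin => ?_, ?_⟩
  · obtain ⟨s, T, S, hex, hT, hS, -⟩ :=
      CorrClust.Params.mainProg_spec (P := P) (coin := coin) hl
    refine ⟨s.mem, T, S, ⟨s, hex, rfl⟩, ?_, hT.trans (hD P rfl rfl _)⟩
    exact (Nat.cast_le.2 hS).trans (P.space_le_log hε rfl)
  · refine (MeasureTheory.measure_mono fun coin hc => ?_).trans (P.measure_badBits_le E)
    refine fun hgood => hc ?_
    obtain ⟨s, T, S, hex, -, -, -, hs, h0, h1⟩ :=
      CorrClust.Params.mainProg_spec (P := P) (coin := coin) hl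
    exact ⟨s.mem, T, S, ⟨s, hex, rfl⟩, hgood.isApprox hpres hε rfl ht hs h0 h1⟩
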